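/- Let $\mathbb K=\mathbb R$ or $\mathbb C$ (smooth means holomorphic if $\mathbb K=\mathbb C$), let $N,m\ge 0$ be integers and $\alpha\in\mathbb K$, $\alpha\neq 0$. **Algebras.** In the open-end case let $\mathbf g=gl(N)$ be the algebra of $N\times N$ matrices over $\mathbb K$ with $\langle X,Y\rangle=\mathrm{tr}(XY)$, and let $\mathbf g_p$ be the span of the matrix units $E_{jk}$ with $j-k=p$. In the periodic case let $\mathbf g$ be the twisted loop algebra of formal series $X(\lambda)=\sum_p\lambda^p\sum_{j-k\equiv p\,(\mathrm{mod}\,N)}x^{(p)}_{jk}E_{jk}$ with finitely many positive powers of $\lambda$, with $\langle X,Y\rangle=\mathrm{tr}(X(\lambda)Y(\lambda))_0$, where the subscript $0$ denotes the free term, and let $\mathbf g_p$ be the subspace of the elements $\lambda^pX^{(p)}$. Let $P_{>0},P_{\ge0},P_{<0},P_0$ be the projections onto the sums of the $\mathbf g_p$ with $p>0$, $p\ge 0$, $p<0$, $p=0$ along the sum of the other $\mathbf g_p$. A function on $\mathbf g$ or $\mathbf g\times\mathbf g$ is called smooth near a point $x$ if, for every $P$ such that $x$ has no components of degree $>P$,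 near $x$ its restriction to the elements without components of degree $>P$ is a smooth function of finitely many matrix coefficients (for $gl(N)$ this is smoothness in the usual sense). The gradient is defined by $\langle\nabla\varphi(L),X\rangle=\frac{d}{d\varepsilon}\varphi(L+\varepsilon X)|_{\varepsilon=0}$ for all $X$, and $d\varphi(L)=L\nabla\varphi(L)$, $d'\varphi(L)=\nabla\varphi(L)L$; on $\mathbf g\times\mathbf g$ one uses the componentwise product and $\langle X_1,Y_1\rangle+\langle X_2,Y_2\rangle$. **Operators.** Put $R=P_{\ge0}-P_{<0}$, $R_0=P_{>0}-P_{<0}$, let $W(E_{kk})=\sum_{j<k}E_{jj}-\sum_{j>k}E_{jj}$, $W=W\circ P_0$, and $$A_1=R_0+W,\quad A_2=R_0-W,\quad S=P_0-W,\quad S^*=P_0+W,$$ $$\mathbf A_1=\begin{pmatrix}A_1&-S\\S^*&A_1\end{pmatrix},\quad \mathbf A_2=\begin{pmatrix}A_2&-S^*\\S&A_2\end{pmatrix},\quad \mathbf S=\begin{pmatrix}S&S\\S&-S^*\end{pmatrix},\quad \mathbf S^*=\begin{pmatrix}S^*&S^*\\S^*&-S\end{pmatrix}.$$ For operators $A_1,A_2,S$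 the bracket $\mathrm{PB}_2(A_1,A_2,S)$ is $$\{\varphi,\psi\}=\tfrac12\langle A_1(d'\varphi),d'\psi\rangle-\tfrac12\langle A_2(d\varphi),d\psi\rangle+\tfrac12\langle S(d\varphi),d'\psi\rangle-\tfrac12\langle S^*(d'\varphi),d\psi\rangle .$$ **Lax matrices.** Put $\mathcal E=\sum_kE_{k+1,k}$ in the open-end case and $\mathcal E=\lambda\sum_kE_{k+1,k}$ in the periodic case (subscripts modulo $N$). For fields $d=(d_k)_{1\le k\le N}$ and $c^{(j)}=(c^{(j)}_k)_{1\le k\le N}$, $1\le j\le m$ (only $1\le k\le N-j$ in the open-end case), put $$L=\sum_k(1+\alpha d_k)E_{kk}+\alpha\mathcal E,\qquad U=I-\alpha\sum_{j=1}^m\lambda^{-j}\sum_kc_k^{(j)}E_{k,k+j}$$ (without the powers of $\lambda$ in the open-end case). Let $\mathbf{RT}_{m+1}\subset\mathbf g\times\mathbf g$ be the set of all pairs $(L,U^{-1})$ with $L\in\alpha\mathcal E\oplus\mathbf g_0$ and $U\in I\oplus\bigoplus_{j=1}^m\mathbf g_{-j}$, $U$ invertible in $\mathbf g$. **Theorem.**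 The operators $A_1,A_2,\mathbf A_1,\mathbf A_2$ are skew-symmetric, $S^*$ and $\mathbf S^*$ are the adjoints of $S$ and $\mathbf S$, and $\alpha\,\mathrm{PB}_2(A_1,A_2,S)$ and $\alpha\,\mathrm{PB}_2(\mathbf A_1,\mathbf A_2,\mathbf S)$ are Poisson brackets on the smooth functions on $\mathbf g$ and $\mathbf g\times\mathbf g$, respectively. Supply $\mathbf g\times\mathbf g$ with the latter bracket. (a) The map $(d,c^{(1)},\dots,c^{(m)})\mapsto(L,U^{-1})$ is a smooth embedding with image $\mathbf{RT}_{m+1}$, and $\mathbf{RT}_{m+1}$ is a Poisson submanifold of $\mathbf g\times\mathbf g$: all Hamiltonian vector fields are tangent to it. (b) The monodromy maps $\mathbf M_1:(L,V)\mapsto LV$ and $\mathbf M_2:(L,V)\mapsto VL$ from $\mathbf g\times\mathbf g$ to $\mathbf g$ are Poisson, if $\mathbf g$ is equipped with the bracket $\alpha\,\mathrm{PB}_2(A_1,A_2,S)$. (c) Let $\varphi$ be an $\mathrm{Ad}$-invariant function on $\mathbf g$, i.e. $\varphi(gXg^{-1})=\varphi(X)$ for all $X$ and all invertible $g\in\mathbf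 g$. At all points $(L,U^{-1})$, $U$ invertible, such that $\varphi$ is smooth near $LU^{-1}$ and $U^{-1}L$, the Hamiltonian vector field $\{\mathrm H,\cdot\}$ of each of the Hamilton functions $\mathrm H=\varphi\circ\mathbf M_1$, $\mathrm H=\varphi\circ\mathbf M_2$ is given by the Lax triad $$\dot L=LC_2-C_1L,\qquad \dot U=UC_2-C_1U,$$ $$C_1=\tfrac{\alpha}{2}R\bigl(d\varphi(LU^{-1})\bigr),\qquad C_2=\tfrac{\alpha}{2}R\bigl(d\varphi(U^{-1}L)\bigr),$$ where $\dot U=-U\dot VU$ for $V=U^{-1}$. Accordingly, differentiable curves $L(t),U(t)$ with differentiable $U(t)^{-1}$ satisfy Hamilton's equations $\dot x=\{\mathrm H,x\}$ for $x=(L,U^{-1})$ at a time $t$ if and only if they satisfy the Lax triad at that time. -/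

import Mathlib

open Topology
open scoped ContDiff

namespace RelToda

noncomputable section

/-! ## The two matrix algebras -/

/-- Open-end or periodic boundary conditions. -/
inductive Boundary
  | openEnd
  | periodic

/-- The formal Laurent series in `λ⁻¹` over `𝕜`, that is, the formal series `∑ₚ xₚ λᵖ` with finitely
many positive powers of `λ`. The coefficient `xₚ` is `coeff (-p)`. -/
def Series (𝕜 : Type*) [RCLike 𝕜] : Type _ := HahnSeries ℤ 𝕜

instance (𝕜 : Type*) [RCLike 𝕜] : CommRing (Series 𝕜) :=
  inferInstanceAs (CommRing (HahnSeries ℤ 𝕜))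

instance (𝕜 : Type*) [RCLike 𝕜] : Algebra 𝕜 (Series 𝕜) :=
  (HahnSeries.instAlgebra : Algebra 𝕜 (HahnSeries ℤ 𝕜))

/-- The coefficient of `λᵖ`. -/
def Series.lam {𝕜 : Type*} [RCLike 𝕜] (p : ℤ) : Series 𝕜 →ₗ[𝕜] 𝕜 where
  toFun f := HahnSeries.coeff f (-p)
  map_add' _ _ := rfl
  map_smul' _ _ := rfl

/-- The series `x λᵖ`. -/
def Series.monomial {𝕜 : Type*} [RCLike 𝕜] (p : ℤ) (x : 𝕜) : Series 𝕜 :=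
  (HahnSeries.single (-p) x : HahnSeries ℤ 𝕜)

theorem Series.lam_monomial {𝕜 : Type*} [RCLike 𝕜] (p q : ℤ) (x : 𝕜) :
    Series.lam q (Series.monomial p x) = if q = p then x else 0 := by
  change (HahnSeries.single (-p) x : HahnSeries ℤ 𝕜).coeff (-q) = _
  rw [HahnSeries.coeff_single]
  simp

theorem Series.lam_algebraMap {𝕜 : Type*} [RCLike 𝕜] (q : ℤ) (x : 𝕜) :
    Series.lam q (algebraMap 𝕜 (Series 𝕜) x) = if q = 0 then x else 0 := by
  change (HahnSeries.C x : HahnSeries ℤ 𝕜).coeff (-q) = _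
  rw [HahnSeries.C_apply, HahnSeries.coeff_single]
  simp

theorem Series.exists_of_lam_mul_ne_zero {𝕜 : Type*} [RCLike 𝕜] {f g : Series 𝕜} {p : ℤ}
    (h : Series.lam p (f * g) ≠ 0) :
    ∃ q r : ℤ, q + r = p ∧ Series.lam q f ≠ 0 ∧ Series.lam r g ≠ 0 := by
  have key : ∀ f g : HahnSeries ℤ 𝕜, (f * g).coeff (-p) ≠ 0 →
      ∃ q r : ℤ, q + r = p ∧ f.coeff (-q) ≠ 0 ∧ g.coeff (-r) ≠ 0 := by
    intro f g h
    rw [HahnSeries.coeff_mul] at h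
    obtain ⟨q, hq, hq'⟩ := Finset.exists_ne_zero_of_sum_ne_zero h
    have h3 : q.1 + q.2 = -p := (Finset.mem_antidiagonal.1 hq).2.2
    refine ⟨-q.1, -q.2, by omega, ?_, ?_⟩
    · rw [neg_neg]
      exact left_ne_zero_of_mul hq'
    · rw [neg_neg]
      exact right_ne_zero_of_mul hq'
  exact key f g h

/-- The twisted loop algebra over `gl(N)`. Its elements are formal series
`X(λ) = ∑ₚ λᵖ X⁽ᵖ⁾` with finitely many positive powers of `λ`, such that the `(j,k)` entry of
`X⁽ᵖ⁾` vanishes unless `j - k ≡ p (mod N)`. -/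
def twistedLoop (𝕜 : Type*) [RCLike 𝕜] (N : ℕ) :
    Subalgebra 𝕜 (Matrix (Fin N) (Fin N) (Series 𝕜)) where
  carrier := {X | ∀ (p : ℤ) (j k : Fin N),
    Series.lam p (X j k) ≠ 0 → ((j : ℕ) : ℤ) - ((k : ℕ) : ℤ) ≡ p [ZMOD N]}
  mul_mem' := by
    intro X Y hX hY p j k h
    rw [Matrix.mul_apply, map_sum] at h
    obtain ⟨l, -, hl⟩ := Finset.exists_ne_zero_of_sum_ne_zero h
    obtain ⟨q, r, hqr, hq, hr⟩ := Series.exists_of_lam_mul_ne_zero hl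
    have h4 := (hX q j l hq).add (hY r l k hr)
    rw [hqr] at h4
    simpa using h4
  add_mem' := by
    intro X Y hX hY p j k h
    rw [Matrix.add_apply, map_add] at h
    by_cases hx : Series.lam p (X j k) = 0
    · exact hY p j k (by simpa [hx] using h)
    · exact hX p j k hx
  algebraMap_mem' := by
    intro r p j k h
    rw [Matrix.algebraMap_matrix_apply] at h
    split_ifs at h with hjk
    · subst hjk
      rw [Series.lam_algebraMap] at h
      have hp : p = 0 := by
        by_contra hp
        simp [hp] at h
      subst hp
      simp [Int.ModEq]
    · simp at h

/-- The associative algebra `g`: `gl(N)` in the open-end case, the twisted loop algebra in the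
periodic case. -/
def Alg (𝕜 : Type*) [RCLike 𝕜] (N : ℕ) : Boundary → Type _
  | .openEnd => Matrix (Fin N) (Fin N) 𝕜
  | .periodic => twistedLoop 𝕜 N

instance (𝕜 : Type*) [RCLike 𝕜] (N : ℕ) : (b : Boundary) → Ring (Alg 𝕜 N b)
  | .openEnd => inferInstanceAs (Ring (Matrix (Fin N) (Fin N) 𝕜))
  | .periodic => inferInstanceAs (Ring (twistedLoop 𝕜 N))

instance (𝕜 : Type*) [RCLike 𝕜] (N : ℕ) : (b : Boundary) → Algebra 𝕜 (Alg 𝕜 N b)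
  | .openEnd => inferInstanceAs (Algebra 𝕜 (Matrix (Fin N) (Fin N) 𝕜))
  | .periodic => inferInstanceAs (Algebra 𝕜 (twistedLoop 𝕜 N))

open Classical in
/-- The part of a series that consists of the powers `λᵖ` with `p ∈ s`. -/
def Series.part (𝕜 : Type*) [RCLike 𝕜] (s : Set ℤ) : Series 𝕜 →ₗ[𝕜] Series 𝕜 where
  toFun f :=
    ({ coeff := fun n => if -n ∈ s then HahnSeries.coeff f n else 0
       isPWO_support' := (HahnSeries.isPWO_support f).mono fun n hn h => hn (by
        change (if -n ∈ s then HahnSeries.coeff f n else 0) = 0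
        rw [h, ite_self]) } : HahnSeries ℤ 𝕜)
  map_add' f g := by
    apply HahnSeries.ext
    funext n
    change (if -n ∈ s then HahnSeries.coeff f n + HahnSeries.coeff g n else 0) =
      (if -n ∈ s then HahnSeries.coeff f n else 0) + (if -n ∈ s then HahnSeries.coeff g n else 0)
    split_ifs <;> simp
  map_smul' r f := by
    apply HahnSeries.ext
    funext n
    change (if -n ∈ s then r * HahnSeries.coeff f n else 0) =
      r * (if -n ∈ s then HahnSeries.coeff f n else 0)
    split_ifs <;> simp

open Classical in
theorem Series.lam_part {𝕜 : Type*} [RCLike 𝕜] (s : Set ℤ) (p : ℤ) (f : Series 𝕜) :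
    Series.lam p (Series.part 𝕜 s f) = if p ∈ s then Series.lam p f else 0 := by
  change (if - -p ∈ s then HahnSeries.coeff f (-p) else 0) = _
  rw [neg_neg]
  rfl

/-- The coefficient at `E_{jk}` of the component in `g_p` of an element of `g`. In the open-end case
`g_p` consists of the matrices supported on the diagonal `j - k = p`, in the periodic case it
consists of the elements `λᵖ X⁽ᵖ⁾`. -/
def entry (𝕜 : Type*) [RCLike 𝕜] (N : ℕ) :
    (b : Boundary) → (p : ℤ) → (j k : Fin N) → Alg 𝕜 N b →ₗ[𝕜] 𝕜
  | .openEnd, p, j, k =>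
    (if ((j : ℕ) : ℤ) - ((k : ℕ) : ℤ) = p then Matrix.entryLinearMap 𝕜 𝕜 j k else 0 :
      Matrix (Fin N) (Fin N) 𝕜 →ₗ[𝕜] 𝕜)
  | .periodic, p, j, k =>
    (Series.lam p ∘ₗ Matrix.entryLinearMap 𝕜 (Series 𝕜) j k ∘ₗ
      (twistedLoop 𝕜 N).val.toLinearMap : twistedLoop 𝕜 N →ₗ[𝕜] 𝕜)

/-- The element `∑_k x_k E_{k,k-p}` (open-end case), `λᵖ ∑_k x_k E_{k,k-p}` (periodic case) of
`g_p`. The column subscript is read modulo `N` in the periodic case; in the open-end case the terms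
whose column subscript is out of range are dropped. -/
def diagonalElt (𝕜 : Type*) [RCLike 𝕜] (N : ℕ) :
    (b : Boundary) → (p : ℤ) → (x : Fin N → 𝕜) → Alg 𝕜 N b
  | .openEnd, p, x =>
    (Matrix.of fun j k => if ((j : ℕ) : ℤ) - ((k : ℕ) : ℤ) = p then x j else 0 :
      Matrix (Fin N) (Fin N) 𝕜)
  | .periodic, p, x =>
    (⟨Matrix.of fun j k => if ((j : ℕ) : ℤ) - ((k : ℕ) : ℤ) ≡ p [ZMOD N] then
        Series.monomial p (x j) else 0, by
      intro q j k h
      rw [Matrix.of_apply] at h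
      split_ifs at h with hp
      · rw [Series.lam_monomial] at h
        have hq : q = p := by
          by_contra hq
          exact h (if_neg hq)
        rwa [hq]
      · simp at h⟩ : twistedLoop 𝕜 N)

open Classical in
/-- The projection `P_s` of `g` onto `⨁_{p ∈ s} g_p` along `⨁_{p ∉ s} g_p`. -/
def proj (𝕜 : Type*) [RCLike 𝕜] (N : ℕ) : (b : Boundary) → Set ℤ → (Alg 𝕜 N b →ₗ[𝕜] Alg 𝕜 N b)
  | .openEnd, s =>
    ({ toFun := fun X => Matrix.of fun j k =>
         if ((j : ℕ) : ℤ) - ((k : ℕ) : ℤ) ∈ s then X j k else 0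
       map_add' := by
         intro X Y
         ext j k
         simp only [Matrix.add_apply, Matrix.of_apply]
         split_ifs <;> simp
       map_smul' := by
         intro r X
         ext j k
         simp only [Matrix.smul_apply, Matrix.of_apply, RingHom.id_apply]
         split_ifs <;> simp } :
      Matrix (Fin N) (Fin N) 𝕜 →ₗ[𝕜] Matrix (Fin N) (Fin N) 𝕜)
  | .periodic, s =>
    ({ toFun := fun X => ⟨X.1.map (Series.part 𝕜 s), by
         intro p j k h
         rw [Matrix.map_apply, Series.lam_part] at h
         refine X.2 p j k fun h0 => h ?_
         simp [h0]⟩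
       map_add' := by
         intro X Y
         ext1
         exact Matrix.map_add (Series.part 𝕜 s) (map_add _) X.1 Y.1
       map_smul' := by
         intro r X
         ext1
         exact Matrix.map_smul (Series.part 𝕜 s) r (fun a => map_smul _ r a) X.1 } :
      twistedLoop 𝕜 N →ₗ[𝕜] twistedLoop 𝕜 N)

/-- The trace of `X` (open-end case), the free term of the trace of `X(λ)` (periodic case). -/
def trace0 (𝕜 : Type*) [RCLike 𝕜] (N : ℕ) (b : Boundary) : Alg 𝕜 N b →ₗ[𝕜] 𝕜 :=
  ∑ k : Fin N, entry 𝕜 N b 0 k k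

/-- The scalar product `⟨X, Y⟩ = tr(XY)`, resp. `⟨X, Y⟩ = tr(X(λ)Y(λ))₀`. -/
def form (𝕜 : Type*) [RCLike 𝕜] (N : ℕ) (b : Boundary) : LinearMap.BilinForm 𝕜 (Alg 𝕜 N b) :=
  (LinearMap.mul 𝕜 (Alg 𝕜 N b)).compr₂ (trace0 𝕜 N b)

/-! ## Smooth functions, gradients, Poisson brackets -/

/-- A vector space with linear coordinates, each of which has an integer degree. -/
class CoordSpace (𝕜 : Type*) [RCLike 𝕜] (M : Type*) [AddCommGroup M] [Module 𝕜 M] where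
  /-- the set of coordinates -/
  Idx : Type
  /-- the coordinates as linear functions -/
  coord : Idx → M →ₗ[𝕜] 𝕜
  /-- the degrees of the coordinates -/
  deg : Idx → ℤ

open CoordSpace

instance (𝕜 : Type*) [RCLike 𝕜] (N : ℕ) (b : Boundary) : CoordSpace 𝕜 (Alg 𝕜 N b) where
  Idx := ℤ × Fin N × Fin N
  coord := fun i => entry 𝕜 N b i.1 i.2.1 i.2.2
  deg := fun i => i.1

instance (𝕜 : Type*) [RCLike 𝕜] (M M' : Type*) [AddCommGroup M] [Module 𝕜 M] [AddCommGroup M']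
    [Module 𝕜 M'] [CoordSpace 𝕜 M] [CoordSpace 𝕜 M'] : CoordSpace 𝕜 (M × M') where
  Idx := Idx 𝕜 M ⊕ Idx 𝕜 M'
  coord := Sum.elim (fun i => coord i ∘ₗ LinearMap.fst 𝕜 M M')
    (fun i => coord i ∘ₗ LinearMap.snd 𝕜 M M')
  deg := Sum.elim (deg (𝕜 := 𝕜) (M := M)) (deg (𝕜 := 𝕜) (M := M'))

section Calculus

variable {𝕜 : Type*} [RCLike 𝕜] {M : Type*} [AddCommGroup M] [Module 𝕜 M] [CoordSpace 𝕜 M]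
  {M' : Type*} [AddCommGroup M'] [Module 𝕜 M'] [CoordSpace 𝕜 M']

variable (𝕜 M) in
/-- The elements whose coordinates of degree outside of `s` vanish. For `M = g` this is
`⨁_{p ∈ s} g_p` (for a finite set `s`). -/
def degreesIn (s : Set ℤ) : Submodule 𝕜 M where
  carrier := {x | ∀ i : Idx 𝕜 M, deg i ∉ s → coord i x = 0}
  add_mem' := by
    intro x y hx hy i hi
    rw [map_add, hx i hi, hy i hi, add_zero]
  zero_mem' := fun i _ => map_zero _
  smul_mem' := by
    intro r x hx i hi
    rw [map_smul, hx i hi, smul_zero]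

/-- Smoothness (holomorphy, if `𝕜 = ℂ`) of a function near a point. The algebras considered here are
the unions of the subspaces of elements of degree at most `P`, and each of these subspaces is a
product of copies of `𝕜`, indexed by the coordinates. A function on such a product is smooth near
`x` iff it is, near `x`, a smooth function of finitely many coordinates. In the finite-dimensional
case this is smoothness in the usual sense. -/
def SmoothAt (φ : M → 𝕜) (x : M) : Prop :=
  ∀ P : ℤ, x ∈ degreesIn 𝕜 M (Set.Iic P) →
    ∃ (s : Finset (Idx 𝕜 M)) (f : (s → 𝕜) → 𝕜),
      ContDiffAt 𝕜 ∞ f (fun i => coord i.1 x) ∧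
      ∀ᶠ u in 𝓝 (fun i : s => coord i.1 x),
        ∀ y ∈ degreesIn 𝕜 M (Set.Iic P), (∀ i : s, coord i.1 y = u i) → φ y = f u

/-- A smooth function on `M`. -/
def Smooth (φ : M → 𝕜) : Prop := ∀ x, SmoothAt φ x

/-- `v` is the derivative at time `t` of the curve `γ` in `M`: near `t` the degrees along the curve
are bounded, and the derivatives of the coordinates are the coordinates of `v`. -/
def HasVelocity (𝕜 : Type*) [RCLike 𝕜] {M : Type*} [AddCommGroup M] [Module 𝕜 M]
    [CoordSpace 𝕜 M] (γ : ℝ → M) (v : M) (t : ℝ) : Prop :=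
  (∃ P : ℤ, ∀ᶠ s in 𝓝 t, γ s ∈ degreesIn 𝕜 M (Set.Iic P)) ∧
  ∀ i : Idx 𝕜 M, HasDerivAt (fun s => coord i (γ s)) (coord i v) t

/-- A Poisson bracket on `M`: a Lie bracket on the smooth functions on `M` that is a derivation in
each argument. -/
structure IsPoissonBracket (br : (M → 𝕜) → (M → 𝕜) → (M → 𝕜)) : Prop where
  smooth : ∀ φ ψ, Smooth φ → Smooth ψ → Smooth (br φ ψ)
  skew : ∀ φ ψ, Smooth φ → Smooth ψ → br φ ψ = -br ψ φ
  add : ∀ φ ψ χ, Smooth φ → Smooth ψ → Smooth χ → br φ (ψ + χ) = br φ ψ + br φ χ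
  smul : ∀ (r : 𝕜) φ ψ, Smooth φ → Smooth ψ → br φ (r • ψ) = r • br φ ψ
  leibniz : ∀ φ ψ χ, Smooth φ → Smooth ψ → Smooth χ → br φ (ψ * χ) = br φ ψ * χ + ψ * br φ χ
  jacobi : ∀ φ ψ χ, Smooth φ → Smooth ψ → Smooth χ →
    br φ (br ψ χ) + br ψ (br χ φ) + br χ (br φ ψ) = 0

/-- The map `T` is Poisson: it pulls smooth functions back to smooth functions and
`{φ ∘ T, ψ ∘ T} = {φ, ψ}' ∘ T`. This is required for locally defined functions as well. -/
def IsPoissonMap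
    (br : (M → 𝕜) → (M → 𝕜) → (M → 𝕜)) (br' : (M' → 𝕜) → (M' → 𝕜) → (M' → 𝕜))
    (T : M → M') : Prop :=
  (∀ (φ : M' → 𝕜) (x : M), SmoothAt φ (T x) → SmoothAt (φ ∘ T) x) ∧
  ∀ (φ ψ : M' → 𝕜) (x : M), SmoothAt φ (T x) → SmoothAt ψ (T x) → br (φ ∘ T) (ψ ∘ T) x = br' φ ψ (T x)

/-- `v` is the value at `x` of the Hamiltonian vector field `{H, ·}`. -/
def IsHamiltonianVector (br : (M → 𝕜) → (M → 𝕜) → (M → 𝕜)) (H : M → 𝕜) (x v : M) : Prop :=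
  ∀ ψ : M → 𝕜, SmoothAt ψ x → HasDerivAt (fun ε : 𝕜 => ψ (x + ε • v)) (br H ψ x) 0

/-- The curve `γ` satisfies Hamilton's equations of motion `ẋ = {H, x}` at time `t`. -/
def HamiltonEquation (br : (M → 𝕜) → (M → 𝕜) → (M → 𝕜)) (H : M → 𝕜) (γ : ℝ → M) (t : ℝ) : Prop :=
  ∀ ψ : M → 𝕜, SmoothAt ψ (γ t) → HasDerivAt (fun s => ψ (γ s)) (br H ψ (γ t)) t

/-- The map `ι` from a finite-dimensional space is a smooth embedding, and its image is a Poisson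
submanifold of `M`: all Hamiltonian vector fields on `M` are tangent to the image. -/
structure IsPoissonSubmanifold {E : Type*} [NormedAddCommGroup E] [NormedSpace 𝕜 E]
    (br : (M → 𝕜) → (M → 𝕜) → (M → 𝕜)) (ι : E → M) : Prop where
  bounded : ∀ u, ∃ P : ℤ, ∀ᶠ w in 𝓝 u, ι w ∈ degreesIn 𝕜 M (Set.Iic P)
  smooth : ∀ i : Idx 𝕜 M, ContDiff 𝕜 ∞ (fun u => coord i (ι u))
  immersion : ∀ u w, (∀ i : Idx 𝕜 M, fderiv 𝕜 (fun u => coord i (ι u)) u w = 0) → w = 0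
  embedding : IsEmbedding (fun u => fun i : Idx 𝕜 M => coord i (ι u))
  tangent : ∀ φ u, SmoothAt φ (ι u) → ∃ v, IsHamiltonianVector br φ (ι u) v ∧
    ∃ w, ∀ i : Idx 𝕜 M, coord i v = fderiv 𝕜 (fun u => coord i (ι u)) u w

end Calculus

section Brackets

variable {𝕜 : Type*} [RCLike 𝕜] {A : Type*} [Ring A] [Algebra 𝕜 A]

/-- `G` is a gradient of `φ` at `L` with respect to the scalar product `B`. -/
def IsGradient (B : LinearMap.BilinForm 𝕜 A) (φ : A → 𝕜) (L G : A) : Prop :=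
  ∀ X : A, HasDerivAt (fun ε : 𝕜 => φ (L + ε • X)) (B G X) 0

open Classical in
/-- The gradient `∇φ(L)` (zero, if there is none). -/
def grad (B : LinearMap.BilinForm 𝕜 A) (φ : A → 𝕜) (L : A) : A :=
  if h : ∃ G, IsGradient B φ L G then h.choose else 0

/-- `dφ(L) = L · ∇φ(L)`. -/
def dLeft (B : LinearMap.BilinForm 𝕜 A) (φ : A → 𝕜) (L : A) : A := L * grad B φ L

/-- `d'φ(L) = ∇φ(L) · L`. -/
def dRight (B : LinearMap.BilinForm 𝕜 A) (φ : A → 𝕜) (L : A) : A := grad B φ L * L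

/-- The quadratic `r`-matrix bracket `PB₂(A₁, A₂, S)`. In the last term the adjoint of `S` has been
moved to the other side: `⟨S*(d'φ), dψ⟩ = ⟨d'φ, S(dψ)⟩`. -/
def quadraticBracket (B : LinearMap.BilinForm 𝕜 A) (A₁ A₂ S : A →ₗ[𝕜] A) (φ ψ : A → 𝕜) : A → 𝕜 :=
  fun L =>
    (1 / 2) * B (A₁ (dRight B φ L)) (dRight B ψ L) - (1 / 2) * B (A₂ (dLeft B φ L)) (dLeft B ψ L)
    + (1 / 2) * B (S (dLeft B φ L)) (dRight B ψ L) - (1 / 2) * B (dRight B φ L) (S (dLeft B ψ L))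

/-- Invariance under conjugation by the invertible elements of the algebra. -/
def AdInvariant (φ : A → 𝕜) : Prop := ∀ (u : Aˣ) (X : A), φ (u * X * (u⁻¹ : Aˣ)) = φ X

/-- The scalar product `⟨⟨(X₁, X₂), (Y₁, Y₂)⟩⟩ = ⟨X₁, Y₁⟩ + ⟨X₂, Y₂⟩` on the direct product. -/
def prodForm (B : LinearMap.BilinForm 𝕜 A) : LinearMap.BilinForm 𝕜 (A × A) :=
  B.compl₁₂ (LinearMap.fst 𝕜 A A) (LinearMap.fst 𝕜 A A)
    + B.compl₁₂ (LinearMap.snd 𝕜 A A) (LinearMap.snd 𝕜 A A)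

/-- The operator on `A × A` with the block matrix `(a b; c d)`. -/
def block (a b c d : A →ₗ[𝕜] A) : A × A →ₗ[𝕜] A × A :=
  (LinearMap.coprod a b).prod (LinearMap.coprod c d)

variable (A) in
/-- The monodromy map `(L, V) ↦ LV`. -/
def monodromy₁ (x : A × A) : A := x.1 * x.2

variable (A) in
/-- The monodromy map `(L, V) ↦ VL`. -/
def monodromy₂ (x : A × A) : A := x.2 * x.1

end Brackets

/-! ## The operators and brackets of the relativistic Toda lattice -/

section Operators

variable (𝕜 : Type*) [RCLike 𝕜] (N : ℕ) (b : Boundary)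

/-- `R = π₊ - π₋ = P_{≥0} - P_{<0}`. -/
def opR : Alg 𝕜 N b →ₗ[𝕜] Alg 𝕜 N b := proj 𝕜 N b (Set.Ici 0) - proj 𝕜 N b (Set.Iio 0)

/-- `R₀ = P_{>0} - P_{<0}`. -/
def opR₀ : Alg 𝕜 N b →ₗ[𝕜] Alg 𝕜 N b := proj 𝕜 N b (Set.Ioi 0) - proj 𝕜 N b (Set.Iio 0)

/-- `P₀`, the projection to the diagonal part, resp. to the free term. -/
def opP₀ : Alg 𝕜 N b →ₗ[𝕜] Alg 𝕜 N b := proj 𝕜 N b {0}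

/-- The operator `W` with `W(E_kk) = ∑_j sgn(k - j) E_jj` and `W = W ∘ P₀`. -/
def opW : Alg 𝕜 N b →ₗ[𝕜] Alg 𝕜 N b :=
  ∑ k : Fin N, ∑ j : Fin N, (((((k : ℕ) : ℤ) - ((j : ℕ) : ℤ)).sign : ℤ) : 𝕜) •
    (entry 𝕜 N b 0 k k).smulRight (diagonalElt 𝕜 N b 0 (Pi.single j 1))

def opA₁ : Alg 𝕜 N b →ₗ[𝕜] Alg 𝕜 N b := opR₀ 𝕜 N b + opW 𝕜 N b

def opA₂ : Alg 𝕜 N b →ₗ[𝕜] Alg 𝕜 N b := opR₀ 𝕜 N b - opW 𝕜 N b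

def opS : Alg 𝕜 N b →ₗ[𝕜] Alg 𝕜 N b := opP₀ 𝕜 N b - opW 𝕜 N b

/-- The adjoint of `S`. -/
def opSadj : Alg 𝕜 N b →ₗ[𝕜] Alg 𝕜 N b := opP₀ 𝕜 N b + opW 𝕜 N b

/-- The block operator `(A₁ -S; S* A₁)`. -/
def bigA₁ : Alg 𝕜 N b × Alg 𝕜 N b →ₗ[𝕜] Alg 𝕜 N b × Alg 𝕜 N b :=
  block (opA₁ 𝕜 N b) (-opS 𝕜 N b) (opSadj 𝕜 N b) (opA₁ 𝕜 N b)

/-- The block operator `(A₂ -S*; S A₂)`. -/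
def bigA₂ : Alg 𝕜 N b × Alg 𝕜 N b →ₗ[𝕜] Alg 𝕜 N b × Alg 𝕜 N b :=
  block (opA₂ 𝕜 N b) (-opSadj 𝕜 N b) (opS 𝕜 N b) (opA₂ 𝕜 N b)

/-- The block operator `(S S; S -S*)`. -/
def bigS : Alg 𝕜 N b × Alg 𝕜 N b →ₗ[𝕜] Alg 𝕜 N b × Alg 𝕜 N b :=
  block (opS 𝕜 N b) (opS 𝕜 N b) (opS 𝕜 N b) (-opSadj 𝕜 N b)

/-- The block operator `(S* S*; S* -S)`, the adjoint of the preceding one. -/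
def bigSadj : Alg 𝕜 N b × Alg 𝕜 N b →ₗ[𝕜] Alg 𝕜 N b × Alg 𝕜 N b :=
  block (opSadj 𝕜 N b) (opSadj 𝕜 N b) (opSadj 𝕜 N b) (-opS 𝕜 N b)

variable {𝕜 N b}

/-- The bracket `α PB₂(A₁, A₂, S)` on `g`. -/
def smallBracket (α : 𝕜) (φ ψ : Alg 𝕜 N b → 𝕜) : Alg 𝕜 N b → 𝕜 :=
  α • quadraticBracket (form 𝕜 N b) (opA₁ 𝕜 N b) (opA₂ 𝕜 N b) (opS 𝕜 N b) φ ψ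

/-- The bracket `α PB₂(𝐀₁, 𝐀₂, 𝐒)` on `g × g`. -/
def bigBracket (α : 𝕜) (φ ψ : Alg 𝕜 N b × Alg 𝕜 N b → 𝕜) : Alg 𝕜 N b × Alg 𝕜 N b → 𝕜 :=
  α • quadraticBracket (prodForm (form 𝕜 N b)) (bigA₁ 𝕜 N b) (bigA₂ 𝕜 N b) (bigS 𝕜 N b) φ ψ

/-- `(α/2) R(dφ(T))`. -/
def laxC (α : 𝕜) (φ : Alg 𝕜 N b → 𝕜) (T : Alg 𝕜 N b) : Alg 𝕜 N b :=
  (α / 2) • opR 𝕜 N b (dLeft (form 𝕜 N b) φ T)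

end Operators

/-! ## The phase space and the Lax matrices -/

section Lax

variable (𝕜 : Type*) [RCLike 𝕜] (N m : ℕ) (b : Boundary)

/-- The phase space of the fields `d = (d_k)` and `c⁽¹⁾, …, c⁽ᵐ⁾`; the field `c⁽ʲ⁺¹⁾` is the value
at `j : Fin m` of the second component. In the open-end case `c⁽ʲ⁾` consists of `N - j` variables
only; the other ones are set to zero. -/
def phaseSpace : Submodule 𝕜 ((Fin N → 𝕜) × (Fin m → Fin N → 𝕜)) where
  carrier := {u | b = .openEnd → ∀ (j : Fin m) (k : Fin N),
    N ≤ (k : ℕ) + ((j : ℕ) + 1) → u.2 j k = 0}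
  add_mem' := by
    intro u v hu hv hb j k h
    simp [hu hb j k h, hv hb j k h]
  zero_mem' := fun _ _ _ _ => rfl
  smul_mem' := by
    intro r u hu hb j k h
    simp [hu hb j k h]

/-- `ℰ = ∑_k E_{k+1,k}`, resp. `λ ∑_k E_{k+1,k}`. -/
def shiftE : Alg 𝕜 N b := diagonalElt 𝕜 N b 1 fun _ => 1

variable {𝕜 N m b}

/-- `L = ∑_k (1 + α d_k) E_kk + α ℰ`. -/
def laxL (α : 𝕜) (u : phaseSpace 𝕜 N m b) : Alg 𝕜 N b :=
  diagonalElt 𝕜 N b 0 (fun k => 1 + α * u.1.1 k) + α • shiftE 𝕜 N b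

/-- `U = I - α ∑_{j=1}^m λ^{-j} ∑_k c_k⁽ʲ⁾ E_{k,k+j}` (without the powers of `λ` in the open-end
case). -/
def laxU (α : 𝕜) (u : phaseSpace 𝕜 N m b) : Alg 𝕜 N b :=
  1 - α • ∑ j : Fin m, diagonalElt 𝕜 N b (-((j : ℕ) + 1 : ℤ)) (u.1.2 j)

/-- The Lax matrix map `(d, c) ↦ (L, U⁻¹)`. -/
def laxMap (α : 𝕜) (u : phaseSpace 𝕜 N m b) : Alg 𝕜 N b × Alg 𝕜 N b :=
  (laxL α u, Ring.inverse (laxU α u))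

variable (m) in
/-- The set of the pairs `(L, U⁻¹)` with `L ∈ αℰ ⊕ g₀` and `U ∈ I ⊕ ⨁_{j=1}^m g_{-j}`. -/
def laxSet (α : 𝕜) : Set (Alg 𝕜 N b × Alg 𝕜 N b) :=
  {x | x.1 - α • shiftE 𝕜 N b ∈ degreesIn 𝕜 (Alg 𝕜 N b) {0} ∧
    ∃ U : Alg 𝕜 N b, U - 1 ∈ degreesIn 𝕜 (Alg 𝕜 N b) (Set.Icc (-(m : ℤ)) (-1)) ∧
      U * x.2 = 1 ∧ x.2 * U = 1}

end Lax

end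

end RelToda

open RelToda

/-! In the periodic case `g` is infinite-dimensional, but locally only finitely many coordinates
matter. On the elements of degree at most `P` a smooth function depends near a point on finitely
many coefficients, so its differential does too, and the trace form turns the resulting functional
into an element of `g`. This gives gradients, their smoothness, the chain rule and symmetric second
derivatives. `IsCoordAlg` collects what this calculus needs; it holds for `g` (`isCoordAlg_form`)
and passes to `g × g` (`IsCoordAlg.prod`), so both brackets fall under one argument.

Poisson brackets. All operators differ from `R₀` (on `g × g`: from `R₀` in each component), or from
zero, by operators with values in the commutative diagonal part `g₀`. `R₀` satisfies the modified
Yang-Baxter equation `[R₀x, R₀y] + [x, y] = R₀([R₀x, y] + [x, R₀y])`, and `[R₀x, y] + [x, R₀y]` has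
no component in `g₀` (`opR₀_bracket`). Hence the diagonal corrections drop out of cyclic sums
(`IsRMatrixBracket.cycle`). In the Jacobi sum the Hessians cancel by symmetry; the rest is a
difference of two such cyclic sums, one for the right and one for the left differentials, which
agree because the trace is cyclic (`IsRMatrixBracket.isPoissonBracket`).

(a) The elements `U` and `U⁻¹` are unipotent, so the entries of either are polynomials in those of
the other (`entry_inverse_mem`); this gives the embedding. For tangency, the left and right
differentials are related by `L y = z L` and `U q = v U`. So an expression built from negative parts
is, up to sign, the same expression in nonnegative parts, which bounds its degrees on both sides
(`lax_left_mem`, `lax_right_mem`). The degree-one part of the diagonal terms vanishes because `S`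
and `S*` at neighbouring sites add up to a multiple of a trace that is zero.

(b) The gradient of `φ ∘ M` makes one differential of the first factor equal to the opposite
differential of the second; the blocks are chosen so that the terms with it cancel.

(c) For invariant `φ` the gradient at `T` commutes with `T` (`AdInvariant.comm_grad`). Both Hamilton
functions then have the same gradient at `(L, U⁻¹)`, and the operators combine by `A₁ + S = A₂ + S*
= R` into the Lax triad. -/

namespace RelToda

open CoordSpace

/-! ### Germs of functions on the elements of bounded degree. -/

section Germs

variable {𝕜 : Type*} [RCLike 𝕜] {M : Type*} [AddCommGroup M] [Module 𝕜 M] [CoordSpace 𝕜 M]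
  {M' : Type*} [AddCommGroup M'] [Module 𝕜 M'] [CoordSpace 𝕜 M']

theorem degreesIn_mono {s t : Set ℤ} (h : s ⊆ t) : degreesIn 𝕜 M s ≤ degreesIn 𝕜 M t :=
  fun _ hx i hi => hx i fun hi' => hi (h hi')

variable (𝕜) in
/-- The neighbourhoods of `x` in the space of the elements of degree at most `P`, in the topology of
the convergence of the coordinates. -/
def nhdsDeg (P : ℤ) (x : M) : Filter M :=
  Filter.comap (fun y => fun i : Idx 𝕜 M => coord i y) (𝓝 fun i : Idx 𝕜 M => coord i x) ⊓
    Filter.principal (degreesIn 𝕜 M (Set.Iic P) : Set M)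

/-- The filter is that of the neighbourhoods within the elements of degree at most `P`, for the
topology induced by the coordinates. It makes a local formula for a function at `x` available around
every nearby point, where gradients are taken. -/
theorem nhdsDeg_eventually {P : ℤ} {x : M} {p : M → Prop} (h : ∀ᶠ y in nhdsDeg 𝕜 P x, p y) :
    ∀ᶠ y in nhdsDeg 𝕜 P x, ∀ᶠ z in nhdsDeg 𝕜 P y, p z := by
  let _ : TopologicalSpace M :=
    TopologicalSpace.induced (fun y => fun i : Idx 𝕜 M => coord i y) inferInstance
  have h1 : ∀ x : M, nhdsDeg 𝕜 P x = 𝓝[(degreesIn 𝕜 M (Set.Iic P) : Set M)] x := by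
    intro x
    rw [nhdsWithin, nhds_induced]
    rfl
  simp only [h1] at h ⊢
  exact eventually_eventually_nhdsWithin.2 h

theorem nhdsDeg_self {P : ℤ} {x : M} (hx : x ∈ degreesIn 𝕜 M (Set.Iic P)) {p : M → Prop}
    (h : ∀ᶠ y in nhdsDeg 𝕜 P x, p y) : p x := by
  rw [nhdsDeg, Filter.eventually_inf_principal, Filter.eventually_comap] at h
  exact h.self_of_nhds x rfl hx

theorem nhdsDeg_mem (P : ℤ) (x : M) :
    ∀ᶠ y in nhdsDeg 𝕜 P x, y ∈ degreesIn 𝕜 M (Set.Iic P) :=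
  Filter.mem_inf_of_right (Filter.mem_principal_self _)

theorem nhdsDeg_mono {P Q : ℤ} (h : P ≤ Q) (x : M) : nhdsDeg 𝕜 P x ≤ nhdsDeg 𝕜 Q x :=
  inf_le_inf_left _ (Filter.principal_mono.2 (degreesIn_mono (Set.Iic_subset_Iic.2 h)))

theorem tendsto_nhdsDeg {X : Type*} {l : Filter X} {P : ℤ} {x : M} {γ : X → M}
    (h1 : ∀ᶠ s in l, γ s ∈ degreesIn 𝕜 M (Set.Iic P))
    (h2 : ∀ i : Idx 𝕜 M, Filter.Tendsto (fun s => coord i (γ s)) l (𝓝 (coord i x))) :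
    Filter.Tendsto γ l (nhdsDeg 𝕜 P x) :=
  Filter.tendsto_inf.2 ⟨Filter.tendsto_comap_iff.2 (tendsto_pi_nhds.2 h2),
    Filter.tendsto_principal.2 h1⟩

theorem tendsto_coord_nhdsDeg (P : ℤ) (x : M) (i : Idx 𝕜 M) :
    Filter.Tendsto (fun y : M => coord i y) (nhdsDeg 𝕜 P x) (𝓝 (coord i x)) :=
  (tendsto_pi_nhds.1 (Filter.tendsto_comap (f := fun y : M => fun i : Idx 𝕜 M => coord i y)
    (x := 𝓝 fun i : Idx 𝕜 M => coord i x)) i).mono_left inf_le_left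

/-- The restriction of `φ` to the elements of degree at most `P` is, near `x`, a smooth function of
finitely many coordinates. -/
def SmoothDeg (P : ℤ) (φ : M → 𝕜) (x : M) : Prop :=
  ∃ (s : Finset (Idx 𝕜 M)) (f : (s → 𝕜) → 𝕜),
    ContDiffAt 𝕜 ∞ f (fun i => coord i.1 x) ∧
    ∀ᶠ y in nhdsDeg 𝕜 P x, φ y = f fun i => coord i.1 y

theorem contDiffAt_reindex {ι κ : Type*} [Fintype ι] [Fintype κ] (e : ι → κ) {f : (ι → 𝕜) → 𝕜}
    {u : κ → 𝕜} (hf : ContDiffAt 𝕜 ∞ f fun i => u (e i)) :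
    ContDiffAt 𝕜 ∞ (fun v : κ → 𝕜 => f fun i => v (e i)) u :=
  ContDiffAt.comp (g := f) (f := fun v : κ → 𝕜 => fun i => v (e i)) u hf
    (contDiff_pi.2 fun i => contDiff_apply 𝕜 𝕜 (e i)).contDiffAt

/-- A neighbourhood in the product topology restricts only finitely many coordinates, so the filter
formulation loses nothing against the finite one. -/
theorem smoothAt_iff (φ : M → 𝕜) (x : M) :
    SmoothAt φ x ↔ ∀ P : ℤ, x ∈ degreesIn 𝕜 M (Set.Iic P) → SmoothDeg P φ x := by
  classical
  refine forall_congr' fun P => forall_congr' fun _ => ⟨?_, ?_⟩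
  · rintro ⟨s, f, hf, h⟩
    refine ⟨s, f, hf, ?_⟩
    rw [nhdsDeg, Filter.eventually_inf_principal]
    have h1 : Filter.Tendsto (fun y : M => fun i : s => coord i.1 y)
        (Filter.comap (fun y => fun i : Idx 𝕜 M => coord i y) (𝓝 fun i : Idx 𝕜 M => coord i x))
        (𝓝 fun i : s => coord i.1 x) :=
      tendsto_pi_nhds.2 fun i => tendsto_pi_nhds.1 (Filter.tendsto_comap
        (f := fun y : M => fun i : Idx 𝕜 M => coord i y)) i.1
    filter_upwards [h1.eventually h] with y hy hyP
    exact hy y hyP fun i => rfl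
  · rintro ⟨s, f, hf, h⟩
    rw [nhdsDeg, Filter.eventually_inf_principal, Filter.eventually_comap, Filter.Eventually,
      nhds_pi, Filter.mem_pi] at h
    obtain ⟨I, hI, t, ht, hsub⟩ := h
    -- The coordinates in `I`, which control where `φ` agrees with `f`, are added to those on which
    -- `f` depends.
    let s' : Finset (Idx 𝕜 M) := s ∪ hI.toFinset
    let e : s → s' := fun i => ⟨i.1, Finset.mem_union_left _ i.2⟩
    refine ⟨s', fun u => f fun i => u (e i), contDiffAt_reindex e hf, ?_⟩
    have h2 : ∀ᶠ u in 𝓝 (fun i : s' => coord i.1 x), ∀ i : s', u i ∈ t i.1 :=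
      Filter.eventually_all.2 fun i => (continuous_apply i).continuousAt (ht i.1)
    filter_upwards [h2] with u hu y hyP hyu
    have h3 : (fun i : Idx 𝕜 M => coord i y) ∈ I.pi t := by
      intro i hi
      have h4 := hu ⟨i, Finset.mem_union_right _ (hI.mem_toFinset.2 hi)⟩
      rw [← hyu] at h4
      exact h4
    rw [hsub h3 y rfl hyP]
    congr 1
    funext i
    exact hyu (e i)

theorem SmoothDeg.mono {P Q : ℤ} (h : P ≤ Q) {φ : M → 𝕜} {x : M} (hφ : SmoothDeg Q φ x) :
    SmoothDeg P φ x := by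
  obtain ⟨s, f, hf, hs⟩ := hφ
  exact ⟨s, f, hf, hs.filter_mono (nhdsDeg_mono h x)⟩

theorem SmoothDeg.congr {P : ℤ} {φ ψ : M → 𝕜} {x : M} (hφ : SmoothDeg P φ x)
    (h : ∀ᶠ y in nhdsDeg 𝕜 P x, ψ y = φ y) : SmoothDeg P ψ x := by
  obtain ⟨s, f, hf, hs⟩ := hφ
  refine ⟨s, f, hf, ?_⟩
  filter_upwards [hs, h] with y h1 h2
  rw [h2, h1]

/-- A smooth function of finitely many smooth functions is smooth. -/
theorem SmoothDeg.comp {P : ℤ} {x : M} (hx : x ∈ degreesIn 𝕜 M (Set.Iic P)) {ι : Type*} [Fintype ι]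
    {φ : ι → M → 𝕜} (hφ : ∀ j, SmoothDeg P (φ j) x) {g : (ι → 𝕜) → 𝕜}
    (hg : ContDiffAt 𝕜 ∞ g fun j => φ j x) : SmoothDeg P (fun y => g fun j => φ j y) x := by
  classical
  choose s f hf hs using hφ
  let s' : Finset (Idx 𝕜 M) := Finset.univ.biUnion s
  let e : ∀ j, s j → s' := fun j i =>
    ⟨i.1, Finset.mem_biUnion.2 ⟨j, Finset.mem_univ _, i.2⟩⟩
  refine ⟨s', fun u => g fun j => f j fun i => u (e j i), ?_, ?_⟩
  · refine ContDiffAt.comp (g := g) (f := fun u : s' → 𝕜 => fun j => f j fun i => u (e j i)) _ ?_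
      (contDiffAt_pi.2 fun j => contDiffAt_reindex (e j) (hf j))
    convert hg using 2 with j
    exact (nhdsDeg_self hx (hs j)).symm
  · filter_upwards [Filter.eventually_all.2 hs] with y hy
    congr 1
    funext j
    exact hy j

theorem SmoothDeg.const (P : ℤ) (c : 𝕜) (x : M) : SmoothDeg P (fun _ => c) x :=
  ⟨∅, fun _ => c, contDiffAt_const, Filter.Eventually.of_forall fun _ => rfl⟩

theorem SmoothDeg.coord (P : ℤ) (i : Idx 𝕜 M) (x : M) :
    SmoothDeg P (fun y => CoordSpace.coord i y) x :=
  ⟨{i}, fun u => u ⟨i, Finset.mem_singleton_self i⟩, (contDiff_apply 𝕜 𝕜 _).contDiffAt,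
    Filter.Eventually.of_forall fun _ => rfl⟩

theorem SmoothDeg.add {P : ℤ} {x : M} (hx : x ∈ degreesIn 𝕜 M (Set.Iic P)) {φ ψ : M → 𝕜}
    (hφ : SmoothDeg P φ x) (hψ : SmoothDeg P ψ x) : SmoothDeg P (fun y => φ y + ψ y) x := by
  have h := SmoothDeg.comp hx (φ := fun j : Bool => bif j then φ else ψ)
    (fun j => by cases j <;> assumption) (g := fun u => u true + u false)
    ((contDiff_apply 𝕜 𝕜 true).add (contDiff_apply 𝕜 𝕜 false)).contDiffAt
  exact h

theorem SmoothDeg.mul {P : ℤ} {x : M} (hx : x ∈ degreesIn 𝕜 M (Set.Iic P)) {φ ψ : M → 𝕜}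
    (hφ : SmoothDeg P φ x) (hψ : SmoothDeg P ψ x) : SmoothDeg P (fun y => φ y * ψ y) x := by
  have h := SmoothDeg.comp hx (φ := fun j : Bool => bif j then φ else ψ)
    (fun j => by cases j <;> assumption) (g := fun u => u true * u false)
    ((contDiff_apply 𝕜 𝕜 true).mul (contDiff_apply 𝕜 𝕜 false)).contDiffAt
  exact h

theorem SmoothDeg.const_mul {P : ℤ} {x : M} (hx : x ∈ degreesIn 𝕜 M (Set.Iic P)) {φ : M → 𝕜}
    (c : 𝕜) (hφ : SmoothDeg P φ x) : SmoothDeg P (fun y => c * φ y) x :=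
  (SmoothDeg.const P c x).mul hx hφ

theorem SmoothDeg.sub {P : ℤ} {x : M} (hx : x ∈ degreesIn 𝕜 M (Set.Iic P)) {φ ψ : M → 𝕜}
    (hφ : SmoothDeg P φ x) (hψ : SmoothDeg P ψ x) : SmoothDeg P (fun y => φ y - ψ y) x := by
  refine (hφ.add hx (hψ.const_mul hx (-1))).congr (Filter.Eventually.of_forall fun y => ?_)
  ring

theorem SmoothAt.smul (r : 𝕜) {φ : M → 𝕜} {x : M} (hφ : SmoothAt φ x) : SmoothAt (r • φ) x :=
  (smoothAt_iff _ _).2 fun P hx => ((smoothAt_iff _ _).1 hφ P hx).const_mul hx r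

theorem SmoothAt.coord (i : Idx 𝕜 M) (x : M) : SmoothAt (fun y => CoordSpace.coord i y) x :=
  (smoothAt_iff _ _).2 fun P _ => SmoothDeg.coord P i x

theorem SmoothDeg.tendsto {P : ℤ} {x : M} (hx : x ∈ degreesIn 𝕜 M (Set.Iic P)) {φ : M → 𝕜}
    (hφ : SmoothDeg P φ x) : Filter.Tendsto φ (nhdsDeg 𝕜 P x) (𝓝 (φ x)) := by
  obtain ⟨s, f, hf, hs⟩ := hφ
  have h1 : Filter.Tendsto (fun y : M => fun i : s => CoordSpace.coord i.1 y) (nhdsDeg 𝕜 P x)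
      (𝓝 fun i : s => CoordSpace.coord i.1 x) :=
    tendsto_pi_nhds.2 fun i => tendsto_coord_nhdsDeg P x i.1
  have h2 := hf.continuousAt.tendsto.comp h1
  rw [nhdsDeg_self hx hs]
  refine h2.congr' ?_
  filter_upwards [hs] with y hy
  exact hy.symm

/-- A map that is, on the elements of degree at most `P`, bounded in degree near `x` and smooth in
each coordinate. -/
def SmoothMapDeg (P : ℤ) (Φ : M → M') (x : M) : Prop :=
  (∃ Q : ℤ, ∀ᶠ y in nhdsDeg 𝕜 P x, Φ y ∈ degreesIn 𝕜 M' (Set.Iic Q)) ∧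
    ∀ i : Idx 𝕜 M', SmoothDeg P (fun y => coord i (Φ y)) x

theorem SmoothMapDeg.tendsto {P Q : ℤ} {Φ : M → M'} {x : M} (hx : x ∈ degreesIn 𝕜 M (Set.Iic P))
    (hQ : ∀ᶠ y in nhdsDeg 𝕜 P x, Φ y ∈ degreesIn 𝕜 M' (Set.Iic Q))
    (hΦ : ∀ i : Idx 𝕜 M', SmoothDeg P (fun y => CoordSpace.coord i (Φ y)) x) :
    Filter.Tendsto Φ (nhdsDeg 𝕜 P x) (nhdsDeg 𝕜 Q (Φ x)) :=
  tendsto_nhdsDeg hQ fun i => (hΦ i).tendsto hx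

theorem SmoothAt.comp {T : M → M'} {φ : M' → 𝕜} {x : M}
    (hT : ∀ P, x ∈ degreesIn 𝕜 M (Set.Iic P) → SmoothMapDeg (𝕜 := 𝕜) P T x)
    (hφ : SmoothAt φ (T x)) : SmoothAt (φ ∘ T) x := by
  refine (smoothAt_iff _ _).2 fun P hx => ?_
  obtain ⟨⟨Q, hQ⟩, hc⟩ := hT P hx
  obtain ⟨s, f, hf, hs⟩ := (smoothAt_iff _ _).1 hφ Q (nhdsDeg_self hx hQ)
  exact (SmoothDeg.comp hx (fun i : s => hc i.1) hf).congr
    ((SmoothMapDeg.tendsto hx hQ hc).eventually hs)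

/-- The restriction of `φ` to the elements of degree at most `P` has near `x` the derivative `Λ`,
which depends on the coordinates in `s`. -/
theorem SmoothDeg.hasDerivAt_comp {P : ℤ} {φ : M → 𝕜} {s : Finset (Idx 𝕜 M)} {f : (s → 𝕜) → 𝕜}
    {Λ : (s → 𝕜) →L[𝕜] 𝕜} {K : Type*} [NontriviallyNormedField K] [NormedAlgebra K 𝕜]
    {γ : K → M} {v : M} {t : K}
    (hf : HasFDerivAt f Λ (fun i => CoordSpace.coord i.1 (γ t)))
    (hs : ∀ᶠ y in nhdsDeg 𝕜 P (γ t), φ y = f fun i => CoordSpace.coord i.1 y)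
    (hγ : ∀ᶠ r in 𝓝 t, γ r ∈ degreesIn 𝕜 M (Set.Iic P))
    (hv : ∀ i : Idx 𝕜 M, HasDerivAt (fun r => CoordSpace.coord i (γ r)) (CoordSpace.coord i v) t) :
    HasDerivAt (fun r => φ (γ r)) (Λ fun i => CoordSpace.coord i.1 v) t := by
  have h1 : Filter.Tendsto γ (𝓝 t) (nhdsDeg 𝕜 P (γ t)) :=
    tendsto_nhdsDeg hγ fun i => (hv i).continuousAt
  have h2 : HasDerivAt (fun r => fun i : s => CoordSpace.coord i.1 (γ r))
      (fun i : s => CoordSpace.coord i.1 v) t := hasDerivAt_pi.2 fun i => hv i.1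
  -- The parameter field `K` may be `ℝ` while `𝕜 = ℂ`; the derivative of `f` is then used as a
  -- `K`-linear map.
  have h3 := (hf.restrictScalars K).comp_hasDerivAt t h2
  exact h3.congr_of_eventuallyEq (h1.eventually hs)

end Germs

/-! ### Velocities of curves, and linear maps that are local in the coordinates. -/

section Velocity

variable {𝕜 : Type*} [RCLike 𝕜] {M : Type*} [AddCommGroup M] [Module 𝕜 M] [CoordSpace 𝕜 M]
  {M' : Type*} [AddCommGroup M'] [Module 𝕜 M'] [CoordSpace 𝕜 M']
  {K : Type*} [NontriviallyNormedField K] [NormedAlgebra K 𝕜]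

variable (𝕜) in
/-- `v` is the derivative at `t` of the curve `γ`, whose parameter runs through `K`. -/
def HasVel (γ : K → M) (v : M) (t : K) : Prop :=
  (∃ P : ℤ, ∀ᶠ s in 𝓝 t, γ s ∈ degreesIn 𝕜 M (Set.Iic P)) ∧
  ∀ i : Idx 𝕜 M, HasDerivAt (fun s => coord i (γ s)) (coord i v) t

theorem HasVel.mem {γ : K → M} {v : M} {t : K} (h : HasVel 𝕜 γ v t) {s : Set ℤ}
    (hs : ∀ᶠ r in 𝓝 t, γ r ∈ degreesIn 𝕜 M s) : v ∈ degreesIn 𝕜 M s := by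
  intro i hi
  refine (h.2 i).unique ((hasDerivAt_const t (0 : 𝕜)).congr_of_eventuallyEq ?_)
  filter_upwards [hs] with r hr
  exact hr i hi

variable (𝕜) in
/-- The linear functionals that depend on finitely many coordinates. -/
def coordSpan (M : Type*) [AddCommGroup M] [Module 𝕜 M] [CoordSpace 𝕜 M] :
    Submodule 𝕜 (M →ₗ[𝕜] 𝕜) :=
  Submodule.span 𝕜 (Set.range (coord : Idx 𝕜 M → M →ₗ[𝕜] 𝕜))

theorem coord_mem_coordSpan (i : Idx 𝕜 M) : coord i ∈ coordSpan 𝕜 M :=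
  Submodule.subset_span ⟨i, rfl⟩

theorem HasVel.hasDerivAt_coordSpan {γ : K → M} {v : M} {t : K} (h : HasVel 𝕜 γ v t)
    {l : M →ₗ[𝕜] 𝕜} (hl : l ∈ coordSpan 𝕜 M) : HasDerivAt (fun s => l (γ s)) (l v) t := by
  induction hl using Submodule.span_induction with
  | mem l hl =>
    obtain ⟨i, rfl⟩ := hl
    exact h.2 i
  | zero => exact hasDerivAt_const t (0 : 𝕜)
  | add l l' _ _ hl hl' => exact hl.add hl'
  | smul r l _ hl => exact hl.const_mul r

theorem SmoothDeg.coordSpan_comp {P : ℤ} {x : M} (hx : x ∈ degreesIn 𝕜 M (Set.Iic P)) {Φ : M → M'}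
    (h : ∀ i : Idx 𝕜 M', SmoothDeg P (fun y => CoordSpace.coord i (Φ y)) x) {l : M' →ₗ[𝕜] 𝕜}
    (hl : l ∈ coordSpan 𝕜 M') : SmoothDeg P (fun y => l (Φ y)) x := by
  induction hl using Submodule.span_induction with
  | mem l hl =>
    obtain ⟨i, rfl⟩ := hl
    exact h i
  | zero => exact SmoothDeg.const P 0 x
  | add l l' _ _ hl hl' => exact hl.add hx hl'
  | smul r l _ hl => exact hl.const_mul hx r

/-- A linear map each coordinate of which depends on finitely many coordinates, and that maps
elements of bounded degree to such elements. -/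
def IsLocalOp (T : M →ₗ[𝕜] M') : Prop :=
  (∀ P : ℤ, ∃ Q : ℤ, ∀ x ∈ degreesIn 𝕜 M (Set.Iic P), T x ∈ degreesIn 𝕜 M' (Set.Iic Q)) ∧
    ∀ i : Idx 𝕜 M', coord i ∘ₗ T ∈ coordSpan 𝕜 M

theorem IsLocalOp.add {T T' : M →ₗ[𝕜] M'} (hT : IsLocalOp T) (hT' : IsLocalOp T') :
    IsLocalOp (T + T') := by
  refine ⟨fun P => ?_, fun i => ?_⟩
  · obtain ⟨Q, hQ⟩ := hT.1 P
    obtain ⟨Q', hQ'⟩ := hT'.1 P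
    exact ⟨max Q Q', fun x hx => add_mem
      (degreesIn_mono (Set.Iic_subset_Iic.2 (le_max_left _ _)) (hQ x hx))
      (degreesIn_mono (Set.Iic_subset_Iic.2 (le_max_right _ _)) (hQ' x hx))⟩
  · rw [LinearMap.comp_add]
    exact add_mem (hT.2 i) (hT'.2 i)

theorem IsLocalOp.neg {T : M →ₗ[𝕜] M'} (hT : IsLocalOp T) : IsLocalOp (-T) := by
  refine ⟨fun P => ?_, fun i => ?_⟩
  · obtain ⟨Q, hQ⟩ := hT.1 P
    exact ⟨Q, fun x hx => neg_mem (hQ x hx)⟩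
  · rw [LinearMap.comp_neg]
    exact neg_mem (hT.2 i)

theorem IsLocalOp.sub {T T' : M →ₗ[𝕜] M'} (hT : IsLocalOp T) (hT' : IsLocalOp T') :
    IsLocalOp (T - T') := by
  rw [sub_eq_add_neg]
  exact hT.add hT'.neg

theorem HasVel.op {γ : K → M} {v : M} {t : K} (h : HasVel 𝕜 γ v t) {T : M →ₗ[𝕜] M'}
    (hT : IsLocalOp T) : HasVel 𝕜 (fun s => T (γ s)) (T v) t := by
  obtain ⟨P, hP⟩ := h.1
  obtain ⟨Q, hQ⟩ := hT.1 P
  exact ⟨⟨Q, hP.mono fun s hs => hQ _ hs⟩, fun i => h.hasDerivAt_coordSpan (hT.2 i)⟩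

theorem SmoothMapDeg.op {P : ℤ} {x : M} (hx : x ∈ degreesIn 𝕜 M (Set.Iic P))
    {M'' : Type*} [AddCommGroup M''] [Module 𝕜 M''] [CoordSpace 𝕜 M''] {Φ : M → M'}
    (h : SmoothMapDeg (𝕜 := 𝕜) P Φ x) {T : M' →ₗ[𝕜] M''} (hT : IsLocalOp T) :
    SmoothMapDeg (𝕜 := 𝕜) P (fun y => T (Φ y)) x := by
  obtain ⟨Q, hQ⟩ := h.1
  obtain ⟨Q', hQ'⟩ := hT.1 Q
  exact ⟨⟨Q', hQ.mono fun s hs => hQ' _ hs⟩, fun i => SmoothDeg.coordSpan_comp hx h.2 (hT.2 i)⟩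

theorem SmoothMapDeg.id (P : ℤ) (x : M) : SmoothMapDeg (𝕜 := 𝕜) P (fun y : M => y) x :=
  ⟨⟨P, nhdsDeg_mem P x⟩, fun i => SmoothDeg.coord P i x⟩

theorem HasVel.line (x X : M) {P : ℤ} (hx : x ∈ degreesIn 𝕜 M (Set.Iic P))
    (hX : X ∈ degreesIn 𝕜 M (Set.Iic P)) (t : 𝕜) : HasVel 𝕜 (fun ε : 𝕜 => x + ε • X) X t := by
  refine ⟨⟨P, Filter.Eventually.of_forall fun ε => add_mem hx (Submodule.smul_mem _ ε hX)⟩,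
    fun i => ?_⟩
  simp only [map_add, map_smul, smul_eq_mul]
  simpa using ((hasDerivAt_id t).mul_const (coord i X)).const_add (coord i x)

end Velocity

/-! ### Calculus in an algebra with coordinates and a trace form. -/

section CoordAlg

variable {𝕜 : Type*} [RCLike 𝕜] {A : Type*} [Ring A] [Algebra 𝕜 A] [CoordSpace 𝕜 A]

/-- The properties of `g` and `g × g` that underlie the calculus of gradients: the multiplication is
a finite bilinear expression in the coordinates, the form `B` is a trace form, and a linear functional
that depends on finitely many coordinates on the elements of degree at most `P`, for every `P`, is
represented by a unique element. -/
structure IsCoordAlg (B : LinearMap.BilinForm 𝕜 A) : Prop where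
  bounded : ∀ x : A, ∃ P : ℤ, x ∈ degreesIn 𝕜 A (Set.Iic P)
  ext : ∀ x y : A, (∀ i : Idx 𝕜 A, coord i x = coord i y) → x = y
  repr : ∀ l : A →ₗ[𝕜] 𝕜, (∀ P : ℤ, ∃ s : Finset (Idx 𝕜 A), ∀ x ∈ degreesIn 𝕜 A (Set.Iic P),
    (∀ i ∈ s, coord i x = 0) → l x = 0) → ∃ G, ∀ x, B G x = l x
  dual : ∀ i : Idx 𝕜 A, ∃ e ∈ degreesIn 𝕜 A {-deg i}, ∀ x, coord i x = B x e
  mul_mem : ∀ (P Q : ℤ), ∀ x ∈ degreesIn 𝕜 A (Set.Iic P), ∀ y ∈ degreesIn 𝕜 A (Set.Iic Q),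
    x * y ∈ degreesIn 𝕜 A (Set.Iic (P + Q))
  coord_mul : ∀ (P Q : ℤ) (i : Idx 𝕜 A), ∃ s : Finset (Idx 𝕜 A × Idx 𝕜 A),
    ∀ x ∈ degreesIn 𝕜 A (Set.Iic P), ∀ y ∈ degreesIn 𝕜 A (Set.Iic Q),
      coord i (x * y) = ∑ p ∈ s, coord p.1 x * coord p.2 y
  trace : ∃ tr ∈ coordSpan 𝕜 A, (∀ x y, B x y = tr (x * y)) ∧ ∀ x y, tr (x * y) = tr (y * x)

namespace IsCoordAlg

variable {B : LinearMap.BilinForm 𝕜 A} (hB : IsCoordAlg B)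

include hB

theorem form_comm (x y : A) : B x y = B y x := by
  obtain ⟨tr, -, h1, h2⟩ := hB.trace
  rw [h1, h1, h2]

theorem form_mul (x y z : A) : B (x * y) z = B x (y * z) := by
  obtain ⟨tr, -, h1, h2⟩ := hB.trace
  rw [h1, h1, mul_assoc]

theorem form_mul_cycle (x y z : A) : B (x * y) z = B y (z * x) := by
  rw [hB.form_comm, ← hB.form_mul, hB.form_comm]

theorem eq_of_form {x y : A} (h : ∀ z, B x z = B y z) : x = y := by
  refine hB.ext x y fun i => ?_
  obtain ⟨e, -, he⟩ := hB.dual i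
  rw [he, he, h]

theorem bounded₂ (x y : A) (P₀ : ℤ) : ∃ P : ℤ, P₀ ≤ P ∧ x ∈ degreesIn 𝕜 A (Set.Iic P) ∧
    y ∈ degreesIn 𝕜 A (Set.Iic P) := by
  obtain ⟨P, hP⟩ := hB.bounded x
  obtain ⟨Q, hQ⟩ := hB.bounded y
  exact ⟨max P₀ (max P Q), le_max_left _ _,
    degreesIn_mono (Set.Iic_subset_Iic.2 (by simp)) hP,
    degreesIn_mono (Set.Iic_subset_Iic.2 (by simp)) hQ⟩

section Curves

variable {K : Type*} [NontriviallyNormedField K] [NormedAlgebra K 𝕜]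

theorem hasVel_mul {γ δ : K → A} {v w : A} {t : K} (h : HasVel 𝕜 γ v t) (h' : HasVel 𝕜 δ w t) :
    HasVel 𝕜 (fun s => γ s * δ s) (v * δ t + γ t * w) t := by
  obtain ⟨P, hP⟩ := h.1
  obtain ⟨Q, hQ⟩ := h'.1
  have hv := h.mem hP
  have hw := h'.mem hQ
  refine ⟨⟨P + Q, ?_⟩, fun i => ?_⟩
  · filter_upwards [hP, hQ] with s h1 h2
    exact hB.mul_mem P Q _ h1 _ h2
  · obtain ⟨s, hs⟩ := hB.coord_mul P Q i
    have h1 : HasDerivAt (fun r => ∑ p ∈ s, coord p.1 (γ r) * coord p.2 (δ r))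
        (∑ p ∈ s, (coord p.1 v * coord p.2 (δ t) + coord p.1 (γ t) * coord p.2 w)) t :=
      HasDerivAt.fun_sum fun p _ => (h.2 p.1).mul (h'.2 p.2)
    -- The finite formula for a coordinate of a product needs the degree bounds; the velocities
    -- satisfy the same bounds as the curves.
    rw [map_add, hs v hv _ hQ.self_of_nhds, hs _ hP.self_of_nhds w hw, ← Finset.sum_add_distrib]
    refine h1.congr_of_eventuallyEq ?_
    filter_upwards [hP, hQ] with r hr hr'
    exact hs _ hr _ hr'

theorem hasDerivAt_form {γ δ : K → A} {v w : A} {t : K} (h : HasVel 𝕜 γ v t)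
    (h' : HasVel 𝕜 δ w t) :
    HasDerivAt (fun s => B (γ s) (δ s)) (B v (δ t) + B (γ t) w) t := by
  obtain ⟨tr, htr, h1, -⟩ := hB.trace
  simp only [h1, ← map_add]
  exact (hB.hasVel_mul h h').hasDerivAt_coordSpan htr

theorem vel_unique {γ : K → A} {v w : A} {t : K} (h : HasVel 𝕜 γ v t) (h' : HasVel 𝕜 γ w t) :
    v = w :=
  hB.ext _ _ fun i => (h.2 i).unique (h'.2 i)

end Curves

theorem hasVel_line (x X : A) (t : 𝕜) : HasVel 𝕜 (fun ε : 𝕜 => x + ε • X) X t := by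
  obtain ⟨P, -, h1, h2⟩ := hB.bounded₂ x X 0
  exact HasVel.line x X h1 h2 t

theorem smoothMapDeg_mul {M : Type*} [AddCommGroup M] [Module 𝕜 M] [CoordSpace 𝕜 M] {P : ℤ} {x : M}
    (hx : x ∈ degreesIn 𝕜 M (Set.Iic P)) {Φ Ψ : M → A} (h : SmoothMapDeg (𝕜 := 𝕜) P Φ x)
    (h' : SmoothMapDeg (𝕜 := 𝕜) P Ψ x) : SmoothMapDeg (𝕜 := 𝕜) P (fun y => Φ y * Ψ y) x := by
  obtain ⟨Q, hQ⟩ := h.1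
  obtain ⟨Q', hQ'⟩ := h'.1
  refine ⟨⟨Q + Q', ?_⟩, fun i => ?_⟩
  · filter_upwards [hQ, hQ'] with s h1 h2
    exact hB.mul_mem Q Q' _ h1 _ h2
  · obtain ⟨s, hs⟩ := hB.coord_mul Q Q' i
    have h1 : SmoothDeg P (fun y => ∑ p ∈ s, coord p.1 (Φ y) * coord p.2 (Ψ y)) x := by
      classical
      clear hs
      induction s using Finset.induction_on with
      | empty => simpa using SmoothDeg.const P (0 : 𝕜) x
      | insert a s ha ih =>
        simp only [Finset.sum_insert ha]
        exact ((h.2 a.1).mul hx (h'.2 a.2)).add hx ih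
    refine h1.congr ?_
    filter_upwards [hQ, hQ'] with r hr hr'
    exact hs _ hr _ hr'

theorem smoothDeg_form {M : Type*} [AddCommGroup M] [Module 𝕜 M] [CoordSpace 𝕜 M] {P : ℤ} {x : M}
    (hx : x ∈ degreesIn 𝕜 M (Set.Iic P)) {Φ Ψ : M → A} (h : SmoothMapDeg (𝕜 := 𝕜) P Φ x)
    (h' : SmoothMapDeg (𝕜 := 𝕜) P Ψ x) : SmoothDeg P (fun y => B (Φ y) (Ψ y)) x := by
  obtain ⟨tr, htr, h1, -⟩ := hB.trace
  simp only [h1]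
  exact SmoothDeg.coordSpan_comp hx (hB.smoothMapDeg_mul hx h h').2 htr

/-! ### Gradients -/

/-- For each `P` the restriction to degree at most `P` has a differential in finitely many
coordinates. These differentials are compatible, since each computes the derivative along lines.
Together they form one functional on the whole algebra, and `repr` represents it. -/
theorem exists_isGradient {φ : A → 𝕜} {x : A} (hφ : SmoothAt φ x) : ∃ G, IsGradient B φ x G := by
  rw [smoothAt_iff] at hφ
  have h1 : ∀ P, x ∈ degreesIn 𝕜 A (Set.Iic P) → ∃ (s : Finset (Idx 𝕜 A)) (Λ : (s → 𝕜) →L[𝕜] 𝕜),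
      ∀ X ∈ degreesIn 𝕜 A (Set.Iic P),
        HasDerivAt (fun ε : 𝕜 => φ (x + ε • X)) (Λ fun i => coord i.1 X) 0 := by
    intro P hP
    obtain ⟨s, f, hf, hs⟩ := hφ P hP
    refine ⟨s, fderiv 𝕜 f fun i => coord i.1 x, fun X hX => ?_⟩
    have h2 := HasVel.line x X hP hX 0
    have h3 : x + (0 : 𝕜) • X = x := by simp
    exact SmoothDeg.hasDerivAt_comp (γ := fun ε : 𝕜 => x + ε • X) (P := P)
      (by rw [h3]; exact (hf.differentiableAt (by simp)).hasFDerivAt) (by rwa [h3])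
      (Filter.Eventually.of_forall fun ε => add_mem hP (Submodule.smul_mem _ ε hX)) h2.2
  let l : A → 𝕜 := fun X => deriv (fun ε : 𝕜 => φ (x + ε • X)) 0
  have h2 : ∀ X, HasDerivAt (fun ε : 𝕜 => φ (x + ε • X)) (l X) 0 := by
    intro X
    obtain ⟨P, -, hx, hX⟩ := hB.bounded₂ x X 0
    obtain ⟨s, Λ, h⟩ := h1 P hx
    exact (h X hX).differentiableAt.hasDerivAt
  let l' : A →ₗ[𝕜] 𝕜 :=
    { toFun := l
      map_add' := by
        intro X Y
        obtain ⟨P₀, hx⟩ := hB.bounded x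
        obtain ⟨P, hP, hX, hY⟩ := hB.bounded₂ X Y P₀
        obtain ⟨s, Λ, h⟩ := h1 P (degreesIn_mono (Set.Iic_subset_Iic.2 hP) hx)
        rw [(h2 _).unique (h _ (add_mem hX hY)), (h2 _).unique (h _ hX), (h2 _).unique (h _ hY),
          ← map_add]
        congr 1
        funext i
        exact map_add _ _ _
      map_smul' := by
        intro r X
        obtain ⟨P, -, hx, hX⟩ := hB.bounded₂ x X 0
        obtain ⟨s, Λ, h⟩ := h1 P hx
        rw [(h2 _).unique (h _ (Submodule.smul_mem _ r hX)), (h2 _).unique (h _ hX),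
          ← map_smul]
        congr 1
        funext i
        exact map_smul _ _ _ }
  obtain ⟨G, hG⟩ := hB.repr l' (by
    intro P
    obtain ⟨P₀, hx⟩ := hB.bounded x
    obtain ⟨s, Λ, h⟩ := h1 (max P₀ P) (degreesIn_mono (Set.Iic_subset_Iic.2 (le_max_left _ _)) hx)
    refine ⟨s, fun X hX hs => ?_⟩
    have h3 := (h2 _).unique (h X (degreesIn_mono (Set.Iic_subset_Iic.2 (le_max_right _ _)) hX))
    change l X = 0
    rw [h3]
    have h4 : (fun i : s => coord i.1 X) = 0 := funext fun i => hs i.1 i.2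
    rw [h4, map_zero])
  exact ⟨G, fun X => by rw [hG]; exact h2 X⟩

theorem isGradient_grad {φ : A → 𝕜} {x : A} (hφ : SmoothAt φ x) :
    IsGradient B φ x (grad B φ x) := by
  have h := hB.exists_isGradient hφ
  rw [grad, dif_pos h]
  exact h.choose_spec

theorem grad_eq {φ : A → 𝕜} {x G : A} (h : IsGradient B φ x G) : grad B φ x = G := by
  have h' : ∃ G, IsGradient B φ x G := ⟨G, h⟩
  rw [grad, dif_pos h']
  exact hB.eq_of_form fun X => (h'.choose_spec X).unique (h X)

/-- The chain rule. -/
theorem hasDerivAt_comp {φ : A → 𝕜} {K : Type*} [NontriviallyNormedField K] [NormedAlgebra K 𝕜]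
    {γ : K → A} {v : A} {t : K} (hφ : SmoothAt φ (γ t)) (h : HasVel 𝕜 γ v t) :
    HasDerivAt (fun s => φ (γ s)) (B (grad B φ (γ t)) v) t := by
  obtain ⟨P, hP⟩ := h.1
  have hx := hP.self_of_nhds
  have hv := h.mem hP
  obtain ⟨s, f, hf, hs⟩ := (smoothAt_iff _ _).1 hφ P hx
  have hf' := (hf.differentiableAt (by simp)).hasFDerivAt
  have h1 := SmoothDeg.hasDerivAt_comp hf' hs hP h.2
  have h2 := HasVel.line (γ t) v hx hv 0
  have h3 : γ t + (0 : 𝕜) • v = γ t := by simp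
  have h4 := SmoothDeg.hasDerivAt_comp (γ := fun ε : 𝕜 => γ t + ε • v) (P := P) (t := 0)
      (by rw [h3]; exact hf') (by rwa [h3])
      (Filter.Eventually.of_forall fun ε => add_mem hx (Submodule.smul_mem _ ε hv)) h2.2
  rw [(hB.isGradient_grad hφ v).unique h4]
  exact h1

theorem form_grad {φ : A → 𝕜} {P : ℤ} {y : A} (hφ : SmoothAt φ y)
    (hy : y ∈ degreesIn 𝕜 A (Set.Iic P)) {s : Finset (Idx 𝕜 A)} {f : (s → 𝕜) → 𝕜}
    {Λ : (s → 𝕜) →L[𝕜] 𝕜} (hf : HasFDerivAt f Λ fun i => coord i.1 y)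
    (hs : ∀ᶠ z in nhdsDeg 𝕜 P y, φ z = f fun i => coord i.1 z) {X : A}
    (hX : X ∈ degreesIn 𝕜 A (Set.Iic P)) : B (grad B φ y) X = Λ fun i => coord i.1 X := by
  have h3 : y + (0 : 𝕜) • X = y := by simp
  have h4 := SmoothDeg.hasDerivAt_comp (γ := fun ε : 𝕜 => y + ε • X) (P := P) (t := 0)
      (by rw [h3]; exact hf) (by rwa [h3])
      (Filter.Eventually.of_forall fun ε => add_mem hy (Submodule.smul_mem _ ε hX))
      (HasVel.line y X hy hX 0).2
  exact (hB.isGradient_grad hφ X).unique h4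

/-- One finite set `s` of coordinates represents `φ` near `x`. A direction of degree below all
degrees in `s` leaves `φ` unchanged, and pairing the gradient with it picks out a coordinate of the
opposite, high degree, which therefore vanishes. -/
theorem grad_bounded {φ : A → 𝕜} (hφ : Smooth φ) {P : ℤ} {x : A}
    (hx : x ∈ degreesIn 𝕜 A (Set.Iic P)) :
    ∃ Q : ℤ, ∀ᶠ y in nhdsDeg 𝕜 P x, grad B φ y ∈ degreesIn 𝕜 A (Set.Iic Q) := by
  obtain ⟨s, f, hf, hs⟩ := (smoothAt_iff _ _).1 (hφ x) P hx
  obtain ⟨Q, hQ⟩ : ∃ Q : ℤ, ∀ i ∈ s, -Q ≤ deg i := by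
    obtain ⟨m, hm⟩ := (s.image (fun i => -deg i)).bddAbove
    exact ⟨m, fun i hi => by
      have := hm (Finset.mem_coe.2 (Finset.mem_image_of_mem _ hi))
      linarith⟩
  -- Beyond `Q` the dual element `e` is invisible to the coordinates in `s`; beyond `-P` it has
  -- degree at most `P`, so that the line `y + ε e` stays where `f` represents `φ`.
  refine ⟨max Q (-P), ?_⟩
  filter_upwards [nhdsDeg_eventually hs, nhdsDeg_mem P x] with y hy hyP i hi
  obtain ⟨e, he, h⟩ := hB.dual i
  rw [h]
  rw [Set.mem_Iic, not_le, max_lt_iff] at hi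
  have heP : e ∈ degreesIn 𝕜 A (Set.Iic P) :=
    degreesIn_mono (Set.singleton_subset_iff.2 (Set.mem_Iic.2 (by linarith))) he
  have h3 := (hB.isGradient_grad (hφ y) e)
  refine h3.unique ((hasDerivAt_const (0 : 𝕜) (φ y)).congr_of_eventuallyEq ?_)
  have h5 : Filter.Tendsto (fun ε : 𝕜 => y + ε • e) (𝓝 0) (nhdsDeg 𝕜 P y) := by
    refine tendsto_nhdsDeg (Filter.Eventually.of_forall fun ε =>
      add_mem hyP (Submodule.smul_mem _ ε heP)) fun j => ?_
    have := ((HasVel.line y e hyP heP 0).2 j).continuousAt.tendsto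
    simpa using this
  filter_upwards [h5.eventually hy] with ε hε
  rw [hε, nhdsDeg_self hyP hy]
  congr 1
  funext j
  have h6 : coord j.1 e = 0 := he j.1 (by
    have := hQ j.1 j.2
    rw [Set.mem_singleton_iff]
    intro h7
    linarith)
  simp [h6]

theorem smoothDeg_form_grad {φ : A → 𝕜} (hφ : Smooth φ) {P : ℤ} {x X : A}
    (hx : x ∈ degreesIn 𝕜 A (Set.Iic P)) (hX : X ∈ degreesIn 𝕜 A (Set.Iic P)) :
    SmoothDeg P (fun y => B (grad B φ y) X) x := by
  obtain ⟨s, f, hf, hs⟩ := (smoothAt_iff _ _).1 (hφ x) P hx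
  refine ⟨s, fun u => fderiv 𝕜 f u fun i => coord i.1 X,
    (hf.fderiv_right (m := ∞) le_rfl).clm_apply contDiffAt_const, ?_⟩
  have h1 : ∀ᶠ u in 𝓝 (fun i : s => coord i.1 x), DifferentiableAt 𝕜 f u := by
    have h2 : ContDiffAt 𝕜 1 f fun i : s => coord i.1 x := hf.of_le (by simp)
    filter_upwards [h2.eventually (by simp)] with u hu
    exact hu.differentiableAt one_ne_zero
  have h3 : Filter.Tendsto (fun y : A => fun i : s => coord i.1 y) (nhdsDeg 𝕜 P x)
      (𝓝 fun i : s => coord i.1 x) :=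
    tendsto_pi_nhds.2 fun i => tendsto_coord_nhdsDeg P x i.1
  filter_upwards [h3.eventually h1, nhdsDeg_eventually hs, nhdsDeg_mem P x] with y h4 h5 h6
  exact hB.form_grad (hφ y) h6 h4.hasFDerivAt h5 hX

theorem smoothMapDeg_grad {φ : A → 𝕜} (hφ : Smooth φ) {P : ℤ} {x : A}
    (hx : x ∈ degreesIn 𝕜 A (Set.Iic P)) : SmoothMapDeg (𝕜 := 𝕜) P (grad B φ) x := by
  refine ⟨hB.grad_bounded hφ hx, fun i => ?_⟩
  obtain ⟨e, -, he⟩ := hB.dual i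
  simp only [he]
  obtain ⟨Q, hQ, h1, h2⟩ := hB.bounded₂ x e P
  exact (hB.smoothDeg_form_grad hφ h1 h2).mono hQ

/-- The second derivative. -/
theorem exists_hessian {φ : A → 𝕜} (hφ : Smooth φ) (x : A) :
    ∃ D : A → A, (∀ X, HasVel 𝕜 (fun ε : 𝕜 => grad B φ (x + ε • X)) (D X) 0) ∧
      ∀ X Y, B (D X) Y = B (D Y) X := by
  have h1 : ∀ P, x ∈ degreesIn 𝕜 A (Set.Iic P) → ∃ (s : Finset (Idx 𝕜 A))
      (Q : (s → 𝕜) →L[𝕜] (s → 𝕜) →L[𝕜] 𝕜), (∀ u v, Q u v = Q v u) ∧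
      ∀ X ∈ degreesIn 𝕜 A (Set.Iic P), ∀ Y ∈ degreesIn 𝕜 A (Set.Iic P),
        HasDerivAt (fun ε : 𝕜 => B (grad B φ (x + ε • X)) Y)
          (Q (fun i => coord i.1 X) fun i => coord i.1 Y) 0 := by
    intro P hP
    obtain ⟨s, f, hf, hs⟩ := (smoothAt_iff _ _).1 (hφ x) P hP
    refine ⟨s, fderiv 𝕜 (fderiv 𝕜 f) fun i => coord i.1 x, fun u v => ?_, fun X hX Y hY => ?_⟩
    · have h2 : ContDiffAt 𝕜 2 f fun i : s => coord i.1 x := hf.of_le ENat.LEInfty.out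
      exact (h2.isSymmSndFDerivAt (by simp)).eq u v
    have h2 : ∀ᶠ u in 𝓝 (fun i : s => coord i.1 x), DifferentiableAt 𝕜 f u := by
      have h2 : ContDiffAt 𝕜 1 f fun i : s => coord i.1 x := hf.of_le (by simp)
      filter_upwards [h2.eventually (by simp)] with u hu
      exact hu.differentiableAt one_ne_zero
    have h3 : Filter.Tendsto (fun y : A => fun i : s => coord i.1 y) (nhdsDeg 𝕜 P x)
        (𝓝 fun i : s => coord i.1 x) :=
      tendsto_pi_nhds.2 fun i => tendsto_coord_nhdsDeg P x i.1
    have h4 : ∀ᶠ y in nhdsDeg 𝕜 P x, B (grad B φ y) Y =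
        fderiv 𝕜 f (fun i => coord i.1 y) fun i => coord i.1 Y := by
      filter_upwards [h3.eventually h2, nhdsDeg_eventually hs, nhdsDeg_mem P x] with y h4 h5 h6
      exact hB.form_grad (hφ y) h6 h4.hasFDerivAt h5 hY
    have h5 : DifferentiableAt 𝕜 (fderiv 𝕜 f) fun i : s => coord i.1 x :=
      (hf.fderiv_right (m := ∞) le_rfl).differentiableAt (by simp)
    have h6 := h5.hasFDerivAt.clm_apply
      (hasFDerivAt_const (fun i : s => coord i.1 Y) (fun i : s => coord i.1 x))
    have h7 : x + (0 : 𝕜) • X = x := by simp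
    have h8 := SmoothDeg.hasDerivAt_comp (φ := fun y => B (grad B φ y) Y) (P := P) (t := 0)
      (γ := fun ε : 𝕜 => x + ε • X) (by rw [h7]; exact h6)
      (by rw [h7]; exact h4)
      (Filter.Eventually.of_forall fun ε => add_mem hP (Submodule.smul_mem _ ε hX))
      (HasVel.line x X hP hX 0).2
    simpa using h8
  let l : A → A → 𝕜 := fun X Y => deriv (fun ε : 𝕜 => B (grad B φ (x + ε • X)) Y) 0
  obtain ⟨P₀, hx⟩ := hB.bounded x
  have hxP : ∀ P, P₀ ≤ P → x ∈ degreesIn 𝕜 A (Set.Iic P) :=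
    fun P hP => degreesIn_mono (Set.Iic_subset_Iic.2 hP) hx
  have h2 : ∀ X Y, HasDerivAt (fun ε : 𝕜 => B (grad B φ (x + ε • X)) Y) (l X Y) 0 := by
    intro X Y
    obtain ⟨P, hP, hX, hY⟩ := hB.bounded₂ X Y P₀
    obtain ⟨s, Λ, -, h⟩ := h1 P (hxP P hP)
    exact (h X hX Y hY).differentiableAt.hasDerivAt
  -- For fixed `X` the derivative of the gradient, paired with `Y`, is linear in `Y` and sees
  -- finitely many coordinates of `Y` in each bounded degree. So it is represented by an element,
  -- which becomes `D X`.
  have h3 : ∀ X, ∃ G, ∀ Y, B G Y = l X Y := by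
    intro X
    let l' : A →ₗ[𝕜] 𝕜 :=
      { toFun := l X
        map_add' := by
          intro Y Z
          refine (h2 X (Y + Z)).unique ?_
          simp only [map_add]
          exact (h2 X Y).add (h2 X Z)
        map_smul' := by
          intro r Y
          refine (h2 X (r • Y)).unique ?_
          simp only [map_smul, smul_eq_mul]
          exact (h2 X Y).const_mul r }
    refine hB.repr l' fun P => ?_
    obtain ⟨P', hP', hX, -⟩ := hB.bounded₂ X X (max P₀ P)
    obtain ⟨s, Λ, -, h⟩ := h1 P' (hxP P' ((le_max_left _ _).trans hP'))
    refine ⟨s, fun Y hY hs => ?_⟩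
    have h3 := (h2 _ _).unique (h X hX Y
      (degreesIn_mono (Set.Iic_subset_Iic.2 ((le_max_right _ _).trans hP')) hY))
    change l X Y = 0
    rw [h3]
    have h4 : (fun i : s => coord i.1 Y) = 0 := funext fun i => hs i.1 i.2
    rw [h4, map_zero]
  choose D hD using h3
  refine ⟨D, fun X => ⟨?_, fun i => ?_⟩, fun X Y => ?_⟩
  · obtain ⟨P, hP, hX, -⟩ := hB.bounded₂ X X P₀
    obtain ⟨Q, hQ⟩ := hB.grad_bounded hφ (hxP P hP)
    refine ⟨Q, Filter.Tendsto.eventually (f := fun ε : 𝕜 => x + ε • X)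
      (tendsto_nhdsDeg (Filter.Eventually.of_forall fun ε =>
        add_mem (hxP P hP) (Submodule.smul_mem _ ε hX)) fun j => ?_) hQ⟩
    have := ((hB.hasVel_line x X 0).2 j).continuousAt.tendsto
    simpa using this
  · obtain ⟨e, -, he⟩ := hB.dual i
    simp only [he, hD]
    exact h2 X e
  · rw [hD, hD]
    obtain ⟨P, hP, hX, hY⟩ := hB.bounded₂ X Y P₀
    obtain ⟨s, Λ, hs, h⟩ := h1 P (hxP P hP)
    rw [(h2 X Y).unique (h X hX Y hY), (h2 Y X).unique (h Y hY X hX), hs]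

end IsCoordAlg

end CoordAlg

/-! ### The direct product of two coordinate spaces or algebras. -/

section Product

variable {𝕜 : Type*} [RCLike 𝕜]

theorem mem_degreesIn_prod {M M' : Type*} [AddCommGroup M] [Module 𝕜 M] [CoordSpace 𝕜 M]
    [AddCommGroup M'] [Module 𝕜 M'] [CoordSpace 𝕜 M'] {s : Set ℤ} {x : M × M'} :
    x ∈ degreesIn 𝕜 (M × M') s ↔ x.1 ∈ degreesIn 𝕜 M s ∧ x.2 ∈ degreesIn 𝕜 M' s :=
  ⟨fun h => ⟨fun i hi => h (Sum.inl i) hi, fun i hi => h (Sum.inr i) hi⟩,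
    fun h i hi => by
      rcases i with i | i
      · exact h.1 i hi
      · exact h.2 i hi⟩

theorem hasVel_prodMk {M M' : Type*} [AddCommGroup M] [Module 𝕜 M] [CoordSpace 𝕜 M]
    [AddCommGroup M'] [Module 𝕜 M'] [CoordSpace 𝕜 M']
    {K : Type*} [NontriviallyNormedField K] [NormedAlgebra K 𝕜] {γ : K → M} {δ : K → M'} {v : M}
    {w : M'} {t : K} (h : HasVel 𝕜 γ v t) (h' : HasVel 𝕜 δ w t) :
    HasVel 𝕜 (fun s => (γ s, δ s)) (v, w) t := by
  obtain ⟨P, hP⟩ := h.1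
  obtain ⟨Q, hQ⟩ := h'.1
  refine ⟨⟨max P Q, ?_⟩, fun i => ?_⟩
  · filter_upwards [hP, hQ] with s h1 h2
    exact mem_degreesIn_prod.2 ⟨degreesIn_mono (Set.Iic_subset_Iic.2 (le_max_left _ _)) h1,
      degreesIn_mono (Set.Iic_subset_Iic.2 (le_max_right _ _)) h2⟩
  · rcases i with i | i
    · exact h.2 i
    · exact h'.2 i

theorem coordSpan_fst {M M' : Type*} [AddCommGroup M] [Module 𝕜 M] [CoordSpace 𝕜 M]
    [AddCommGroup M'] [Module 𝕜 M'] [CoordSpace 𝕜 M'] {l : M →ₗ[𝕜] 𝕜} (hl : l ∈ coordSpan 𝕜 M) :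
    l ∘ₗ LinearMap.fst 𝕜 M M' ∈ coordSpan 𝕜 (M × M') := by
  induction hl using Submodule.span_induction with
  | mem l hl =>
    obtain ⟨i, rfl⟩ := hl
    exact coord_mem_coordSpan (𝕜 := 𝕜) (M := M × M') (Sum.inl i)
  | zero => exact zero_mem _
  | add l l' _ _ hl hl' => exact add_mem hl hl'
  | smul r l _ hl => exact Submodule.smul_mem _ r hl

theorem coordSpan_snd {M M' : Type*} [AddCommGroup M] [Module 𝕜 M] [CoordSpace 𝕜 M]
    [AddCommGroup M'] [Module 𝕜 M'] [CoordSpace 𝕜 M'] {l : M' →ₗ[𝕜] 𝕜}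
    (hl : l ∈ coordSpan 𝕜 M') : l ∘ₗ LinearMap.snd 𝕜 M M' ∈ coordSpan 𝕜 (M × M') := by
  induction hl using Submodule.span_induction with
  | mem l hl =>
    obtain ⟨i, rfl⟩ := hl
    exact coord_mem_coordSpan (𝕜 := 𝕜) (M := M × M') (Sum.inr i)
  | zero => exact zero_mem _
  | add l l' _ _ hl hl' => exact add_mem hl hl'
  | smul r l _ hl => exact Submodule.smul_mem _ r hl

variable {A : Type*} [Ring A] [Algebra 𝕜 A]

theorem prodForm_apply (B : LinearMap.BilinForm 𝕜 A) (x y : A × A) :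
    prodForm B x y = B x.1 y.1 + B x.2 y.2 := rfl

theorem block_apply (a b c d : A →ₗ[𝕜] A) (x : A × A) :
    block a b c d x = (a x.1 + b x.2, c x.1 + d x.2) := rfl

variable [CoordSpace 𝕜 A]

theorem IsLocalOp.block {a b c d : A →ₗ[𝕜] A} (ha : IsLocalOp a) (hb : IsLocalOp b)
    (hc : IsLocalOp c) (hd : IsLocalOp d) : IsLocalOp (RelToda.block a b c d) := by
  have h1 : ∀ {a b : A →ₗ[𝕜] A}, IsLocalOp a → IsLocalOp b →
      IsLocalOp (LinearMap.coprod a b) := by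
    intro a b ha hb
    have h : LinearMap.coprod a b = a ∘ₗ LinearMap.fst 𝕜 A A + b ∘ₗ LinearMap.snd 𝕜 A A := by
      ext <;> simp
    rw [h]
    refine IsLocalOp.add ⟨fun P => ?_, fun i => coordSpan_fst (ha.2 i)⟩
      ⟨fun P => ?_, fun i => coordSpan_snd (hb.2 i)⟩
    · obtain ⟨Q, hQ⟩ := ha.1 P
      exact ⟨Q, fun x hx => hQ _ (mem_degreesIn_prod.1 hx).1⟩
    · obtain ⟨Q, hQ⟩ := hb.1 P
      exact ⟨Q, fun x hx => hQ _ (mem_degreesIn_prod.1 hx).2⟩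
  have h2 := h1 ha hb
  have h3 := h1 hc hd
  refine ⟨fun P => ?_, fun i => ?_⟩
  · obtain ⟨Q, hQ⟩ := h2.1 P
    obtain ⟨Q', hQ'⟩ := h3.1 P
    exact ⟨max Q Q', fun x hx => mem_degreesIn_prod.2
      ⟨degreesIn_mono (Set.Iic_subset_Iic.2 (le_max_left _ _)) (hQ x hx),
        degreesIn_mono (Set.Iic_subset_Iic.2 (le_max_right _ _)) (hQ' x hx)⟩⟩
  · rcases i with i | i
    · exact h2.2 i
    · exact h3.2 i

/-- By this the calculus of gradients and the theory of quadratic brackets apply to `g × g` without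
further work. -/
theorem IsCoordAlg.prod {B : LinearMap.BilinForm 𝕜 A} (hB : IsCoordAlg B) :
    IsCoordAlg (prodForm B) where
  bounded x := by
    obtain ⟨P, -, h1, h2⟩ := hB.bounded₂ x.1 x.2 0
    exact ⟨P, mem_degreesIn_prod.2 ⟨h1, h2⟩⟩
  ext x y h := Prod.ext (hB.ext _ _ fun i => h (Sum.inl i)) (hB.ext _ _ fun i => h (Sum.inr i))
  repr l hl := by
    classical
    obtain ⟨G, hG⟩ := hB.repr (l ∘ₗ LinearMap.inl 𝕜 A A) (by
      intro P
      obtain ⟨s, hs⟩ := hl P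
      refine ⟨s.preimage Sum.inl Sum.inl_injective.injOn, fun x hx h => hs (x, 0)
        (mem_degreesIn_prod.2 ⟨hx, zero_mem _⟩) fun i hi => ?_⟩
      rcases i with i | i
      · exact h i (Finset.mem_preimage.2 hi)
      · exact map_zero (coord i))
    obtain ⟨H, hH⟩ := hB.repr (l ∘ₗ LinearMap.inr 𝕜 A A) (by
      intro P
      obtain ⟨s, hs⟩ := hl P
      refine ⟨s.preimage Sum.inr Sum.inr_injective.injOn, fun x hx h => hs (0, x)
        (mem_degreesIn_prod.2 ⟨zero_mem _, hx⟩) fun i hi => ?_⟩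
      rcases i with i | i
      · exact map_zero (coord i)
      · exact h i (Finset.mem_preimage.2 hi))
    refine ⟨(G, H), fun x => ?_⟩
    rw [prodForm_apply, hG, hH]
    simp [← map_add]
  dual i := by
    rcases i with i | i
    · obtain ⟨e, he, h⟩ := hB.dual i
      refine ⟨(e, 0), mem_degreesIn_prod.2 ⟨he, zero_mem _⟩, fun x => ?_⟩
      rw [prodForm_apply, ← h, map_zero, add_zero]
      rfl
    · obtain ⟨e, he, h⟩ := hB.dual i
      refine ⟨(0, e), mem_degreesIn_prod.2 ⟨zero_mem _, he⟩, fun x => ?_⟩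
      rw [prodForm_apply, ← h, map_zero, zero_add]
      rfl
  mul_mem P Q x hx y hy := by
    rw [mem_degreesIn_prod] at hx hy ⊢
    exact ⟨hB.mul_mem P Q _ hx.1 _ hy.1, hB.mul_mem P Q _ hx.2 _ hy.2⟩
  coord_mul P Q i := by
    rcases i with i | i
    · obtain ⟨s, hs⟩ := hB.coord_mul P Q i
      refine ⟨s.map ⟨Prod.map Sum.inl Sum.inl, Sum.inl_injective.prodMap Sum.inl_injective⟩,
        fun x hx y hy => ?_⟩
      rw [Finset.sum_map]
      exact hs _ (mem_degreesIn_prod.1 hx).1 _ (mem_degreesIn_prod.1 hy).1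
    · obtain ⟨s, hs⟩ := hB.coord_mul P Q i
      refine ⟨s.map ⟨Prod.map Sum.inr Sum.inr, Sum.inr_injective.prodMap Sum.inr_injective⟩,
        fun x hx y hy => ?_⟩
      rw [Finset.sum_map]
      exact hs _ (mem_degreesIn_prod.1 hx).2 _ (mem_degreesIn_prod.1 hy).2
  trace := by
    obtain ⟨tr, htr, h1, h2⟩ := hB.trace
    refine ⟨tr ∘ₗ LinearMap.fst 𝕜 A A + tr ∘ₗ LinearMap.snd 𝕜 A A,
      add_mem (coordSpan_fst htr) (coordSpan_snd htr), fun x y => ?_, fun x y => ?_⟩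
    · rw [prodForm_apply, h1, h1]
      rfl
    · change tr (x.1 * y.1) + tr (x.2 * y.2) = tr (y.1 * x.1) + tr (y.2 * x.2)
      rw [h2 x.1, h2 x.2]

end Product

/-! ### The algebraic identity behind the Jacobi identity. -/

section Poisson

variable {𝕜 : Type*} [RCLike 𝕜] {A : Type*} [Ring A] [Algebra 𝕜 A]

/-- The operators `A₁, A₂, S, S*` of a quadratic bracket that differ from the `r`-matrix `R` only by
operators with values in a commutative subalgebra `D` whose orthogonal complement contains all the
elements `[Rx,y] + [x,Ry]`. -/
structure IsRMatrixBracket (B : LinearMap.BilinForm 𝕜 A) (R A₁ A₂ S S' : A →ₗ[𝕜] A)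
    (D : Submodule 𝕜 A) : Prop where
  skew₁ : ∀ x y, B (A₁ x) y = -B x (A₁ y)
  skew₂ : ∀ x y, B (A₂ x) y = -B x (A₂ y)
  adj : ∀ x y, B (S x) y = B x (S' y)
  diag₁ : ∀ x, A₁ x - R x ∈ D
  diag₂ : ∀ x, A₂ x - R x ∈ D
  diagS : ∀ x, S x ∈ D
  diagS' : ∀ x, S' x ∈ D
  comm : ∀ x ∈ D, ∀ y ∈ D, x * y = y * x
  orth : ∀ d ∈ D, ∀ x y, B d (R x * y - y * R x + (x * R y - R y * x)) = 0
  yangBaxter : ∀ x y, R x * R y - R y * R x + (x * y - y * x) =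
    R (R x * y - y * R x + (x * R y - R y * x))
  skewR : ∀ x y, B (R x) y = -B x (R y)

/-- The tensor of the Hamiltonian structure: `{φ, ψ} = ⟨X, ∇ψ⟩` with the vector `X` at `L`, if
`∇φ(L) = G`. -/
noncomputable def hamVector (A₁ A₂ S S' : A →ₗ[𝕜] A) (L G : A) : A :=
  (1 / 2 : 𝕜) • (L * (A₁ (G * L) + S (L * G)) - (A₂ (L * G) + S' (G * L)) * L)

variable [CoordSpace 𝕜 A] {B : LinearMap.BilinForm 𝕜 A} {R A₁ A₂ S S' : A →ₗ[𝕜] A}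
  {D : Submodule 𝕜 A}

theorem form_hamVector (hB : IsCoordAlg B) (L G H : A) :
    B (hamVector A₁ A₂ S S' L G) H = (1 / 2) * (B (A₁ (G * L) + S (L * G)) (H * L) -
      B (A₂ (L * G) + S' (G * L)) (L * H)) := by
  rw [hamVector, map_smul, LinearMap.smul_apply, smul_eq_mul, map_sub, LinearMap.sub_apply,
    hB.form_mul_cycle L, hB.form_mul _ L]

/-- Moving `S` back across the form leaves one pairing with the right and one with the left
differential of `ψ`. In this shape the bracket is differentiated and compared with `hamVector`. -/
theorem quadraticBracket_eq_sub (hB : IsCoordAlg B) (hS : ∀ x y, B (S x) y = B x (S' y))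
    (φ ψ : A → 𝕜) (L : A) : quadraticBracket B A₁ A₂ S φ ψ L = (1 / 2) *
      (B (A₁ (grad B φ L * L) + S (L * grad B φ L)) (grad B ψ L * L) -
      B (A₂ (L * grad B φ L) + S' (grad B φ L * L)) (L * grad B ψ L)) := by
  have h : B (dRight B φ L) (S (dLeft B ψ L)) = B (S' (dRight B φ L)) (dLeft B ψ L) := by
    rw [hB.form_comm, hS, hB.form_comm]
  rw [quadraticBracket, h, map_add, map_add, LinearMap.add_apply, LinearMap.add_apply]
  simp only [dLeft, dRight]
  ring

theorem quadraticBracket_eq (hB : IsCoordAlg B) (hS : ∀ x y, B (S x) y = B x (S' y))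
    (φ ψ : A → 𝕜) (L : A) : quadraticBracket B A₁ A₂ S φ ψ L =
      B (hamVector A₁ A₂ S S' L (grad B φ L)) (grad B ψ L) := by
  rw [quadraticBracket_eq_sub hB hS, form_hamVector hB]

/-- Pairing the Yang-Baxter equation with `z` and moving `R` by skew-symmetry gives the case `c = d
= e = 0`. The terms linear in one of `c`, `d`, `e` are the three relations `orth`; the quadratic
ones vanish because `D` is commutative. -/
theorem IsRMatrixBracket.cycle (hB : IsCoordAlg B) (h : IsRMatrixBracket B R A₁ A₂ S S' D)
    (x y z : A) {c d e : A} (hc : c ∈ D) (hd : d ∈ D) (he : e ∈ D) :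
    B ((R x + c) * (R y + d) - (R y + d) * (R x + c)) z
      + B ((R y + d) * (R z + e) - (R z + e) * (R y + d)) x
      + B ((R z + e) * (R x + c) - (R x + c) * (R z + e)) y = -B (x * y - y * x) z := by
  obtain ⟨tr, -, htr, hcomm⟩ := hB.trace
  have h1 := congrArg (fun w => B w z) (h.yangBaxter x y)
  simp only [h.skewR] at h1
  have o1 := h.orth c hc y z
  have o2 := h.orth d hd z x
  have o3 := h.orth e he x y
  have c1 := h.comm c hc d hd
  have c2 := h.comm d hd e he
  have c3 := h.comm e he c hc
  have hr : ∀ u v w, tr (u * (v * w)) = tr (v * (w * u)) := fun u v w => by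
    rw [hcomm, mul_assoc]
  have e1 : tr (c * (d * z)) = tr (d * (c * z)) := by rw [← mul_assoc, c1, mul_assoc]
  have e2 : tr (d * (e * x)) = tr (e * (d * x)) := by rw [← mul_assoc, c2, mul_assoc]
  have e3 : tr (e * (c * y)) = tr (c * (e * y)) := by rw [← mul_assoc, c3, mul_assoc]
  simp only [htr] at h1 o1 o2 o3 ⊢
  simp only [mul_add, add_mul, mul_sub, sub_mul, map_add, map_sub, mul_assoc,
    hr y, hr (R y), hr d, hr z, hr (R z), hr e] at h1 o1 o2 o3 e1 e2 e3 ⊢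
  linear_combination h1 + o1 + o2 + o3 + e1 + e2 + e3

/-- This is the part of the Jacobi sum without second derivatives. Each of `aF, …, bH` is a value of
`R` plus an element of `D`, so `cycle` applies to the triple `FL, GL, HL` and to the triple `LF, LG,
LH`. The sum is half the difference of the two identities, whose right-hand sides agree by cyclicity
of the trace (`k₃`). -/
theorem IsRMatrixBracket.jacobi (hB : IsCoordAlg B) (h : IsRMatrixBracket B R A₁ A₂ S S' D)
    (L F G H : A) {X Y Z : A} (hX : X = hamVector A₁ A₂ S S' L F)
    (hY : Y = hamVector A₁ A₂ S S' L G) (hZ : Z = hamVector A₁ A₂ S S' L H) {aF bF aG bG aH bH : A}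
    (haF : aF = A₁ (F * L) + S (L * F)) (hbF : bF = A₂ (L * F) + S' (F * L))
    (haG : aG = A₁ (G * L) + S (L * G)) (hbG : bG = A₂ (L * G) + S' (G * L))
    (haH : aH = A₁ (H * L) + S (L * H)) (hbH : bH = A₂ (L * H) + S' (H * L)) :
    (-B (G * X) aH + B (X * G) bH + B aG (H * X) - B bG (X * H))
    + (-B (H * Y) aF + B (Y * H) bF + B aH (F * Y) - B bH (Y * F))
    + (-B (F * Z) aG + B (Z * F) bG + B aF (G * Z) - B bF (Z * G)) = 0 := by
  have hd₁ : ∀ U : A, A₁ (U * L) + S (L * U) =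
      R (U * L) + (A₁ (U * L) - R (U * L) + S (L * U)) := fun U => by abel
  have hd₂ : ∀ U : A, A₂ (L * U) + S' (U * L) =
      R (L * U) + (A₂ (L * U) - R (L * U) + S' (U * L)) := fun U => by abel
  have m₁ : ∀ U : A, A₁ (U * L) - R (U * L) + S (L * U) ∈ D :=
    fun U => add_mem (h.diag₁ _) (h.diagS _)
  have m₂ : ∀ U : A, A₂ (L * U) - R (L * U) + S' (U * L) ∈ D :=
    fun U => add_mem (h.diag₂ _) (h.diagS' _)
  have k₁ := h.cycle hB (F * L) (G * L) (H * L) (m₁ F) (m₁ G) (m₁ H)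
  have k₂ := h.cycle hB (L * F) (L * G) (L * H) (m₂ F) (m₂ G) (m₂ H)
  simp only [← hd₁, ← hd₂] at k₁ k₂
  rw [← haF, ← haG, ← haH] at k₁
  rw [← hbF, ← hbG, ← hbH] at k₂
  rw [hamVector, ← haF, ← hbF] at hX
  rw [hamVector, ← haG, ← hbG] at hY
  rw [hamVector, ← haH, ← hbH] at hZ
  have k₃ : B (F * L * (G * L) - G * L * (F * L)) (H * L) =
      B (L * F * (L * G) - L * G * (L * F)) (L * H) := by
    simp only [map_sub, LinearMap.sub_apply]
    have : ∀ U V : A, B (U * L * (V * L)) (H * L) = B (L * U * (L * V)) (L * H) := fun U V => by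
      rw [← hB.form_mul, hB.form_comm _ L, ← hB.form_mul]
      simp only [mul_assoc, ← hB.form_mul]
    rw [this, this]
  clear hd₁ hd₂ m₁ m₂ haF haG haH hbF hbG hbH
  have l₁ : ∀ a b d U : A, B (U * ((1 / 2 : 𝕜) • (L * a - b * L))) d =
      1 / 2 * (B (a * d) (U * L) - B (d * U) (b * L)) := by
    intro a b d U
    rw [mul_smul_comm, map_smul, LinearMap.smul_apply, smul_eq_mul, mul_sub, map_sub,
      LinearMap.sub_apply, ← mul_assoc, hB.form_mul (U * L), hB.form_comm (U * L),
      hB.form_mul d, hB.form_comm d]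
  have l₂ : ∀ a b d U : A, B (((1 / 2 : 𝕜) • (L * a - b * L)) * U) d =
      1 / 2 * (B (a * U) (d * L) - B (d * b) (L * U)) := by
    intro a b d U
    rw [smul_mul_assoc, map_smul, LinearMap.smul_apply, smul_eq_mul, sub_mul, map_sub,
      LinearMap.sub_apply, mul_assoc, hB.form_mul_cycle L, hB.form_mul d, mul_assoc, hB.form_comm d]
  have r₁ : ∀ a b d U : A, B d (U * ((1 / 2 : 𝕜) • (L * a - b * L))) =
      1 / 2 * (B (a * d) (U * L) - B (d * U) (b * L)) := by
    intro a b d U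
    rw [hB.form_comm, l₁ a b d U]
  have r₂ : ∀ a b d U : A, B d (((1 / 2 : 𝕜) • (L * a - b * L)) * U) =
      1 / 2 * (B (a * U) (d * L) - B (d * b) (L * U)) := by
    intro a b d U
    rw [hB.form_comm, l₂ a b d U]
  rw [hX, hY, hZ]
  simp only [l₁, l₂, r₁, r₂]
  simp only [map_sub, LinearMap.sub_apply] at k₁ k₂ k₃
  linear_combination (1 / 2) * k₁ - (1 / 2) * k₂ - (1 / 2) * k₃

end Poisson

/-! ### The axioms of a Poisson bracket, and Hamiltonian vector fields. -/

section Poisson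

variable {𝕜 : Type*} [RCLike 𝕜] {M : Type*} [AddCommGroup M] [Module 𝕜 M] [CoordSpace 𝕜 M]
  {M' : Type*} [AddCommGroup M'] [Module 𝕜 M'] [CoordSpace 𝕜 M']

theorem SmoothMapDeg.add {P : ℤ} {x : M} (hx : x ∈ degreesIn 𝕜 M (Set.Iic P)) {Φ Ψ : M → M'}
    (h : SmoothMapDeg (𝕜 := 𝕜) P Φ x) (h' : SmoothMapDeg (𝕜 := 𝕜) P Ψ x) :
    SmoothMapDeg (𝕜 := 𝕜) P (fun y => Φ y + Ψ y) x := by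
  obtain ⟨Q, hQ⟩ := h.1
  obtain ⟨Q', hQ'⟩ := h'.1
  refine ⟨⟨max Q Q', ?_⟩, fun i => ?_⟩
  · filter_upwards [hQ, hQ'] with s h1 h2
    exact add_mem (degreesIn_mono (Set.Iic_subset_Iic.2 (le_max_left _ _)) h1)
      (degreesIn_mono (Set.Iic_subset_Iic.2 (le_max_right _ _)) h2)
  · simp only [map_add]
    exact (h.2 i).add hx (h'.2 i)

theorem HasVel.add {K : Type*} [NontriviallyNormedField K] [NormedAlgebra K 𝕜] {γ δ : K → M}
    {v w : M} {t : K} (h : HasVel 𝕜 γ v t) (h' : HasVel 𝕜 δ w t) :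
    HasVel 𝕜 (fun s => γ s + δ s) (v + w) t := by
  obtain ⟨Q, hQ⟩ := h.1
  obtain ⟨Q', hQ'⟩ := h'.1
  refine ⟨⟨max Q Q', ?_⟩, fun i => ?_⟩
  · filter_upwards [hQ, hQ'] with s h1 h2
    exact add_mem (degreesIn_mono (Set.Iic_subset_Iic.2 (le_max_left _ _)) h1)
      (degreesIn_mono (Set.Iic_subset_Iic.2 (le_max_right _ _)) h2)
  · simp only [map_add]
    exact (h.2 i).add (h'.2 i)

variable {A : Type*} [Ring A] [Algebra 𝕜 A] [CoordSpace 𝕜 A] {B : LinearMap.BilinForm 𝕜 A}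
  {R A₁ A₂ S S' : A →ₗ[𝕜] A} {D : Submodule 𝕜 A}

namespace IsCoordAlg

variable (hB : IsCoordAlg B)

include hB

theorem grad_add {φ ψ : A → 𝕜} {x : A} (hφ : SmoothAt φ x) (hψ : SmoothAt ψ x) :
    grad B (φ + ψ) x = grad B φ x + grad B ψ x :=
  hB.grad_eq fun X => by
    rw [map_add]
    exact (hB.isGradient_grad hφ X).add (hB.isGradient_grad hψ X)

theorem grad_smul (r : 𝕜) {φ : A → 𝕜} {x : A} (hφ : SmoothAt φ x) :
    grad B (r • φ) x = r • grad B φ x :=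
  hB.grad_eq fun X => by
    rw [map_smul]
    exact (hB.isGradient_grad hφ X).const_mul r

theorem grad_mul {φ ψ : A → 𝕜} {x : A} (hφ : SmoothAt φ x) (hψ : SmoothAt ψ x) :
    grad B (φ * ψ) x = ψ x • grad B φ x + φ x • grad B ψ x :=
  hB.grad_eq fun X => by
    have h := (hB.isGradient_grad hφ X).mul (hB.isGradient_grad hψ X)
    simp only [zero_smul, add_zero] at h
    simp only [map_add, map_smul, LinearMap.add_apply, LinearMap.smul_apply, smul_eq_mul]
    rw [mul_comm (ψ x)]
    exact h

theorem smoothAt_quadraticBracket (hS : ∀ x y, B (S x) y = B x (S' y)) (l₁ : IsLocalOp A₁)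
    (l₂ : IsLocalOp A₂) (lS : IsLocalOp S) (lS' : IsLocalOp S') {φ ψ : A → 𝕜} (hφ : Smooth φ)
    (hψ : Smooth ψ) : Smooth (quadraticBracket B A₁ A₂ S φ ψ) := by
  refine fun x => (smoothAt_iff _ _).2 fun P hx => ?_
  have hL := SmoothMapDeg.id (𝕜 := 𝕜) P x
  have hF := hB.smoothMapDeg_grad hφ hx
  have hG := hB.smoothMapDeg_grad hψ hx
  have h1 := hB.smoothMapDeg_mul hx hF hL
  have h2 := hB.smoothMapDeg_mul hx hL hF
  have h3 := hB.smoothMapDeg_mul hx hG hL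
  have h4 := hB.smoothMapDeg_mul hx hL hG
  have h5 := hB.smoothDeg_form hx ((h1.op hx l₁).add hx (h2.op hx lS)) h3
  have h6 := hB.smoothDeg_form hx ((h2.op hx l₂).add hx (h1.op hx lS')) h4
  exact ((h5.sub hx h6).const_mul hx (1 / 2)).congr
    (Filter.Eventually.of_forall fun y => quadraticBracket_eq_sub hB hS φ ψ y)

theorem isHamiltonianVector (hS : ∀ x y, B (S x) y = B x (S' y)) (α : 𝕜) (φ : A → 𝕜) (L : A) :
    IsHamiltonianVector (fun φ ψ => α • quadraticBracket B A₁ A₂ S φ ψ) φ L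
      (α • hamVector A₁ A₂ S S' L (grad B φ L)) := by
  intro ψ hψ
  have h := hB.isGradient_grad hψ (α • hamVector A₁ A₂ S S' L (grad B φ L))
  rw [map_smul, hB.form_comm, ← quadraticBracket_eq hB hS] at h
  exact h

end IsCoordAlg

/-- Only the Jacobi identity has content. The derivative of `{ψ, χ}` along `X` (`key`) splits into
the Hessians of `ψ` and `χ`, paired with the Hamiltonian vectors of `χ` and `ψ`, and a part with
first derivatives only. In the cyclic sum the former cancel and the latter is `jacobi`. -/
theorem IsRMatrixBracket.isPoissonBracket (hB : IsCoordAlg B)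
    (h : IsRMatrixBracket B R A₁ A₂ S S' D) (l₁ : IsLocalOp A₁) (l₂ : IsLocalOp A₂)
    (lS : IsLocalOp S) (lS' : IsLocalOp S') (α : 𝕜) :
    IsPoissonBracket fun φ ψ => α • quadraticBracket B A₁ A₂ S φ ψ := by
  have hsm : ∀ φ ψ : A → 𝕜, Smooth φ → Smooth ψ → Smooth (quadraticBracket B A₁ A₂ S φ ψ) :=
    fun φ ψ hφ hψ => hB.smoothAt_quadraticBracket h.adj l₁ l₂ lS lS' hφ hψ
  have hbr := quadraticBracket_eq (A₁ := A₁) (A₂ := A₂) hB h.adj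
  refine ⟨fun φ ψ hφ hψ x => (hsm φ ψ hφ hψ x).smul α, fun φ ψ _ _ => ?_,
    fun φ ψ χ _ hψ hχ => ?_, fun r φ ψ _ hψ => ?_, fun φ ψ χ _ hψ hχ => ?_,
    fun φ ψ χ hφ hψ hχ => ?_⟩
  · rw [← smul_neg]
    congr 1
    funext L
    simp only [quadraticBracket, Pi.neg_apply]
    rw [h.skew₁ (dRight B φ L), h.skew₂ (dLeft B φ L), hB.form_comm (A₁ (dRight B ψ L)),
      hB.form_comm (A₂ (dLeft B ψ L)), hB.form_comm (S (dLeft B ψ L)),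
      hB.form_comm _ (S (dLeft B φ L))]
    ring
  · funext L
    simp only [Pi.smul_apply, Pi.add_apply, hbr, hB.grad_add (hψ L) (hχ L), map_add, smul_add]
  · funext L
    simp only [Pi.smul_apply, hbr, hB.grad_smul r (hψ L), map_smul, smul_eq_mul]
    ring
  · funext L
    simp only [Pi.smul_apply, Pi.add_apply, Pi.mul_apply, hbr, hB.grad_mul (hψ L) (hχ L), map_add,
      map_smul, smul_eq_mul]
    ring
  · funext L
    obtain ⟨Dφ, hDφ, sφ⟩ := hB.exists_hessian hφ L
    obtain ⟨Dψ, hDψ, sψ⟩ := hB.exists_hessian hψ L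
    obtain ⟨Dχ, hDχ, sχ⟩ := hB.exists_hessian hχ L
    have key : ∀ (ψ χ : A → 𝕜) (Dψ Dχ : A → A) (X : A), Smooth ψ → Smooth χ →
        HasVel 𝕜 (fun ε : 𝕜 => grad B ψ (L + ε • X)) (Dψ X) 0 →
        HasVel 𝕜 (fun ε : 𝕜 => grad B χ (L + ε • X)) (Dχ X) 0 →
        B X (grad B (α • quadraticBracket B A₁ A₂ S ψ χ) L) = α *
          (-B (Dψ X) (hamVector A₁ A₂ S S' L (grad B χ L)) +
            B (Dχ X) (hamVector A₁ A₂ S S' L (grad B ψ L)) + 1 / 2 *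
          (-B (grad B ψ L * X) (A₁ (grad B χ L * L) + S (L * grad B χ L)) +
            B (X * grad B ψ L) (A₂ (L * grad B χ L) + S' (grad B χ L * L)) +
            B (A₁ (grad B ψ L * L) + S (L * grad B ψ L)) (grad B χ L * X) -
            B (A₂ (L * grad B ψ L) + S' (grad B ψ L * L)) (X * grad B χ L))) := by
      intro ψ χ Dψ Dχ X hψ hχ hG hH
      have hL := hB.hasVel_line L X 0
      have h0 : L + (0 : 𝕜) • X = L := by simp
      have v1 := hB.hasVel_mul hG hL
      have v2 := hB.hasVel_mul hL hG
      have v3 := hB.hasVel_mul hH hL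
      have v4 := hB.hasVel_mul hL hH
      have v5 := hB.hasDerivAt_form ((v1.op l₁).add (v2.op lS)) v3
      have v6 := hB.hasDerivAt_form ((v2.op l₂).add (v1.op lS')) v4
      have v7 := ((v5.sub v6).const_mul (1 / 2)).const_mul α
      have v8 := hB.isGradient_grad ((hsm ψ χ hψ hχ L).smul α) X
      have v9 := v8.unique (v7.congr_of_eventuallyEq (Filter.Eventually.of_forall fun ε => by
        change α * quadraticBracket B A₁ A₂ S ψ χ (L + ε • X) = _
        rw [quadraticBracket_eq_sub hB h.adj]
        rfl))
      rw [hB.form_comm, v9, h0]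
      have hadj' : ∀ x y, B (S' x) y = B x (S y) := fun x y => by
        rw [hB.form_comm, ← h.adj, hB.form_comm]
      rw [hB.form_comm (Dψ X), hB.form_comm (Dχ X), form_hamVector hB, form_hamVector hB]
      simp only [map_add, LinearMap.add_apply, h.skew₁, h.skew₂, h.adj, hadj', mul_add]
      simp only [hB.form_comm (Dψ X * L), hB.form_comm (L * Dψ X), h.skew₁, h.skew₂, h.adj, hadj']
      ring
    simp only [Pi.add_apply, Pi.smul_apply, Pi.zero_apply, hbr φ, hbr ψ, hbr χ]
    rw [key ψ χ Dψ Dχ _ hψ hχ (hDψ _) (hDχ _), key χ φ Dχ Dφ _ hχ hφ (hDχ _) (hDφ _),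
      key φ ψ Dφ Dψ _ hφ hψ (hDφ _) (hDψ _)]
    have hJ := h.jacobi hB L (grad B φ L) (grad B ψ L) (grad B χ L) rfl rfl rfl rfl rfl rfl rfl rfl
      rfl
    -- Symmetry of each Hessian exchanges the two Hamiltonian vectors it is paired with, so that its
    -- two occurrences cancel.
    rw [sφ _ (hamVector A₁ A₂ S S' L (grad B ψ L)), sψ _ (hamVector A₁ A₂ S S' L (grad B χ L)),
      sχ _ (hamVector A₁ A₂ S S' L (grad B φ L))]
    simp only [smul_eq_mul]
    linear_combination (1 / 2) * α ^ 2 * hJ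

end Poisson

/-! ### Entries of the elements of `g` and of their products. -/

section Entries

variable {𝕜 : Type*} [RCLike 𝕜] {N : ℕ} {b : Boundary}

/-- Whether `E_jk` occurs in the component of degree `p`. -/
def Occurs (N : ℕ) : Boundary → ℤ → Fin N → Fin N → Prop
  | .openEnd, p, j, k => ((j : ℕ) : ℤ) - ((k : ℕ) : ℤ) = p
  | .periodic, p, j, k => ((j : ℕ) : ℤ) - ((k : ℕ) : ℤ) ≡ p [ZMOD N]

theorem entry_openEnd (p : ℤ) (j k : Fin N) (X : Alg 𝕜 N .openEnd) :
    entry 𝕜 N .openEnd p j k X = if ((j : ℕ) : ℤ) - ((k : ℕ) : ℤ) = p then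
      (show Matrix (Fin N) (Fin N) 𝕜 from X) j k else 0 := by
  simp only [entry]
  split_ifs <;> rfl

theorem entry_periodic (p : ℤ) (j k : Fin N) (X : Alg 𝕜 N .periodic) :
    entry 𝕜 N .periodic p j k X = Series.lam p ((show twistedLoop 𝕜 N from X).1 j k) := rfl

theorem entry_eq_zero {p : ℤ} {j k : Fin N} (h : ¬Occurs N b p j k) (X : Alg 𝕜 N b) :
    entry 𝕜 N b p j k X = 0 := by
  cases b with
  | openEnd => exact (entry_openEnd p j k X).trans (if_neg h)
  | periodic =>
    rw [entry_periodic]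
    by_contra h'
    exact h (X.2 p j k h')

theorem alg_ext {X Y : Alg 𝕜 N b} (h : ∀ p j k, entry 𝕜 N b p j k X = entry 𝕜 N b p j k Y) :
    X = Y := by
  cases b with
  | openEnd =>
    refine Matrix.ext fun j k => ?_
    have h1 := h (((j : ℕ) : ℤ) - ((k : ℕ) : ℤ)) j k
    rw [entry_openEnd, entry_openEnd, if_pos rfl, if_pos rfl] at h1
    exact h1
  | periodic =>
    refine Subtype.ext (Matrix.ext fun j k => HahnSeries.ext (funext fun n => ?_))
    have h1 := h (-n) j k
    rw [entry_periodic, entry_periodic] at h1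
    change HahnSeries.coeff _ (- -n) = HahnSeries.coeff _ (- -n) at h1
    rwa [neg_neg] at h1

/-- Negative powers of `λ` are unrestricted, so besides the pattern of occurring entries only a
bound of the degrees from above is needed. Representing elements of functionals, the Neumann series
and the derivative of `U⁻¹` are built in this way. -/
theorem exists_of_entries (c : ℤ → Fin N → Fin N → 𝕜)
    (hc : ∀ p j k, ¬Occurs N b p j k → c p j k = 0) {P : ℤ} (hP : ∀ p, P < p → ∀ j k, c p j k = 0) :
    ∃ X : Alg 𝕜 N b, ∀ p j k, entry 𝕜 N b p j k X = c p j k := by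
  cases b with
  | openEnd =>
    refine ⟨(Matrix.of fun j k => c (((j : ℕ) : ℤ) - ((k : ℕ) : ℤ)) j k :
      Matrix (Fin N) (Fin N) 𝕜), fun p j k => ?_⟩
    erw [entry_openEnd]
    split_ifs with h
    · rw [← h]
      rfl
    · exact (hc p j k h).symm
  | periodic =>
    have hb : ∀ j k, BddBelow (Function.support fun n : ℤ => c (-n) j k) := fun j k =>
      ⟨-P, fun n hn => by
        by_contra h
        exact hn (hP (-n) (by linarith) j k)⟩
    have h : ∀ p j k, Series.lam p
        (HahnSeries.ofSuppBddBelow (fun n : ℤ => c (-n) j k) (hb j k) : HahnSeries ℤ 𝕜) =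
        c p j k := fun p j k => by
      change c (- -p) j k = _
      rw [neg_neg]
    refine ⟨(⟨Matrix.of fun j k =>
      (HahnSeries.ofSuppBddBelow (fun n : ℤ => c (-n) j k) (hb j k) : HahnSeries ℤ 𝕜),
      fun p j k h' => ?_⟩ : twistedLoop 𝕜 N), fun p j k => h p j k⟩
    erw [Matrix.of_apply, h] at h'
    by_contra h2
    exact h' (hc p j k h2)

theorem mem_degreesIn_iff {s : Set ℤ} {X : Alg 𝕜 N b} :
    X ∈ degreesIn 𝕜 (Alg 𝕜 N b) s ↔ ∀ p, p ∉ s → ∀ j k, entry 𝕜 N b p j k X = 0 :=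
  ⟨fun h p hp j k => h (p, j, k) hp, fun h i hi => h i.1 hi i.2.1 i.2.2⟩

theorem exists_mem_degreesIn_Iic (X : Alg 𝕜 N b) :
    ∃ P : ℤ, X ∈ degreesIn 𝕜 (Alg 𝕜 N b) (Set.Iic P) := by
  cases b with
  | openEnd =>
    refine ⟨N, mem_degreesIn_iff.2 fun p hp j k => entry_eq_zero (fun h => hp ?_) X⟩
    change ((j : ℕ) : ℤ) - ((k : ℕ) : ℤ) = p at h
    have := j.2
    rw [Set.mem_Iic]
    omega
  | periodic =>
    obtain ⟨P, hP⟩ := (Set.finite_range fun i : Fin N × Fin N =>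
      -HahnSeries.order (X.1 i.1 i.2 : HahnSeries ℤ 𝕜)).bddAbove
    refine ⟨P, mem_degreesIn_iff.2 fun p hp j k => ?_⟩
    rw [Set.mem_Iic, not_le] at hp
    have h1 := hP ⟨(j, k), rfl⟩
    rw [entry_periodic]
    exact HahnSeries.coeff_eq_zero_of_lt_order (x := (X.1 j k : HahnSeries ℤ 𝕜))
      (by simp only at h1; linarith)

/-- The conditions `q ≤ P` and `p - q ≤ Q` cut the convolution down to a range that no longer
depends on `f` and `g`, so the coefficient is a fixed bilinear expression in finitely many
coefficients. -/
theorem Series.lam_mul {f g : Series 𝕜} {P Q : ℤ} (hf : ∀ p, P < p → Series.lam p f = 0)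
    (hg : ∀ p, Q < p → Series.lam p g = 0) (p : ℤ) :
    Series.lam p (f * g) = ∑ q ∈ Finset.Icc (p - Q) P, Series.lam q f * Series.lam (p - q) g := by
  have key : ∀ f g : HahnSeries ℤ 𝕜, (∀ p, P < p → f.coeff (-p) = 0) →
      (∀ p, Q < p → g.coeff (-p) = 0) → (f * g).coeff (-p) =
        ∑ q ∈ Finset.Icc (p - Q) P, f.coeff (-q) * g.coeff (-(p - q)) := by
    intro f g hf hg
    have h1 : ∑ q ∈ Finset.Icc (p - Q) P, f.coeff (-q) * g.coeff (-(p - q)) =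
        ∑ r ∈ (Finset.Icc (p - Q) P).map ⟨fun q => (-q, -(p - q)), fun q q' h => by
          simpa using congrArg Prod.fst h⟩, f.coeff r.1 * g.coeff r.2 := by
      rw [Finset.sum_map]
      rfl
    rw [h1, HahnSeries.coeff_mul]
    refine Finset.sum_subset (fun r hr => ?_) fun r hr hr' => ?_
    · obtain ⟨h2, h3, h4⟩ := Finset.mem_antidiagonal.1 hr
      refine Finset.mem_map.2 ⟨-r.1, Finset.mem_Icc.2 ⟨?_, ?_⟩, ?_⟩
      · by_contra h5
        exact h3 (by simpa using hg (-r.2) (by linarith))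
      · by_contra h5
        exact h2 (by simpa using hf (-r.1) (by linarith))
      · refine Prod.ext (neg_neg _) ?_
        change -(p - -r.1) = r.2
        linarith
    · obtain ⟨q, -, rfl⟩ := Finset.mem_map.1 hr
      by_contra h2
      refine hr' (Finset.mem_antidiagonal.2 ⟨left_ne_zero_of_mul h2, right_ne_zero_of_mul h2, ?_⟩)
      change -q + -(p - q) = -p
      ring
  exact key f g hf hg

/-- One formula serves both algebras: in `gl(N)` the pair `j, k` determines the degree, so only `q =
j - k` contributes to the sum over `q`. -/
theorem entry_mul {P Q : ℤ} {X Y : Alg 𝕜 N b} (hX : X ∈ degreesIn 𝕜 (Alg 𝕜 N b) (Set.Iic P))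
    (hY : Y ∈ degreesIn 𝕜 (Alg 𝕜 N b) (Set.Iic Q)) (p : ℤ) (j l : Fin N) :
    entry 𝕜 N b p j l (X * Y) = ∑ q ∈ Finset.Icc (p - Q) P, ∑ k,
      entry 𝕜 N b q j k X * entry 𝕜 N b (p - q) k l Y := by
  rw [mem_degreesIn_iff] at hX hY
  rw [Finset.sum_comm]
  cases b with
  | openEnd =>
    have h1 : entry 𝕜 N .openEnd p j l (X * Y) =
        if ((j : ℕ) : ℤ) - ((l : ℕ) : ℤ) = p then
          ∑ k, (X : Matrix (Fin N) (Fin N) 𝕜) j k * (Y : Matrix (Fin N) (Fin N) 𝕜) k l else 0 :=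
      entry_openEnd p j l _
    have h0 : ∀ f : Fin N → 𝕜, (if ((j : ℕ) : ℤ) - ((l : ℕ) : ℤ) = p then ∑ k, f k else 0) =
        ∑ k, if ((j : ℕ) : ℤ) - ((l : ℕ) : ℤ) = p then f k else 0 := fun f => by
      split_ifs <;> simp
    refine h1.trans ((h0 _).trans (Finset.sum_congr rfl fun k _ => ?_))
    have h2 : ∀ q ∈ Finset.Icc (p - Q) P, q ≠ ((j : ℕ) : ℤ) - ((k : ℕ) : ℤ) →
        entry 𝕜 N .openEnd q j k X * entry 𝕜 N .openEnd (p - q) k l Y = 0 := fun q _ hq => by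
      rw [entry_eq_zero (b := .openEnd) (fun h : _ = q => hq h.symm) X, zero_mul]
    rw [Finset.sum_eq_single (((j : ℕ) : ℤ) - ((k : ℕ) : ℤ)) h2]
    · rw [entry_openEnd, if_pos rfl, entry_openEnd]
      split_ifs with h3 h4 h4
      · rfl
      · omega
      · omega
      · rw [mul_zero]
    · intro h3
      rw [Finset.mem_Icc, not_and_or] at h3
      rcases h3 with h3 | h3
      · rw [hY _ (by rw [Set.mem_Iic]; omega), mul_zero]
      · rw [hX _ (by rw [Set.mem_Iic]; omega), zero_mul]
  | periodic =>
    have h1 : entry 𝕜 N .periodic p j l (X * Y) = Series.lam p (∑ k, X.1 j k * Y.1 k l) := rfl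
    rw [h1, map_sum]
    refine Finset.sum_congr rfl fun k _ => ?_
    exact Series.lam_mul (fun q hq => hX q (by rw [Set.mem_Iic]; omega) j k)
      (fun q hq => hY q (by rw [Set.mem_Iic]; omega) k l) p

theorem entry_one (p : ℤ) (j k : Fin N) :
    entry 𝕜 N b p j k 1 = if p = 0 ∧ j = k then 1 else 0 := by
  cases b with
  | openEnd =>
    have h : entry 𝕜 N .openEnd p j k 1 = if ((j : ℕ) : ℤ) - ((k : ℕ) : ℤ) = p then
      (1 : Matrix (Fin N) (Fin N) 𝕜) j k else 0 := entry_openEnd p j k 1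
    rw [h, Matrix.one_apply]
    by_cases hjk : j = k
    · subst hjk
      simp [eq_comm]
    · simp [hjk]
  | periodic =>
    have h : entry 𝕜 N .periodic p j k 1 = Series.lam p ((1 : Matrix (Fin N) (Fin N) (Series 𝕜)) j k) :=
      rfl
    rw [h, Matrix.one_apply]
    by_cases hjk : j = k
    · rw [if_pos hjk, ← map_one (algebraMap 𝕜 (Series 𝕜)), Series.lam_algebraMap]
      simp [hjk]
    · simp [hjk]

open Classical in
theorem entry_proj (s : Set ℤ) (p : ℤ) (j k : Fin N) (X : Alg 𝕜 N b) :
    entry 𝕜 N b p j k (proj 𝕜 N b s X) = if p ∈ s then entry 𝕜 N b p j k X else 0 := by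
  cases b with
  | openEnd =>
    have h : entry 𝕜 N .openEnd p j k (proj 𝕜 N .openEnd s X) =
        if ((j : ℕ) : ℤ) - ((k : ℕ) : ℤ) = p then
          if ((j : ℕ) : ℤ) - ((k : ℕ) : ℤ) ∈ s then (X : Matrix (Fin N) (Fin N) 𝕜) j k else 0
        else 0 := entry_openEnd p j k _
    rw [h, entry_openEnd]
    by_cases h1 : ((j : ℕ) : ℤ) - ((k : ℕ) : ℤ) = p
    · simp only [h1, if_true]
    · simp only [h1, if_false, ite_self]
  | periodic => exact Series.lam_part s p (X.1 j k)

open Classical in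
theorem entry_diagonalElt (q : ℤ) (x : Fin N → 𝕜) (p : ℤ) (j k : Fin N) :
    entry 𝕜 N b p j k (diagonalElt 𝕜 N b q x) = if p = q ∧ Occurs N b q j k then x j else 0 := by
  cases b with
  | openEnd =>
    have h : entry 𝕜 N .openEnd p j k (diagonalElt 𝕜 N .openEnd q x) =
        if ((j : ℕ) : ℤ) - ((k : ℕ) : ℤ) = p then
          if ((j : ℕ) : ℤ) - ((k : ℕ) : ℤ) = q then x j else 0
        else 0 := entry_openEnd p j k _
    rw [h]
    simp only [Occurs]
    by_cases h1 : ((j : ℕ) : ℤ) - ((k : ℕ) : ℤ) = q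
    · simp only [h1, if_true, and_true, eq_comm]
    · simp only [h1, if_false, and_false, ite_self]
  | periodic =>
    have h : entry 𝕜 N .periodic p j k (diagonalElt 𝕜 N .periodic q x) =
        Series.lam p (if ((j : ℕ) : ℤ) - ((k : ℕ) : ℤ) ≡ q [ZMOD N] then
        Series.monomial q (x j) else 0) := rfl
    rw [h]
    simp only [Occurs]
    by_cases h1 : ((j : ℕ) : ℤ) - ((k : ℕ) : ℤ) ≡ q [ZMOD N]
    · rw [if_pos h1, Series.lam_monomial]
      simp only [h1, and_true]
    · rw [if_neg h1, map_zero]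
      simp only [h1, and_false, if_false]

end Entries

/-! ### The grading, matrix units, and the trace form. -/

noncomputable section Form

variable {𝕜 : Type*} [RCLike 𝕜] {N : ℕ} {b : Boundary}

theorem Occurs.neg {p : ℤ} {j k : Fin N} (h : Occurs N b p j k) : Occurs N b (-p) k j := by
  cases b with
  | openEnd =>
    change _ = _ at h ⊢
    omega
  | periodic =>
    have := Int.ModEq.neg h
    rwa [neg_sub] at this

theorem Occurs.add {p q : ℤ} {j k l : Fin N} (h : Occurs N b p j k) (h' : Occurs N b q k l) :
    Occurs N b (p + q) j l := by
  cases b with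
  | openEnd =>
    change _ = _ at h h' ⊢
    omega
  | periodic =>
    have := Int.ModEq.add h h'
    rwa [sub_add_sub_cancel] at this

theorem occurs_zero (j : Fin N) : Occurs N b 0 j j := by
  cases b with
  | openEnd => exact sub_self _
  | periodic => simp [Occurs, Int.ModEq]

theorem eq_of_occurs_zero {j k : Fin N} (h : Occurs N b 0 j k) : j = k := by
  cases b with
  | openEnd =>
    change _ = _ at h
    exact Fin.ext (by omega)
  | periodic =>
    have h1 := (Int.modEq_iff_dvd.1 h)
    rw [zero_sub, neg_sub] at h1
    have h2 := Int.eq_zero_of_abs_lt_dvd h1 (by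
      have := j.2
      have := k.2
      rw [abs_lt]
      omega)
    exact Fin.ext (by omega)

/-- A degree and a row determine the column; this makes a homogeneous component a function of the
row alone. -/
theorem Occurs.unique {p : ℤ} {j k l : Fin N} (h : Occurs N b p j k) (h' : Occurs N b p j l) :
    k = l :=
  eq_of_occurs_zero (by simpa using h.neg.add h')

theorem mul_mem_degreesIn {s t u : Set ℤ} (h : ∀ p ∈ s, ∀ q ∈ t, p + q ∈ u) {X Y : Alg 𝕜 N b}
    (hX : X ∈ degreesIn 𝕜 (Alg 𝕜 N b) s) (hY : Y ∈ degreesIn 𝕜 (Alg 𝕜 N b) t) :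
    X * Y ∈ degreesIn 𝕜 (Alg 𝕜 N b) u := by
  obtain ⟨P, hP⟩ := exists_mem_degreesIn_Iic X
  obtain ⟨Q, hQ⟩ := exists_mem_degreesIn_Iic Y
  rw [mem_degreesIn_iff] at hX hY ⊢
  intro p hp j k
  rw [entry_mul hP hQ]
  refine Finset.sum_eq_zero fun q _ => Finset.sum_eq_zero fun l _ => ?_
  by_cases hq : q ∈ s
  · rw [hY (p - q) (fun h' => hp ?_), mul_zero]
    simpa using h q hq (p - q) h'
  · rw [hX q hq, zero_mul]

theorem one_mem_degreesIn {s : Set ℤ} (h : (0 : ℤ) ∈ s) :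
    (1 : Alg 𝕜 N b) ∈ degreesIn 𝕜 (Alg 𝕜 N b) s := by
  rw [mem_degreesIn_iff]
  intro p hp j k
  exact (entry_one p j k).trans (if_neg fun h' => hp (by rwa [h'.1]))

theorem diagonalElt_mem_degreesIn {s : Set ℤ} {p : ℤ} (h : p ∈ s) (x : Fin N → 𝕜) :
    diagonalElt 𝕜 N b p x ∈ degreesIn 𝕜 (Alg 𝕜 N b) s := by
  classical
  rw [mem_degreesIn_iff]
  intro q hq j k
  exact (entry_diagonalElt p x q j k).trans (if_neg fun h' => hq (by rwa [h'.1]))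

theorem trace0_apply (X : Alg 𝕜 N b) : trace0 𝕜 N b X = ∑ j, entry 𝕜 N b 0 j j X := by
  simp [trace0]

theorem form_eq_trace0 (X Y : Alg 𝕜 N b) : form 𝕜 N b X Y = trace0 𝕜 N b (X * Y) := rfl

theorem form_apply {P Q : ℤ} {X Y : Alg 𝕜 N b} (hX : X ∈ degreesIn 𝕜 (Alg 𝕜 N b) (Set.Iic P))
    (hY : Y ∈ degreesIn 𝕜 (Alg 𝕜 N b) (Set.Iic Q)) :
    form 𝕜 N b X Y = ∑ q ∈ Finset.Icc (-Q) P, ∑ j, ∑ k,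
      entry 𝕜 N b q j k X * entry 𝕜 N b (-q) k j Y := by
  rw [form_eq_trace0, trace0_apply, Finset.sum_comm]
  refine Finset.sum_congr rfl fun j _ => ?_
  rw [entry_mul hX hY]
  simp only [zero_sub]

theorem trace0_mul_comm (X Y : Alg 𝕜 N b) : trace0 𝕜 N b (X * Y) = trace0 𝕜 N b (Y * X) := by
  obtain ⟨P, hP⟩ := exists_mem_degreesIn_Iic X
  obtain ⟨Q, hQ⟩ := exists_mem_degreesIn_Iic Y
  rw [← form_eq_trace0, ← form_eq_trace0, form_apply hP hQ, form_apply hQ hP]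
  refine Finset.sum_bij' (fun q _ => -q) (fun q _ => -q) ?_ ?_ ?_ ?_ ?_
  · intro q hq
    simp only [Finset.mem_Icc] at hq ⊢
    omega
  · intro q hq
    simp only [Finset.mem_Icc] at hq ⊢
    omega
  · simp
  · simp
  · intro q _
    rw [Finset.sum_comm]
    simp only [neg_neg, mul_comm]

/-- The coefficients of the component of degree `p`, listed by rows. -/
def rowCoeff (p : ℤ) (X : Alg 𝕜 N b) (j : Fin N) : 𝕜 := ∑ k, entry 𝕜 N b p j k X

theorem rowCoeff_eq {p : ℤ} {j k : Fin N} (h : Occurs N b p j k) (X : Alg 𝕜 N b) :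
    rowCoeff p X j = entry 𝕜 N b p j k X :=
  Finset.sum_eq_single k (fun _ _ hl => entry_eq_zero (fun h' => hl (h'.unique h)) X)
    fun h' => absurd (Finset.mem_univ k) h'

theorem eq_sum_diagonalElt {a c : ℤ} {X : Alg 𝕜 N b}
    (hX : X ∈ degreesIn 𝕜 (Alg 𝕜 N b) (Set.Icc a c)) :
    X = ∑ q ∈ Finset.Icc a c, diagonalElt 𝕜 N b q (rowCoeff q X) := by
  classical
  refine alg_ext fun p j k => ?_
  simp only [map_sum, entry_diagonalElt]
  by_cases h : Occurs N b p j k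
  · by_cases hp : p ∈ Finset.Icc a c
    · rw [Finset.sum_eq_single p (fun q _ hq => if_neg fun h' => hq h'.1.symm)
        fun h' => absurd hp h', if_pos ⟨rfl, h⟩, rowCoeff_eq h]
    · rw [Finset.sum_eq_zero fun q hq => if_neg fun h' : p = q ∧ _ => hp (by rwa [h'.1])]
      exact mem_degreesIn_iff.1 hX p (by simpa using hp) j k
  · rw [Finset.sum_eq_zero fun q _ => if_neg fun h' : p = q ∧ _ => h (by rw [h'.1]; exact h'.2),
      entry_eq_zero h]

/-- The element `E_jk λᵖ` of `g_p`, with the index `k` determined by `j` and `p`. -/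
def rowUnit (𝕜 : Type*) [RCLike 𝕜] (N : ℕ) (b : Boundary) (p : ℤ) (j : Fin N) : Alg 𝕜 N b :=
  diagonalElt 𝕜 N b p (Pi.single j 1)

theorem entry_rowUnit {p : ℤ} {j k : Fin N} (h : Occurs N b p j k) (q : ℤ) (i l : Fin N) :
    entry 𝕜 N b q i l (rowUnit 𝕜 N b p j) = if q = p ∧ i = j ∧ l = k then 1 else 0 := by
  classical
  rw [rowUnit, entry_diagonalElt]
  by_cases h1 : q = p ∧ i = j ∧ l = k
  · obtain ⟨rfl, rfl, rfl⟩ := h1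
    simp [h]
  · rw [if_neg h1]
    split_ifs with h2
    · rw [Pi.single_apply, if_neg]
      rintro rfl
      exact h1 ⟨h2.1, rfl, h2.2.unique h⟩
    · rfl

theorem diagonalElt_eq_sum (p : ℤ) (x : Fin N → 𝕜) :
    diagonalElt 𝕜 N b p x = ∑ j, x j • rowUnit 𝕜 N b p j := by
  classical
  refine alg_ext fun q j k => ?_
  simp only [map_sum, map_smul, rowUnit, entry_diagonalElt, smul_eq_mul]
  split_ifs with h
  · simp [Pi.single_apply]
  · simp

theorem rowUnit_mem (p : ℤ) (j : Fin N) : rowUnit 𝕜 N b p j ∈ degreesIn 𝕜 (Alg 𝕜 N b) {p} :=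
  diagonalElt_mem_degreesIn (Set.mem_singleton p) _

theorem entry_mul_rowUnit {q : ℤ} {i k : Fin N} (h : Occurs N b q i k) (p : ℤ) (j l : Fin N)
    (X : Alg 𝕜 N b) : entry 𝕜 N b p j l (X * rowUnit 𝕜 N b q i) =
      if l = k then entry 𝕜 N b (p - q) j i X else 0 := by
  obtain ⟨P, hP⟩ := exists_mem_degreesIn_Iic X
  rw [entry_mul hP (degreesIn_mono (by simp) (rowUnit_mem q i) :
    _ ∈ degreesIn 𝕜 _ (Set.Iic q))]
  simp only [entry_rowUnit h]
  split_ifs with hl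
  · rw [Finset.sum_eq_single (p - q)]
    · rw [Finset.sum_eq_single i] <;> simp +contextual [hl]
    · intro r _ hr
      refine Finset.sum_eq_zero fun m _ => ?_
      rw [if_neg fun h' => hr (by omega), mul_zero]
    · intro h'
      rw [Finset.mem_Icc, not_and_or] at h'
      refine Finset.sum_eq_zero fun m _ => ?_
      rw [mem_degreesIn_iff.1 hP (p - q) (by rw [Set.mem_Iic]; omega), zero_mul]
  · simp [hl]

theorem entry_rowUnit_mul {q : ℤ} {i k : Fin N} (h : Occurs N b q i k) (p : ℤ) (j l : Fin N)
    (X : Alg 𝕜 N b) : entry 𝕜 N b p j l (rowUnit 𝕜 N b q i * X) =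
      if j = i then entry 𝕜 N b (p - q) k l X else 0 := by
  obtain ⟨P, hP⟩ := exists_mem_degreesIn_Iic X
  rw [entry_mul (degreesIn_mono (by simp) (rowUnit_mem q i) :
    _ ∈ degreesIn 𝕜 _ (Set.Iic q)) hP]
  simp only [entry_rowUnit h]
  split_ifs with hl
  · rw [Finset.sum_eq_single q]
    · rw [Finset.sum_eq_single k] <;> simp +contextual [hl]
    · intro r _ hr
      refine Finset.sum_eq_zero fun m _ => ?_
      rw [if_neg fun h' => hr (by omega), zero_mul]
    · intro h'
      rw [Finset.mem_Icc, not_and_or] at h'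
      refine Finset.sum_eq_zero fun m _ => ?_
      rw [mem_degreesIn_iff.1 hP (p - q) (by rw [Set.mem_Iic]; omega), mul_zero]
  · simp [hl]

theorem form_rowUnit {p : ℤ} {j k : Fin N} (h : Occurs N b p j k) (X : Alg 𝕜 N b) :
    form 𝕜 N b X (rowUnit 𝕜 N b (-p) k) = entry 𝕜 N b p j k X := by
  rw [form_eq_trace0, trace0_apply]
  simp only [entry_mul_rowUnit h.neg]
  simp

theorem isCoordAlg_form (𝕜 : Type*) [RCLike 𝕜] (N : ℕ) (b : Boundary) :
    IsCoordAlg (form 𝕜 N b) where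
  bounded := exists_mem_degreesIn_Iic
  ext x y h := alg_ext fun p j k => h (p, j, k)
  repr l hl := by
    classical
    -- On degrees at most `0` the functional sees finitely many coordinates, hence kills all units
    -- of sufficiently negative degree. So the entries that duality prescribes for `G` vanish in
    -- high degrees.
    obtain ⟨Q, hQ0, hQ⟩ : ∃ Q : ℤ, 0 ≤ Q ∧ ∀ p, Q < p → ∀ k, l (rowUnit 𝕜 N b (-p) k) = 0 := by
      obtain ⟨s, hs⟩ := hl 0
      obtain ⟨Q, hQ⟩ := (s.image fun i => -deg i).bddAbove
      refine ⟨max Q 0, le_max_right _ _, fun p hp k => hs _ (degreesIn_mono ?_ (rowUnit_mem _ _))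
        fun i hi => rowUnit_mem (-p) k i fun h => ?_⟩
      · rw [Set.singleton_subset_iff, Set.mem_Iic]
        have := le_max_right Q 0
        omega
      · have h1 := hQ (Finset.mem_coe.2 (Finset.mem_image_of_mem _ hi))
        have h2 := le_max_left Q 0
        rw [Set.mem_singleton_iff] at h
        simp only [h] at h1
        omega
    obtain ⟨G, hG⟩ := exists_of_entries (𝕜 := 𝕜) (N := N) (b := b) (P := Q)
      (fun p j k => if Occurs N b p j k then l (rowUnit 𝕜 N b (-p) k) else 0)
      (fun p j k h => if_neg h) (fun p hp j k => by
        rw [hQ p hp k, ite_self])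
    refine ⟨G, fun X => ?_⟩
    have hGQ : G ∈ degreesIn 𝕜 (Alg 𝕜 N b) (Set.Iic Q) := by
      rw [mem_degreesIn_iff]
      intro p hp j k
      rw [hG, hQ p (not_le.1 hp), ite_self]
    obtain ⟨P, hP⟩ := exists_mem_degreesIn_Iic X
    obtain ⟨s, hs⟩ := hl P
    obtain ⟨K, hK⟩ := (s.image fun i => -deg i).bddAbove
    -- Cutting off `X` below degree `-K'` changes neither side: `K` covers the coordinates that `l`
    -- sees, `Q` the degrees of `G`. What is left is a finite combination of units.
    let K' := max K Q
    let X' := proj 𝕜 N b (Set.Ici (-K')) X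
    have hX' : X' ∈ degreesIn 𝕜 (Alg 𝕜 N b) (Set.Icc (-K') P) := by
      rw [mem_degreesIn_iff]
      intro p hp j k
      rw [entry_proj]
      split_ifs with h
      · refine mem_degreesIn_iff.1 hP p (fun h' => hp ⟨h, h'⟩) j k
      · rfl
    have h1 : l X = l X' := by
      rw [← sub_eq_zero, ← map_sub]
      refine hs _ (sub_mem hP (degreesIn_mono Set.Icc_subset_Iic_self hX')) fun i hi => ?_
      have h2 := hK (Finset.mem_coe.2 (Finset.mem_image_of_mem _ hi))
      have h3 := entry_proj (Set.Ici (-K')) i.1 i.2.1 i.2.2 X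
      rw [if_pos (by
        have h4 := le_max_left K Q
        change -i.1 ≤ K at h2
        rw [Set.mem_Ici]
        omega)] at h3
      rw [map_sub, sub_eq_zero]
      exact h3.symm
    have h2 : form 𝕜 N b G X = form 𝕜 N b G X' := by
      have hX'P : X' ∈ degreesIn 𝕜 (Alg 𝕜 N b) (Set.Iic P) :=
        degreesIn_mono Set.Icc_subset_Iic_self hX'
      rw [form_apply hGQ hP, form_apply hGQ hX'P]
      refine Finset.sum_congr rfl fun q hq => Finset.sum_congr rfl fun j _ =>
        Finset.sum_congr rfl fun k _ => ?_
      rw [entry_proj, if_pos]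
      rw [Finset.mem_Icc] at hq
      rw [Set.mem_Ici]
      have := le_max_right K Q
      omega
    have hG' : ∀ q k, form 𝕜 N b G (rowUnit 𝕜 N b q k) = l (rowUnit 𝕜 N b q k) := by
      intro q k
      by_cases h : ∃ j, Occurs N b q k j
      · obtain ⟨j, hj⟩ := h
        have := form_rowUnit hj.neg G
        rw [neg_neg] at this
        rw [this, hG, if_pos hj.neg, neg_neg]
      -- If no column occurs in row `k` in degree `q`, which happens with open ends, the unit is
      -- zero.
      · have : rowUnit 𝕜 N b q k = 0 := by
          refine alg_ext fun p i m => ?_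
          rw [map_zero, rowUnit, entry_diagonalElt]
          split_ifs with h'
          · rw [Pi.single_apply, if_neg]
            rintro rfl
            exact h ⟨m, h'.2⟩
          · rfl
        rw [this, map_zero, map_zero]
    rw [h1, h2, eq_sum_diagonalElt hX']
    simp only [diagonalElt_eq_sum, map_sum, map_smul, hG']
  dual i := by
    classical
    by_cases h : Occurs N b i.1 i.2.1 i.2.2
    · exact ⟨rowUnit 𝕜 N b (-i.1) i.2.2, rowUnit_mem _ _, fun x => (form_rowUnit h x).symm⟩
    · exact ⟨0, zero_mem _, fun x => (entry_eq_zero h x).trans (map_zero _).symm⟩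
  mul_mem P Q x hx y hy := mul_mem_degreesIn (fun p hp q hq =>
    Set.mem_Iic.2 (add_le_add (Set.mem_Iic.1 hp) (Set.mem_Iic.1 hq))) hx hy
  coord_mul P Q i := by
    classical
    refine ⟨((Finset.Icc (i.1 - Q) P) ×ˢ Finset.univ).map
      ⟨fun r : ℤ × Fin N => ((r.1, i.2.1, r.2), (i.1 - r.1, r.2, i.2.2)), fun r r' h => Prod.ext
        (congrArg (fun z => z.1.1) h) (congrArg (fun z => z.1.2.2) h)⟩,
      fun x hx y hy => ?_⟩
    rw [Finset.sum_map, Finset.sum_product]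
    exact entry_mul hx hy i.1 i.2.1 i.2.2
  trace := ⟨trace0 𝕜 N b, sum_mem fun k _ => coord_mem_coordSpan (𝕜 := 𝕜) (M := Alg 𝕜 N b) (0, k, k),
    fun x y => rfl, trace0_mul_comm⟩

end Form

/-! ### The operators, the Yang-Baxter equation, and both Poisson brackets. -/

section Operators

variable {𝕜 : Type*} [RCLike 𝕜] {N : ℕ} {b : Boundary}

theorem eq_diagonalElt_of_mem {p : ℤ} {X : Alg 𝕜 N b} (hX : X ∈ degreesIn 𝕜 (Alg 𝕜 N b) {p}) :
    X = diagonalElt 𝕜 N b p (rowCoeff p X) := by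
  have h := eq_sum_diagonalElt (a := p) (c := p) (X := X) (by rwa [Set.Icc_self])
  rwa [Finset.Icc_self, Finset.sum_singleton] at h

theorem entry_mul_diag {Y : Alg 𝕜 N b} (hY : Y ∈ degreesIn 𝕜 (Alg 𝕜 N b) {0}) (X : Alg 𝕜 N b)
    (p : ℤ) (j l : Fin N) :
    entry 𝕜 N b p j l (X * Y) = entry 𝕜 N b p j l X * entry 𝕜 N b 0 l l Y := by
  rw [eq_diagonalElt_of_mem hY, diagonalElt_eq_sum, Finset.mul_sum]
  simp only [mul_smul_comm, map_sum, map_smul, entry_mul_rowUnit (occurs_zero _),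
    entry_rowUnit (occurs_zero _), smul_eq_mul, sub_zero, true_and]
  simp [mul_comm]

theorem entry_diag_mul {Y : Alg 𝕜 N b} (hY : Y ∈ degreesIn 𝕜 (Alg 𝕜 N b) {0}) (X : Alg 𝕜 N b)
    (p : ℤ) (j l : Fin N) :
    entry 𝕜 N b p j l (Y * X) = entry 𝕜 N b 0 j j Y * entry 𝕜 N b p j l X := by
  rw [eq_diagonalElt_of_mem hY, diagonalElt_eq_sum, Finset.sum_mul]
  simp only [smul_mul_assoc, map_sum, map_smul, entry_rowUnit_mul (occurs_zero _),
    entry_rowUnit (occurs_zero _), smul_eq_mul, sub_zero, true_and]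
  simp

theorem diag_mul_comm {X Y : Alg 𝕜 N b} (hX : X ∈ degreesIn 𝕜 (Alg 𝕜 N b) {0})
    (hY : Y ∈ degreesIn 𝕜 (Alg 𝕜 N b) {0}) : X * Y = Y * X := by
  refine alg_ext fun p j k => ?_
  rw [entry_mul_diag hY, entry_diag_mul hY]
  by_cases h : Occurs N b p j k
  · by_cases hp : p = 0
    · subst hp
      rw [eq_of_occurs_zero h, mul_comm]
    · rw [mem_degreesIn_iff.1 hX p hp, zero_mul, mul_zero]
  · rw [entry_eq_zero h, zero_mul, mul_zero]

theorem form_eq_zero {s t : Set ℤ} (h : ∀ p ∈ s, -p ∉ t) {X Y : Alg 𝕜 N b}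
    (hX : X ∈ degreesIn 𝕜 (Alg 𝕜 N b) s) (hY : Y ∈ degreesIn 𝕜 (Alg 𝕜 N b) t) :
    form 𝕜 N b X Y = 0 := by
  have h1 : X * Y ∈ degreesIn 𝕜 (Alg 𝕜 N b) {0}ᶜ :=
    mul_mem_degreesIn (u := {0}ᶜ) (fun p hp q hq => fun h0 : p + q = 0 => h p hp (by
      rwa [show -p = q by linarith])) hX hY
  rw [form_eq_trace0, trace0_apply]
  exact Finset.sum_eq_zero fun j _ => mem_degreesIn_iff.1 h1 0 (fun h => h rfl) j j

theorem form_of_diag {X : Alg 𝕜 N b} (hX : X ∈ degreesIn 𝕜 (Alg 𝕜 N b) {0}) (Y : Alg 𝕜 N b) :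
    form 𝕜 N b X Y = ∑ j, entry 𝕜 N b 0 j j X * entry 𝕜 N b 0 j j Y := by
  rw [form_eq_trace0, trace0_apply]
  exact Finset.sum_congr rfl fun j _ => entry_diag_mul hX Y 0 j j

theorem proj_mem (s : Set ℤ) (X : Alg 𝕜 N b) :
    proj 𝕜 N b s X ∈ degreesIn 𝕜 (Alg 𝕜 N b) s := by
  classical
  rw [mem_degreesIn_iff]
  intro p hp j k
  rw [entry_proj, if_neg hp]

theorem proj_of_mem {s : Set ℤ} {X : Alg 𝕜 N b} (hX : X ∈ degreesIn 𝕜 (Alg 𝕜 N b) s) :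
    proj 𝕜 N b s X = X := by
  classical
  refine alg_ext fun p j k => ?_
  rw [entry_proj]
  split_ifs with h
  · rfl
  · exact (mem_degreesIn_iff.1 hX p h j k).symm

theorem proj_of_disjoint {s t : Set ℤ} (h : ∀ p ∈ s, p ∉ t) {X : Alg 𝕜 N b}
    (hX : X ∈ degreesIn 𝕜 (Alg 𝕜 N b) t) : proj 𝕜 N b s X = 0 := by
  classical
  refine alg_ext fun p j k => ?_
  rw [entry_proj, map_zero]
  split_ifs with h'
  · exact mem_degreesIn_iff.1 hX p (h p h') j k
  · rfl

theorem proj_add_proj_add_proj (X : Alg 𝕜 N b) : proj 𝕜 N b (Set.Ioi 0) X + proj 𝕜 N b {0} X +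
    proj 𝕜 N b (Set.Iio 0) X = X := by
  classical
  refine alg_ext fun p j k => ?_
  simp only [map_add, entry_proj]
  rcases lt_trichotomy p 0 with h | h | h
  · simp [h, h.ne, h.le]
  · simp [h]
  · simp [h, h.ne', h.le]

theorem form_proj {s t : Set ℤ} (h : ∀ p, p ∈ s ↔ -p ∈ t) (X Y : Alg 𝕜 N b) :
    form 𝕜 N b (proj 𝕜 N b s X) Y = form 𝕜 N b X (proj 𝕜 N b t Y) := by
  classical
  obtain ⟨P, hP⟩ := exists_mem_degreesIn_Iic X
  obtain ⟨Q, hQ⟩ := exists_mem_degreesIn_Iic Y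
  have hP' : proj 𝕜 N b s X ∈ degreesIn 𝕜 (Alg 𝕜 N b) (Set.Iic P) := mem_degreesIn_iff.2 fun p hp j k => by
    rw [entry_proj, mem_degreesIn_iff.1 hP p hp, ite_self]
  have hQ' : proj 𝕜 N b t Y ∈ degreesIn 𝕜 (Alg 𝕜 N b) (Set.Iic Q) := mem_degreesIn_iff.2 fun p hp j k => by
    rw [entry_proj, mem_degreesIn_iff.1 hQ p hp, ite_self]
  rw [form_apply hP' hQ, form_apply hP hQ']
  refine Finset.sum_congr rfl fun q hq => Finset.sum_congr rfl fun j _ =>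
    Finset.sum_congr rfl fun k _ => ?_
  rw [entry_proj, entry_proj]
  by_cases hqs : q ∈ s
  · rw [if_pos hqs, if_pos ((h q).1 hqs)]
  · rw [if_neg hqs, if_neg fun h' => hqs ((h q).2 h'), zero_mul, mul_zero]

theorem isLocalOp_proj (s : Set ℤ) : IsLocalOp (𝕜 := 𝕜) (proj 𝕜 N b s) := by
  classical
  refine ⟨fun P => ⟨P, fun X hX => mem_degreesIn_iff.2 fun p hp j k => ?_⟩, fun i => ?_⟩
  · rw [entry_proj, mem_degreesIn_iff.1 hX p hp, ite_self]
  · by_cases h : i.1 ∈ s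
    · have h1 : coord i ∘ₗ proj 𝕜 N b s = coord i := LinearMap.ext fun X =>
        (entry_proj s i.1 i.2.1 i.2.2 X).trans (if_pos h)
      rw [h1]
      exact coord_mem_coordSpan i
    · have h1 : coord i ∘ₗ proj 𝕜 N b s = 0 := LinearMap.ext fun X =>
        (entry_proj s i.1 i.2.1 i.2.2 X).trans (if_neg h)
      rw [h1]
      exact zero_mem _

/-! ### The operators `R₀`, `P₀`, `W` -/

theorem opW_apply (X : Alg 𝕜 N b) : opW 𝕜 N b X = diagonalElt 𝕜 N b 0 fun j =>
    ∑ k : Fin N, ((((k : ℕ) : ℤ) - ((j : ℕ) : ℤ)).sign : 𝕜) * entry 𝕜 N b 0 k k X := by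
  rw [diagonalElt_eq_sum]
  simp only [opW, LinearMap.sum_apply, LinearMap.smul_apply, LinearMap.smulRight_apply, smul_smul,
    Finset.sum_smul]
  exact Finset.sum_comm

theorem opW_mem (X : Alg 𝕜 N b) : opW 𝕜 N b X ∈ degreesIn 𝕜 (Alg 𝕜 N b) {0} := by
  rw [opW_apply]
  exact diagonalElt_mem_degreesIn (Set.mem_singleton 0) _

theorem entry_diagonalElt_zero (x : Fin N → 𝕜) (j : Fin N) :
    entry 𝕜 N b 0 j j (diagonalElt 𝕜 N b 0 x) = x j := by
  classical
  rw [entry_diagonalElt, if_pos ⟨rfl, occurs_zero j⟩]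

theorem entry_opW (X : Alg 𝕜 N b) (j : Fin N) : entry 𝕜 N b 0 j j (opW 𝕜 N b X) =
    ∑ k : Fin N, ((((k : ℕ) : ℤ) - ((j : ℕ) : ℤ)).sign : 𝕜) * entry 𝕜 N b 0 k k X := by
  rw [opW_apply, entry_diagonalElt_zero]

theorem form_opW (X Y : Alg 𝕜 N b) :
    form 𝕜 N b (opW 𝕜 N b X) Y = -form 𝕜 N b X (opW 𝕜 N b Y) := by
  rw [(isCoordAlg_form 𝕜 N b).form_comm X, form_of_diag (opW_mem X), form_of_diag (opW_mem Y)]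
  simp only [entry_opW, Finset.sum_mul]
  rw [Finset.sum_comm, ← Finset.sum_neg_distrib]
  refine Finset.sum_congr rfl fun j _ => ?_
  rw [← Finset.sum_neg_distrib]
  refine Finset.sum_congr rfl fun k _ => ?_
  rw [← neg_sub ((k : ℕ) : ℤ), Int.sign_neg]
  push_cast
  ring

theorem opP₀_mem (X : Alg 𝕜 N b) : opP₀ 𝕜 N b X ∈ degreesIn 𝕜 (Alg 𝕜 N b) {0} := proj_mem _ _

theorem form_opP₀ (X Y : Alg 𝕜 N b) :
    form 𝕜 N b (opP₀ 𝕜 N b X) Y = form 𝕜 N b X (opP₀ 𝕜 N b Y) :=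
  form_proj (by simp) X Y

theorem form_opR₀ (X Y : Alg 𝕜 N b) :
    form 𝕜 N b (opR₀ 𝕜 N b X) Y = -form 𝕜 N b X (opR₀ 𝕜 N b Y) := by
  simp only [opR₀, LinearMap.sub_apply, map_sub]
  rw [form_proj (s := Set.Ioi 0) (t := Set.Iio 0) (by simp),
    form_proj (s := Set.Iio 0) (t := Set.Ioi 0) (by simp)]
  ring

theorem form_opA₁ (X Y : Alg 𝕜 N b) :
    form 𝕜 N b (opA₁ 𝕜 N b X) Y = -form 𝕜 N b X (opA₁ 𝕜 N b Y) := by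
  simp only [opA₁, LinearMap.add_apply, map_add, form_opR₀, form_opW]
  ring

theorem form_opA₂ (X Y : Alg 𝕜 N b) :
    form 𝕜 N b (opA₂ 𝕜 N b X) Y = -form 𝕜 N b X (opA₂ 𝕜 N b Y) := by
  simp only [opA₂, LinearMap.sub_apply, map_sub, form_opR₀, form_opW]
  ring

theorem form_opS (X Y : Alg 𝕜 N b) :
    form 𝕜 N b (opS 𝕜 N b X) Y = form 𝕜 N b X (opSadj 𝕜 N b Y) := by
  simp only [opS, opSadj, LinearMap.sub_apply, LinearMap.add_apply, map_sub, map_add, form_opP₀,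
    form_opW]
  ring

theorem form_opSadj (X Y : Alg 𝕜 N b) :
    form 𝕜 N b (opSadj 𝕜 N b X) Y = form 𝕜 N b X (opS 𝕜 N b Y) := by
  simp only [opS, opSadj, LinearMap.sub_apply, LinearMap.add_apply, map_sub, map_add, form_opP₀,
    form_opW]
  ring

theorem opS_mem (X : Alg 𝕜 N b) : opS 𝕜 N b X ∈ degreesIn 𝕜 (Alg 𝕜 N b) {0} :=
  sub_mem (opP₀_mem X) (opW_mem X)

theorem opSadj_mem (X : Alg 𝕜 N b) : opSadj 𝕜 N b X ∈ degreesIn 𝕜 (Alg 𝕜 N b) {0} :=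
  add_mem (opP₀_mem X) (opW_mem X)

theorem isLocalOp_opW : IsLocalOp (𝕜 := 𝕜) (opW 𝕜 N b) := by
  refine ⟨fun P => ⟨0, fun X _ => degreesIn_mono (by simp) (opW_mem X)⟩, fun i => ?_⟩
  have h : coord i ∘ₗ opW 𝕜 N b = ∑ k : Fin N, ∑ j : Fin N,
      ((((k : ℕ) : ℤ) - ((j : ℕ) : ℤ)).sign : 𝕜) •
        (coord i (diagonalElt 𝕜 N b 0 (Pi.single j 1)) • entry 𝕜 N b 0 k k) := by
    refine LinearMap.ext fun X => ?_
    simp only [opW, LinearMap.comp_apply, LinearMap.sum_apply, LinearMap.smul_apply, map_sum,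
      map_smul, LinearMap.smulRight_apply]
    refine Finset.sum_congr rfl fun k _ => Finset.sum_congr rfl fun j _ => ?_
    simp only [smul_eq_mul]
    ring
  rw [h]
  exact sum_mem fun k _ => sum_mem fun j _ => Submodule.smul_mem _ _ (Submodule.smul_mem _ _
    (coord_mem_coordSpan (𝕜 := 𝕜) (M := Alg 𝕜 N b) (0, k, k)))

theorem isLocalOp_opR₀ : IsLocalOp (𝕜 := 𝕜) (opR₀ 𝕜 N b) :=
  (isLocalOp_proj _).sub (isLocalOp_proj _)

theorem isLocalOp_opA₁ : IsLocalOp (𝕜 := 𝕜) (opA₁ 𝕜 N b) := isLocalOp_opR₀.add isLocalOp_opW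

theorem isLocalOp_opA₂ : IsLocalOp (𝕜 := 𝕜) (opA₂ 𝕜 N b) := isLocalOp_opR₀.sub isLocalOp_opW

theorem isLocalOp_opS : IsLocalOp (𝕜 := 𝕜) (opS 𝕜 N b) := (isLocalOp_proj _).sub isLocalOp_opW

theorem isLocalOp_opSadj : IsLocalOp (𝕜 := 𝕜) (opSadj 𝕜 N b) :=
  (isLocalOp_proj _).add isLocalOp_opW

theorem opR₀_of_pos {X : Alg 𝕜 N b} (hX : X ∈ degreesIn 𝕜 (Alg 𝕜 N b) (Set.Ioi 0)) :
    opR₀ 𝕜 N b X = X := by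
  rw [opR₀, LinearMap.sub_apply, proj_of_mem hX,
    proj_of_disjoint (fun p hp hp' => lt_asymm (Set.mem_Iio.1 hp) (Set.mem_Ioi.1 hp')) hX, sub_zero]

theorem opR₀_of_neg {X : Alg 𝕜 N b} (hX : X ∈ degreesIn 𝕜 (Alg 𝕜 N b) (Set.Iio 0)) :
    opR₀ 𝕜 N b X = -X := by
  rw [opR₀, LinearMap.sub_apply, proj_of_mem hX,
    proj_of_disjoint (fun p hp hp' => lt_asymm (Set.mem_Ioi.1 hp) (Set.mem_Iio.1 hp')) hX, zero_sub]

/-- Both expressions are expanded in positive, diagonal and negative parts. The commutators of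
positive with negative parts cancel in each, and the others give the same `U` and `V` up to the sign
of `V`. Hence the first has no diagonal component, and `R₀` maps it to the second: these are `orth`
and `yangBaxter`. -/
theorem opR₀_bracket (X Y : Alg 𝕜 N b) : ∃ U ∈ degreesIn 𝕜 (Alg 𝕜 N b) (Set.Ioi 0),
    ∃ V ∈ degreesIn 𝕜 (Alg 𝕜 N b) (Set.Iio 0),
      opR₀ 𝕜 N b X * Y - Y * opR₀ 𝕜 N b X + (X * opR₀ 𝕜 N b Y - opR₀ 𝕜 N b Y * X) = U - V ∧
      opR₀ 𝕜 N b X * opR₀ 𝕜 N b Y - opR₀ 𝕜 N b Y * opR₀ 𝕜 N b X + (X * Y - Y * X) = U + V := by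
  have hX := proj_add_proj_add_proj X
  have hY := proj_add_proj_add_proj Y
  simp only [opR₀, LinearMap.sub_apply]
  have p₁ := proj_mem (Set.Ioi 0) X
  have z₁ := proj_mem {0} X
  have n₁ := proj_mem (Set.Iio 0) X
  have p₂ := proj_mem (Set.Ioi 0) Y
  have z₂ := proj_mem {0} Y
  have n₂ := proj_mem (Set.Iio 0) Y
  generalize proj 𝕜 N b (Set.Ioi 0) X = xp at *
  generalize proj 𝕜 N b (Set.Iio 0) X = xn at *
  generalize proj 𝕜 N b {0} X = x0 at *
  generalize proj 𝕜 N b (Set.Ioi 0) Y = yp at *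
  generalize proj 𝕜 N b (Set.Iio 0) Y = yn at *
  generalize proj 𝕜 N b {0} Y = y0 at *
  subst hX hY
  have hpp : ∀ {u v : Alg 𝕜 N b}, u ∈ degreesIn 𝕜 (Alg 𝕜 N b) (Set.Ioi 0) →
      v ∈ degreesIn 𝕜 (Alg 𝕜 N b) (Set.Ioi 0) → u * v ∈ degreesIn 𝕜 (Alg 𝕜 N b) (Set.Ioi 0) :=
    mul_mem_degreesIn fun p hp q hq => add_pos hp hq
  have hpz : ∀ {u v : Alg 𝕜 N b}, u ∈ degreesIn 𝕜 (Alg 𝕜 N b) (Set.Ioi 0) →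
      v ∈ degreesIn 𝕜 (Alg 𝕜 N b) {0} → u * v ∈ degreesIn 𝕜 (Alg 𝕜 N b) (Set.Ioi 0) :=
    mul_mem_degreesIn fun p hp q hq => by simp_all
  have hzp : ∀ {u v : Alg 𝕜 N b}, u ∈ degreesIn 𝕜 (Alg 𝕜 N b) {0} →
      v ∈ degreesIn 𝕜 (Alg 𝕜 N b) (Set.Ioi 0) → u * v ∈ degreesIn 𝕜 (Alg 𝕜 N b) (Set.Ioi 0) :=
    mul_mem_degreesIn fun p hp q hq => by simp_all
  have hnn : ∀ {u v : Alg 𝕜 N b}, u ∈ degreesIn 𝕜 (Alg 𝕜 N b) (Set.Iio 0) →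
      v ∈ degreesIn 𝕜 (Alg 𝕜 N b) (Set.Iio 0) → u * v ∈ degreesIn 𝕜 (Alg 𝕜 N b) (Set.Iio 0) :=
    mul_mem_degreesIn fun p hp q hq =>
      Set.mem_Iio.2 (add_neg (Set.mem_Iio.1 hp) (Set.mem_Iio.1 hq))
  have hnz : ∀ {u v : Alg 𝕜 N b}, u ∈ degreesIn 𝕜 (Alg 𝕜 N b) (Set.Iio 0) →
      v ∈ degreesIn 𝕜 (Alg 𝕜 N b) {0} → u * v ∈ degreesIn 𝕜 (Alg 𝕜 N b) (Set.Iio 0) :=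
    mul_mem_degreesIn fun p hp q hq => by simp_all
  have hzn : ∀ {u v : Alg 𝕜 N b}, u ∈ degreesIn 𝕜 (Alg 𝕜 N b) {0} →
      v ∈ degreesIn 𝕜 (Alg 𝕜 N b) (Set.Iio 0) → u * v ∈ degreesIn 𝕜 (Alg 𝕜 N b) (Set.Iio 0) :=
    mul_mem_degreesIn fun p hp q hq => by simp_all
  have pp := sub_mem (hpp p₁ p₂) (hpp p₂ p₁)
  have nn := sub_mem (hnn n₁ n₂) (hnn n₂ n₁)
  refine ⟨(xp * yp - yp * xp) + (xp * yp - yp * xp) + (xp * y0 - y0 * xp) + (x0 * yp - yp * x0),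
    add_mem (add_mem (add_mem pp pp) (sub_mem (hpz p₁ z₂) (hzp z₂ p₁)))
      (sub_mem (hzp z₁ p₂) (hpz p₂ z₁)),
    (xn * yn - yn * xn) + (xn * yn - yn * xn) + (xn * y0 - y0 * xn) + (x0 * yn - yn * x0),
    add_mem (add_mem (add_mem nn nn) (sub_mem (hnz n₁ z₂) (hzn z₂ n₁)))
      (sub_mem (hzn z₁ n₂) (hnz n₂ z₁)), by noncomm_ring, ?_⟩
  -- The only diagonal contribution to the second expression vanishes because `g₀` is commutative.
  have h0 : x0 * y0 - y0 * x0 = 0 := sub_eq_zero.2 (diag_mul_comm z₁ z₂)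
  rw [← sub_eq_zero, ← h0]
  noncomm_ring

theorem isRMatrixBracket_small : IsRMatrixBracket (form 𝕜 N b) (opR₀ 𝕜 N b) (opA₁ 𝕜 N b)
    (opA₂ 𝕜 N b) (opS 𝕜 N b) (opSadj 𝕜 N b) (degreesIn 𝕜 (Alg 𝕜 N b) {0}) where
  skew₁ := form_opA₁
  skew₂ := form_opA₂
  adj := form_opS
  diag₁ X := by
    rw [opA₁, LinearMap.add_apply, add_sub_cancel_left]
    exact opW_mem X
  diag₂ X := by
    rw [opA₂, LinearMap.sub_apply, sub_sub_cancel_left]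
    exact neg_mem (opW_mem X)
  diagS := opS_mem
  diagS' := opSadj_mem
  comm _ hX _ hY := diag_mul_comm hX hY
  orth d hd X Y := by
    obtain ⟨U, hU, V, hV, h, -⟩ := opR₀_bracket X Y
    rw [h, map_sub, form_eq_zero (t := Set.Ioi 0) (by simp) hd hU,
      form_eq_zero (t := Set.Iio 0) (by simp) hd hV, sub_zero]
  yangBaxter X Y := by
    obtain ⟨U, hU, V, hV, h, h'⟩ := opR₀_bracket X Y
    rw [h, h', map_sub, opR₀_of_pos hU, opR₀_of_neg hV, sub_neg_eq_add]
  skewR := form_opR₀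

/-- All blocks apart from `R₀` on the diagonal take values in `g₀`, so the r-matrix acts by `R₀` in
each component and its properties are inherited. The signs of the off-diagonal blocks give
skew-symmetry, since `S` and `S*` are adjoint. -/
theorem isRMatrixBracket_big : IsRMatrixBracket (prodForm (form 𝕜 N b))
    (block (opR₀ 𝕜 N b) 0 0 (opR₀ 𝕜 N b)) (bigA₁ 𝕜 N b) (bigA₂ 𝕜 N b) (bigS 𝕜 N b)
    (bigSadj 𝕜 N b) (degreesIn 𝕜 (Alg 𝕜 N b × Alg 𝕜 N b) {0}) where
  skew₁ X Y := by
    simp only [prodForm_apply, bigA₁, block_apply, map_add, LinearMap.add_apply,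
      LinearMap.neg_apply, map_neg, form_opA₁, form_opS, form_opSadj]
    ring
  skew₂ X Y := by
    simp only [prodForm_apply, bigA₂, block_apply, map_add, LinearMap.add_apply,
      LinearMap.neg_apply, map_neg, form_opA₂, form_opS, form_opSadj]
    ring
  adj X Y := by
    simp only [prodForm_apply, bigS, bigSadj, block_apply, map_add, LinearMap.add_apply,
      LinearMap.neg_apply, map_neg, form_opS, form_opSadj]
    ring
  diag₁ X := by
    refine mem_degreesIn_prod.2 ⟨?_, ?_⟩
    · have h : (bigA₁ 𝕜 N b X - block (opR₀ 𝕜 N b) 0 0 (opR₀ 𝕜 N b) X).1 =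
          opW 𝕜 N b X.1 - opS 𝕜 N b X.2 := by
        simp only [bigA₁, block_apply, Prod.fst_sub, opA₁, LinearMap.add_apply, LinearMap.neg_apply,
          LinearMap.zero_apply]
        abel
      rw [h]
      exact sub_mem (opW_mem _) (opS_mem _)
    · have h : (bigA₁ 𝕜 N b X - block (opR₀ 𝕜 N b) 0 0 (opR₀ 𝕜 N b) X).2 =
          opSadj 𝕜 N b X.1 + opW 𝕜 N b X.2 := by
        simp only [bigA₁, block_apply, Prod.snd_sub, opA₁, LinearMap.add_apply, LinearMap.neg_apply,
          LinearMap.zero_apply]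
        abel
      rw [h]
      exact add_mem (opSadj_mem _) (opW_mem _)
  diag₂ X := by
    refine mem_degreesIn_prod.2 ⟨?_, ?_⟩
    · have h : (bigA₂ 𝕜 N b X - block (opR₀ 𝕜 N b) 0 0 (opR₀ 𝕜 N b) X).1 =
          -opW 𝕜 N b X.1 - opSadj 𝕜 N b X.2 := by
        simp only [bigA₂, block_apply, Prod.fst_sub, opA₂, LinearMap.sub_apply, LinearMap.neg_apply,
          LinearMap.zero_apply]
        abel
      rw [h]
      exact sub_mem (neg_mem (opW_mem _)) (opSadj_mem _)
    · have h : (bigA₂ 𝕜 N b X - block (opR₀ 𝕜 N b) 0 0 (opR₀ 𝕜 N b) X).2 =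
          opS 𝕜 N b X.1 - opW 𝕜 N b X.2 := by
        simp only [bigA₂, block_apply, Prod.snd_sub, opA₂, LinearMap.sub_apply, LinearMap.neg_apply,
          LinearMap.zero_apply]
        abel
      rw [h]
      exact sub_mem (opS_mem _) (opW_mem _)
  diagS X := mem_degreesIn_prod.2 ⟨add_mem (opS_mem _) (opS_mem _),
    add_mem (opS_mem _) (neg_mem (opSadj_mem _))⟩
  diagS' X := mem_degreesIn_prod.2 ⟨add_mem (opSadj_mem _) (opSadj_mem _),
    add_mem (opSadj_mem _) (neg_mem (opS_mem _))⟩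
  comm X hX Y hY := by
    rw [mem_degreesIn_prod] at hX hY
    exact Prod.ext (diag_mul_comm hX.1 hY.1) (diag_mul_comm hX.2 hY.2)
  orth d hd X Y := by
    rw [mem_degreesIn_prod] at hd
    have h1 := isRMatrixBracket_small.orth d.1 hd.1 X.1 Y.1
    have h2 := isRMatrixBracket_small.orth d.2 hd.2 X.2 Y.2
    simp only [prodForm_apply, block_apply, Prod.fst_add, Prod.fst_sub, Prod.fst_mul, Prod.snd_add,
      Prod.snd_sub, Prod.snd_mul, LinearMap.zero_apply, add_zero, zero_add]
    rw [h1, h2, add_zero]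
  yangBaxter X Y := by
    have h1 := isRMatrixBracket_small.yangBaxter X.1 Y.1
    have h2 := isRMatrixBracket_small.yangBaxter X.2 Y.2
    simp only [block_apply, Prod.fst_add, Prod.fst_sub, Prod.fst_mul, Prod.snd_add,
      Prod.snd_sub, Prod.snd_mul, LinearMap.zero_apply, add_zero, zero_add]
    exact Prod.ext h1 h2
  skewR X Y := by
    simp only [prodForm_apply, block_apply, LinearMap.zero_apply, add_zero, zero_add, form_opR₀]
    ring

theorem isPoissonBracket_small (α : 𝕜) : IsPoissonBracket (smallBracket (N := N) (b := b) α) :=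
  isRMatrixBracket_small.isPoissonBracket (isCoordAlg_form 𝕜 N b) isLocalOp_opA₁ isLocalOp_opA₂
    isLocalOp_opS isLocalOp_opSadj α

theorem isPoissonBracket_big (α : 𝕜) : IsPoissonBracket (bigBracket (N := N) (b := b) α) :=
  isRMatrixBracket_big.isPoissonBracket (isCoordAlg_form 𝕜 N b).prod
    (isLocalOp_opA₁.block isLocalOp_opS.neg isLocalOp_opSadj isLocalOp_opA₁)
    (isLocalOp_opA₂.block isLocalOp_opSadj.neg isLocalOp_opS isLocalOp_opA₂)
    (isLocalOp_opS.block isLocalOp_opS isLocalOp_opS isLocalOp_opSadj.neg)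
    (isLocalOp_opSadj.block isLocalOp_opSadj isLocalOp_opSadj isLocalOp_opS.neg) α

end Operators

/-! ### Monodromy maps, invariant functions, and the Lax triad. -/

section Monodromy

variable {𝕜 : Type*} [RCLike 𝕜]

theorem isLocalOp_fst {M M' : Type*} [AddCommGroup M] [Module 𝕜 M] [CoordSpace 𝕜 M]
    [AddCommGroup M'] [Module 𝕜 M'] [CoordSpace 𝕜 M'] : IsLocalOp (LinearMap.fst 𝕜 M M') :=
  ⟨fun P => ⟨P, fun _ hx => (mem_degreesIn_prod.1 hx).1⟩,
    fun i => coordSpan_fst (coord_mem_coordSpan i)⟩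

theorem isLocalOp_snd {M M' : Type*} [AddCommGroup M] [Module 𝕜 M] [CoordSpace 𝕜 M]
    [AddCommGroup M'] [Module 𝕜 M'] [CoordSpace 𝕜 M'] : IsLocalOp (LinearMap.snd 𝕜 M M') :=
  ⟨fun P => ⟨P, fun _ hx => (mem_degreesIn_prod.1 hx).2⟩,
    fun i => coordSpan_snd (coord_mem_coordSpan i)⟩

variable {A : Type*} [Ring A] [Algebra 𝕜 A] [CoordSpace 𝕜 A] {B : LinearMap.BilinForm 𝕜 A}

namespace IsCoordAlg

variable (hB : IsCoordAlg B)

include hB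

theorem smoothAt_comp_monodromy₁ {φ : A → 𝕜} {x : A × A} (hφ : SmoothAt φ (monodromy₁ A x)) :
    SmoothAt (φ ∘ monodromy₁ A) x :=
  SmoothAt.comp (fun P hx => hB.smoothMapDeg_mul hx ((SmoothMapDeg.id P x).op hx isLocalOp_fst)
    ((SmoothMapDeg.id P x).op hx isLocalOp_snd)) hφ

theorem smoothAt_comp_monodromy₂ {φ : A → 𝕜} {x : A × A} (hφ : SmoothAt φ (monodromy₂ A x)) :
    SmoothAt (φ ∘ monodromy₂ A) x :=
  SmoothAt.comp (fun P hx => hB.smoothMapDeg_mul hx ((SmoothMapDeg.id P x).op hx isLocalOp_snd)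
    ((SmoothMapDeg.id P x).op hx isLocalOp_fst)) hφ

theorem hasDerivAt_mul_line {φ : A → 𝕜} {L V : A} (hφ : SmoothAt φ (L * V)) (X Y : A) :
    HasDerivAt (fun ε : 𝕜 => φ ((L + ε • X) * (V + ε • Y)))
      (B (V * grad B φ (L * V)) X + B (grad B φ (L * V) * L) Y) 0 := by
  have h := hB.hasVel_mul (hB.hasVel_line L X 0) (hB.hasVel_line V Y 0)
  have hφ' : SmoothAt φ ((L + (0 : 𝕜) • X) * (V + (0 : 𝕜) • Y)) := by simpa using hφ
  have h1 := hB.hasDerivAt_comp (γ := fun ε : 𝕜 => (L + ε • X) * (V + ε • Y)) hφ' h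
  simp only [zero_smul, add_zero, map_add] at h1
  rwa [hB.form_mul_cycle, hB.form_mul]

theorem grad_comp_monodromy₁ {φ : A → 𝕜} {L V : A} (hφ : SmoothAt φ (L * V)) :
    grad (prodForm B) (φ ∘ monodromy₁ A) (L, V) =
      (V * grad B φ (L * V), grad B φ (L * V) * L) :=
  hB.prod.grad_eq fun X => hB.hasDerivAt_mul_line hφ X.1 X.2

theorem grad_comp_monodromy₂ {φ : A → 𝕜} {L V : A} (hφ : SmoothAt φ (V * L)) :
    grad (prodForm B) (φ ∘ monodromy₂ A) (L, V) =
      (grad B φ (V * L) * V, L * grad B φ (V * L)) :=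
  hB.prod.grad_eq fun X => by
    rw [prodForm_apply, add_comm]
    exact hB.hasDerivAt_mul_line hφ X.2 X.1

end IsCoordAlg

variable {N : ℕ} {b : Boundary}

/-- The element `z = V ∇φ(LV) L` is both the right differential in the first factor and the left
differential in the second. All terms with `z` or its counterpart `Z` for `ψ` cancel; the remaining
differentials are those of `φ` and `ψ` at `LV`. -/
theorem isPoissonMap_monodromy₁ (α : 𝕜) :
    IsPoissonMap (bigBracket α) (smallBracket α) (monodromy₁ (Alg 𝕜 N b)) := by
  have hB := isCoordAlg_form 𝕜 N b
  refine ⟨fun φ x hφ => hB.smoothAt_comp_monodromy₁ hφ, fun φ ψ x hφ hψ => ?_⟩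
  obtain ⟨L, V⟩ := x
  simp only [bigBracket, smallBracket, Pi.smul_apply, quadraticBracket, dLeft, dRight,
    hB.grad_comp_monodromy₁ hφ, hB.grad_comp_monodromy₁ hψ]
  congr 1
  simp only [monodromy₁, Prod.mk_mul_mk, bigA₁, bigA₂, bigS, block_apply, prodForm_apply,
    LinearMap.neg_apply, ← mul_assoc]
  generalize L * V * grad (form 𝕜 N b) φ (L * V) = x
  generalize V * grad (form 𝕜 N b) φ (L * V) * L = z
  generalize grad (form 𝕜 N b) φ (L * V) * L * V = w
  generalize L * V * grad (form 𝕜 N b) ψ (L * V) = X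
  generalize V * grad (form 𝕜 N b) ψ (L * V) * L = Z
  generalize grad (form 𝕜 N b) ψ (L * V) * L * V = Y
  simp only [opA₁, opA₂, opS, opSadj, map_add, map_sub, LinearMap.add_apply, LinearMap.sub_apply,
    map_neg, LinearMap.neg_apply, form_opW, form_opR₀, form_opP₀]
  ring

/-- Now the shared element is `L ∇φ(VL) V`, the left differential in the first factor and the right
one in the second; its terms cancel again. -/
theorem isPoissonMap_monodromy₂ (α : 𝕜) :
    IsPoissonMap (bigBracket α) (smallBracket α) (monodromy₂ (Alg 𝕜 N b)) := by
  have hB := isCoordAlg_form 𝕜 N b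
  refine ⟨fun φ x hφ => hB.smoothAt_comp_monodromy₂ hφ, fun φ ψ x hφ hψ => ?_⟩
  obtain ⟨L, V⟩ := x
  simp only [bigBracket, smallBracket, Pi.smul_apply, quadraticBracket, dLeft, dRight,
    hB.grad_comp_monodromy₂ hφ, hB.grad_comp_monodromy₂ hψ]
  congr 1
  simp only [monodromy₂, Prod.mk_mul_mk, bigA₁, bigA₂, bigS, block_apply, prodForm_apply,
    LinearMap.neg_apply, ← mul_assoc]
  generalize V * L * grad (form 𝕜 N b) φ (V * L) = x
  generalize L * grad (form 𝕜 N b) φ (V * L) * V = z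
  generalize grad (form 𝕜 N b) φ (V * L) * V * L = w
  generalize V * L * grad (form 𝕜 N b) ψ (V * L) = X
  generalize L * grad (form 𝕜 N b) ψ (V * L) * V = Z
  generalize grad (form 𝕜 N b) ψ (V * L) * V * L = Y
  simp only [opA₁, opA₂, opS, opSadj, map_add, map_sub, LinearMap.add_apply, LinearMap.sub_apply,
    map_neg, LinearMap.neg_apply, form_opW, form_opR₀, form_opP₀]
  ring

/-! ### Invariant functions -/

theorem IsCoordAlg.hasVel_const (hB : IsCoordAlg B) {K : Type*} [NontriviallyNormedField K]
    [NormedAlgebra K 𝕜] (x : A) (t : K) : HasVel 𝕜 (fun _ : K => x) 0 t := by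
  obtain ⟨P, hP⟩ := hB.bounded x
  refine ⟨⟨P, Filter.Eventually.of_forall fun _ => hP⟩, fun i => ?_⟩
  rw [map_zero]
  exact hasDerivAt_const t _

/-- If `X² = 0`, then `1 + εX` has the inverse `1 - εX` for every `ε`. Conjugating `T` by it gives a
polynomial curve on which `φ` is constant, and no exponentials are needed. The derivative at `ε = 0`
is the claim. -/
theorem AdInvariant.form_comm_of_sq_zero (hB : IsCoordAlg B) {φ : A → 𝕜} (hinv : AdInvariant φ)
    {T : A} (hφ : SmoothAt φ T) {X : A} (hX : X * X = 0) :
    B (T * grad B φ T - grad B φ T * T) X = 0 := by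
  have hu : ∀ ε : 𝕜, (1 + ε • X) * (1 + ε • -X) = 1 ∧ (1 + ε • -X) * (1 + ε • X) = 1 := fun ε => by
    constructor <;> simp [mul_add, add_mul, hX]
  have h1 := hB.hasVel_mul (hB.hasVel_mul (hB.hasVel_line 1 X 0) (hB.hasVel_const T (0 : 𝕜)))
    (hB.hasVel_line 1 (-X) 0)
  have h2 := hB.hasDerivAt_comp (φ := φ)
    (γ := fun ε : 𝕜 => (1 + ε • X) * T * (1 + ε • -X)) (t := 0) (by simpa using hφ) h1
  have h3 : ∀ ε : 𝕜, φ ((1 + ε • X) * T * (1 + ε • -X)) = φ T := fun ε =>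
    hinv ⟨1 + ε • X, 1 + ε • -X, (hu ε).1, (hu ε).2⟩ T
  simp only [h3] at h2
  have h4 := h2.unique (hasDerivAt_const (0 : 𝕜) (φ T))
  simp only [zero_smul, add_zero, one_mul, mul_one, mul_zero, mul_neg, map_add, map_neg] at h4
  rw [map_sub, LinearMap.sub_apply, hB.form_mul_cycle, hB.form_mul, sub_eq_add_neg]
  exact h4

theorem rowUnit_mul_rowUnit {p q : ℤ} {i j k l : Fin N} (h : Occurs N b p i j)
    (h' : Occurs N b q k l) : rowUnit 𝕜 N b p i * rowUnit 𝕜 N b q k =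
      if j = k then rowUnit 𝕜 N b (p + q) i else 0 := by
  refine alg_ext fun r m n => ?_
  rw [entry_rowUnit_mul h, entry_rowUnit h']
  by_cases hjk : j = k
  · subst hjk
    rw [if_pos rfl, entry_rowUnit (h.add h')]
    by_cases hm : m = i
    · simp only [hm, true_and, if_true, sub_eq_iff_eq_add']
    · simp only [hm, false_and, and_false, if_false]
  · simp only [hjk, false_and, and_false, if_false, ite_self, map_zero]

theorem Occurs.diag {p : ℤ} {j : Fin N} (h : Occurs N b p j j) (k : Fin N) :
    Occurs N b p k k := by
  cases b <;> simpa [Occurs] using h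

theorem occurs_sub (j k : Fin N) : Occurs N b (((j : ℕ) : ℤ) - ((k : ℕ) : ℤ)) j k := by
  cases b
  · exact rfl
  · exact Int.ModEq.refl _

/-- The commutator is tested against matrix units. Off-diagonal units square to zero. For diagonal
ones `λ^q E_kk` the pairing is independent of `k`, by another square-zero element, and the sum over
`k` is central, so it pairs to zero. -/
theorem AdInvariant.comm_grad {φ : Alg 𝕜 N b → 𝕜} (hinv : AdInvariant φ) {T : Alg 𝕜 N b}
    (hφ : SmoothAt φ T) : T * grad (form 𝕜 N b) φ T = grad (form 𝕜 N b) φ T * T := by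
  have hB := isCoordAlg_form 𝕜 N b
  set G := grad (form 𝕜 N b) φ T with hG
  have hsq : ∀ X : Alg 𝕜 N b, X * X = 0 → form 𝕜 N b (T * G - G * T) X = 0 :=
    fun X hX => hinv.form_comm_of_sq_zero hB hφ hX
  have hoff : ∀ (q : ℤ) (k j : Fin N), Occurs N b q k j → k ≠ j →
      form 𝕜 N b (T * G - G * T) (rowUnit 𝕜 N b q k) = 0 := by
    intro q k j h hkj
    refine hsq _ ?_
    rw [rowUnit_mul_rowUnit h h, if_neg (Ne.symm hkj)]
  have heq : ∀ (q : ℤ) (k i : Fin N), Occurs N b q k k →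
      form 𝕜 N b (T * G - G * T) (rowUnit 𝕜 N b q i) =
        form 𝕜 N b (T * G - G * T) (rowUnit 𝕜 N b q k) := by
    intro q k i h
    by_cases hik : i = k
    · rw [hik]
    have hi := h.diag i
    have hki := h.add (occurs_sub k i)
    have hik' := hi.add (occurs_sub i k)
    -- Up to `λ^q` this is `E_kk - E_ii` plus `E_ki - E_ik` with suitable powers of `λ`, modelled on
    -- the nilpotent matrix with rows `(1, 1)` and `(-1, -1)`.
    have h1 := hsq (rowUnit 𝕜 N b q k - rowUnit 𝕜 N b q i
      + rowUnit 𝕜 N b (q + (((k : ℕ) : ℤ) - ((i : ℕ) : ℤ))) k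
      - rowUnit 𝕜 N b (q + (((i : ℕ) : ℤ) - ((k : ℕ) : ℤ))) i) (by
        simp only [sub_mul, add_mul, mul_sub, mul_add, rowUnit_mul_rowUnit h h,
          rowUnit_mul_rowUnit h hi, rowUnit_mul_rowUnit h hki, rowUnit_mul_rowUnit h hik',
          rowUnit_mul_rowUnit hi h, rowUnit_mul_rowUnit hi hi, rowUnit_mul_rowUnit hi hki,
          rowUnit_mul_rowUnit hi hik', rowUnit_mul_rowUnit hki h, rowUnit_mul_rowUnit hki hi,
          rowUnit_mul_rowUnit hki hki, rowUnit_mul_rowUnit hki hik', rowUnit_mul_rowUnit hik' h,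
          rowUnit_mul_rowUnit hik' hi, rowUnit_mul_rowUnit hik' hki, rowUnit_mul_rowUnit hik' hik',
          if_true, if_neg hik, if_neg (Ne.symm hik)]
        rw [show q + (((k : ℕ) : ℤ) - ((i : ℕ) : ℤ)) + (q + (((i : ℕ) : ℤ) - ((k : ℕ) : ℤ))) = q + q by
            ring,
          show q + (((i : ℕ) : ℤ) - ((k : ℕ) : ℤ)) + (q + (((k : ℕ) : ℤ) - ((i : ℕ) : ℤ))) = q + q by
            ring,
          show q + (((k : ℕ) : ℤ) - ((i : ℕ) : ℤ)) + q = q + (q + (((k : ℕ) : ℤ) - ((i : ℕ) : ℤ))) by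
            ring,
          show q + (((i : ℕ) : ℤ) - ((k : ℕ) : ℤ)) + q = q + (q + (((i : ℕ) : ℤ) - ((k : ℕ) : ℤ))) by
            ring]
        abel)
    rw [map_sub, map_add, map_sub, hoff _ _ _ hki (Ne.symm hik), hoff _ _ _ hik' hik] at h1
    linear_combination -h1
  have hdiag : ∀ (q : ℤ) (k : Fin N), Occurs N b q k k →
      form 𝕜 N b (T * G - G * T) (rowUnit 𝕜 N b q k) = 0 := by
    intro q k h
    have hz : (∑ i, rowUnit 𝕜 N b q i) * T = T * ∑ i, rowUnit 𝕜 N b q i := by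
      refine alg_ext fun p j l => ?_
      simp only [Finset.sum_mul, Finset.mul_sum, map_sum, entry_rowUnit_mul (h.diag _),
        entry_mul_rowUnit (h.diag _)]
      simp
    have h1 : form 𝕜 N b (T * G - G * T) (∑ i, rowUnit 𝕜 N b q i) = 0 := by
      rw [map_sub, LinearMap.sub_apply, hB.form_mul_cycle, hB.form_mul, hz, sub_self]
    rw [map_sum, Finset.sum_congr rfl fun i _ => heq q k i h] at h1
    simp only [Finset.sum_const, Finset.card_univ, Fintype.card_fin, nsmul_eq_mul] at h1
    -- The `N` pairings are equal and add up to zero, and the existence of `k` excludes `N = 0`.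
    have hN : (N : 𝕜) ≠ 0 := Nat.cast_ne_zero.2 (Fin.pos k).ne'
    exact (mul_eq_zero.1 h1).resolve_left hN
  refine sub_eq_zero.1 (alg_ext fun p j k => ?_)
  rw [map_zero]
  by_cases h : Occurs N b p j k
  · rw [← form_rowUnit h]
    by_cases hjk : j = k
    · subst hjk
      exact hdiag _ _ h.neg
    · exact hoff _ _ _ h.neg (Ne.symm hjk)
  · exact entry_eq_zero h _

theorem opR_apply (X : Alg 𝕜 N b) : opR 𝕜 N b X = opR₀ 𝕜 N b X + opP₀ 𝕜 N b X := by
  classical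
  refine alg_ext fun p j k => ?_
  simp only [opR, opR₀, opP₀, LinearMap.sub_apply, map_sub, map_add, entry_proj, Set.mem_Ici,
    Set.mem_Iio, Set.mem_Ioi, Set.mem_singleton_iff]
  rcases lt_trichotomy p 0 with h | h | h
  · simp [h, h.ne, h.not_ge, h.not_gt]
  · simp [h]
  · simp [h, h.ne', h.le]

theorem AdInvariant.grad_conj (hB : IsCoordAlg B) {φ : A → 𝕜} (hinv : AdInvariant φ) {T U V : A}
    (hUV : U * V = 1) (hVU : V * U = 1) (hφ : SmoothAt φ T) :
    grad B φ (V * T * U) = V * grad B φ T * U := by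
  refine hB.grad_eq fun X => ?_
  have h := hB.isGradient_grad hφ (U * X * V)
  have h1 : ∀ ε : 𝕜, φ (V * T * U + ε • X) = φ (T + ε • (U * X * V)) := fun ε => by
    rw [← hinv ⟨U, V, hUV, hVU⟩ (V * T * U + ε • X)]
    congr 1
    change U * (V * T * U + ε • X) * V = _
    have h2 : U * (V * T * U) * V = T := by
      rw [show U * (V * T * U) * V = (U * V) * T * (U * V) by noncomm_ring, hUV, one_mul, mul_one]
    rw [mul_add, add_mul, h2, mul_smul_comm, smul_mul_assoc]
  simp only [h1]
  rwa [hB.form_mul, hB.form_mul_cycle]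

theorem hamVector_big (L V F₁ F₂ : Alg 𝕜 N b) :
    hamVector (bigA₁ 𝕜 N b) (bigA₂ 𝕜 N b) (bigS 𝕜 N b) (bigSadj 𝕜 N b) (L, V) (F₁, F₂) =
      ((1 / 2 : 𝕜) • (L * (opA₁ 𝕜 N b (F₁ * L) - opS 𝕜 N b (F₂ * V)
            + (opS 𝕜 N b (L * F₁) + opS 𝕜 N b (V * F₂)))
          - (opA₂ 𝕜 N b (L * F₁) - opSadj 𝕜 N b (V * F₂)
            + (opSadj 𝕜 N b (F₁ * L) + opSadj 𝕜 N b (F₂ * V))) * L),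
        (1 / 2 : 𝕜) • (V * (opSadj 𝕜 N b (F₁ * L) + opA₁ 𝕜 N b (F₂ * V)
            + (opS 𝕜 N b (L * F₁) - opSadj 𝕜 N b (V * F₂)))
          - (opS 𝕜 N b (L * F₁) + opA₂ 𝕜 N b (V * F₂)
            + (opSadj 𝕜 N b (F₁ * L) - opS 𝕜 N b (F₂ * V))) * V)) := by
  simp only [hamVector, bigA₁, bigA₂, bigS, bigSadj, block_apply, LinearMap.neg_apply,
    Prod.mk_mul_mk, Prod.mk_add_mk, Prod.mk_sub_mk, Prod.smul_mk, ← sub_eq_add_neg]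

/-- Invariance gives `∇φ(VL) = V ∇φ(LV) U`, and left and right differentials of `φ` coincide. So
both choices of `M` lead to the gradient `(V ∇φ(LV), ∇φ(LV) L)`, and the Hamiltonian vector contains
only `c₁ = dφ(LV)` and `c₂ = dφ(VL)`. -/
theorem AdInvariant.exists_hamiltonianVector (α : 𝕜) {φ : Alg 𝕜 N b → 𝕜} (hinv : AdInvariant φ)
    {M : Alg 𝕜 N b × Alg 𝕜 N b → Alg 𝕜 N b}
    (hM : M = monodromy₁ (Alg 𝕜 N b) ∨ M = monodromy₂ (Alg 𝕜 N b)) {L U V : Alg 𝕜 N b}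
    (hUV : U * V = 1) (hVU : V * U = 1) (h₁ : SmoothAt φ (L * V)) (h₂ : SmoothAt φ (V * L)) :
    ∃ L' V' : Alg 𝕜 N b, IsHamiltonianVector (bigBracket α) (φ ∘ M) (L, V) (L', V') ∧
      L' = L * laxC α φ (V * L) - laxC α φ (L * V) * L ∧
      -(U * V' * U) = U * laxC α φ (V * L) - laxC α φ (L * V) * U := by
  have hB := isCoordAlg_form 𝕜 N b
  have hc : L * V * grad (form 𝕜 N b) φ (L * V) = grad (form 𝕜 N b) φ (L * V) * L * V := by
    rw [hinv.comm_grad h₁, mul_assoc]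
  have hVL : V * L = V * (L * V) * U := by
    rw [show V * (L * V) * U = V * L * (V * U) by noncomm_ring, hVU, mul_one]
  have hG₂ : grad (form 𝕜 N b) φ (V * L) = V * grad (form 𝕜 N b) φ (L * V) * U := by
    rw [hVL]
    exact hinv.grad_conj hB hUV hVU h₁
  have hgrad : grad (prodForm (form 𝕜 N b)) (φ ∘ M) (L, V) =
      (V * grad (form 𝕜 N b) φ (L * V), grad (form 𝕜 N b) φ (L * V) * L) := by
    rcases hM with rfl | rfl
    · exact hB.grad_comp_monodromy₁ h₁
    · rw [hB.grad_comp_monodromy₂ h₂, hG₂, mul_assoc _ U V, hUV, mul_one, ← mul_assoc, ← mul_assoc,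
        hc, mul_assoc _ V U, hVU, mul_one]
  have hv := hB.prod.isHamiltonianVector (A₁ := bigA₁ 𝕜 N b) (A₂ := bigA₂ 𝕜 N b)
    isRMatrixBracket_big.adj α (φ ∘ M) (L, V)
  rw [hgrad, hamVector_big] at hv
  have hd₂ : V * L * grad (form 𝕜 N b) φ (V * L) = V * grad (form 𝕜 N b) φ (L * V) * L := by
    rw [hG₂, show V * L * (V * grad (form 𝕜 N b) φ (L * V) * U) =
      V * (L * V * grad (form 𝕜 N b) φ (L * V)) * U by noncomm_ring, hc,
      show V * (grad (form 𝕜 N b) φ (L * V) * L * V) * U =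
        V * grad (form 𝕜 N b) φ (L * V) * L * (V * U) by noncomm_ring, hVU, mul_one]
  -- The operator `W` cancels, and `R₀ + P₀ = R`.
  have hc₁ : ∀ X : Alg 𝕜 N b, opA₁ 𝕜 N b X + opS 𝕜 N b X = opR 𝕜 N b X := fun X => by
    simp only [opA₁, opS, opR_apply, LinearMap.add_apply, LinearMap.sub_apply]
    abel
  have hc₂ : ∀ X : Alg 𝕜 N b, opA₂ 𝕜 N b X + opSadj 𝕜 N b X = opR 𝕜 N b X := fun X => by
    simp only [opA₂, opSadj, opR_apply, LinearMap.add_apply, LinearMap.sub_apply]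
    abel
  simp only [laxC, dLeft, hd₂]
  rw [← mul_assoc L V, ← mul_assoc V, ← hc] at hv
  generalize V * grad (form 𝕜 N b) φ (L * V) * L = c₂ at *
  generalize L * V * grad (form 𝕜 N b) φ (L * V) = c₁ at *
  refine ⟨_, _, hv, ?_, ?_⟩
  · rw [← hc₁ c₂, ← hc₂ c₁]
    simp only [mul_smul_comm, smul_mul_assoc, ← smul_sub, smul_smul]
    rw [mul_one_div]
    congr 1
    noncomm_ring
  · have e : ∀ a c : Alg 𝕜 N b, U * (V * a - c * V) * U = a * U - U * c := fun a c => by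
      rw [show U * (V * a - c * V) * U = (U * V) * a * U - U * c * (V * U) by noncomm_ring, hUV,
        hVU, one_mul, mul_one]
    simp only [mul_smul_comm, smul_mul_assoc, e, ← smul_sub, ← smul_neg, smul_smul]
    rw [mul_one_div, ← hc₁ c₁, ← hc₂ c₂]
    congr 1
    noncomm_ring

/-- Coordinates are admissible test functions and determine the velocity; conversely the chain rule
recovers the derivative of every smooth function. -/
theorem hamiltonEquation_iff (hB : IsCoordAlg B) {br : (A → 𝕜) → (A → 𝕜) → (A → 𝕜)} {H : A → 𝕜}
    {γ : ℝ → A} {v w : A} {t : ℝ} (hv : IsHamiltonianVector br H (γ t) v)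
    (hw : HasVelocity 𝕜 γ w t) : HamiltonEquation br H γ t ↔ w = v := by
  refine ⟨fun h => hB.ext _ _ fun i => ?_, ?_⟩
  · have h1 := h _ (SmoothAt.coord i (γ t))
    have h2 := hv _ (SmoothAt.coord i (γ t))
    rw [(hw.2 i).unique h1]
    exact h2.unique ((hB.hasVel_line (γ t) v 0).2 i)
  · rintro rfl ψ hψ
    have h1 := hB.hasDerivAt_comp (K := ℝ) hψ hw
    rwa [(hB.isGradient_grad hψ w).unique (hv ψ hψ)] at h1

theorem AdInvariant.hamiltonEquation_iff_laxTriad (α : 𝕜) {φ : Alg 𝕜 N b → 𝕜}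
    (hinv : AdInvariant φ) {M : Alg 𝕜 N b × Alg 𝕜 N b → Alg 𝕜 N b}
    (hM : M = monodromy₁ (Alg 𝕜 N b) ∨ M = monodromy₂ (Alg 𝕜 N b)) {L U V : ℝ → Alg 𝕜 N b}
    {L' U' V' : Alg 𝕜 N b} {t : ℝ} (hUV : ∀ s, U s * V s = 1 ∧ V s * U s = 1)
    (h₁ : SmoothAt φ (L t * V t)) (h₂ : SmoothAt φ (V t * L t)) (hL : HasVelocity 𝕜 L L' t)
    (hU : HasVelocity 𝕜 U U' t) (hV : HasVelocity 𝕜 V V' t) :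
    HamiltonEquation (bigBracket α) (φ ∘ M) (fun s => (L s, V s)) t ↔
      L' = L t * laxC α φ (V t * L t) - laxC α φ (L t * V t) * L t ∧
      U' = U t * laxC α φ (V t * L t) - laxC α φ (L t * V t) * U t := by
  have hB := isCoordAlg_form 𝕜 N b
  obtain ⟨X, Y, hv, hX, hY⟩ := hinv.exists_hamiltonianVector α hM (hUV t).1 (hUV t).2 h₁ h₂
  have hmul := hB.hasVel_mul (K := ℝ) (γ := U) (δ := V) hU hV
  simp only [(hUV _).1] at hmul
  have h0 := hB.vel_unique hmul (hB.hasVel_const 1 t)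
  -- Obtained by differentiating `U V = 1` and multiplying by `U` on the right.
  have hU' : U' = -(U t * V' * U t) := by
    have h3 := congrArg (fun x => x * U t) h0
    simp only [add_mul, zero_mul, mul_assoc, (hUV t).2, mul_one] at h3
    rw [mul_assoc]
    exact eq_neg_of_add_eq_zero_left h3
  rw [hamiltonEquation_iff hB.prod (γ := fun s => (L s, V s)) hv
    (hasVel_prodMk (K := ℝ) (γ := L) (δ := V) hL hV), Prod.mk.injEq, ← hX, ← hY, hU']
  refine and_congr_right fun _ => ⟨fun h => by rw [h], fun h => ?_⟩
  have h4 := congrArg (fun x => V t * x * V t) (neg_injective h)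
  have e : ∀ Z : Alg 𝕜 N b, V t * (U t * Z * U t) * V t = Z := fun Z => by
    rw [show V t * (U t * Z * U t) * V t = (V t * U t) * Z * (U t * V t) by noncomm_ring,
      (hUV t).1, (hUV t).2, one_mul, mul_one]
  simpa only [e] using h4

end Monodromy

/-! ### Inverses of unipotent elements. -/

section Inverse

variable {𝕜 : Type*} [RCLike 𝕜] {N m : ℕ} {b : Boundary}

theorem mem_degreesIn_of_inter {s t u : Set ℤ} (h : ∀ p, p ∈ s → p ∈ t → p ∈ u) {X : Alg 𝕜 N b}
    (hs : X ∈ degreesIn 𝕜 (Alg 𝕜 N b) s) (ht : X ∈ degreesIn 𝕜 (Alg 𝕜 N b) t) :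
    X ∈ degreesIn 𝕜 (Alg 𝕜 N b) u := by
  rw [mem_degreesIn_iff] at hs ht ⊢
  intro p hp j k
  by_cases h1 : p ∈ s
  · exact ht p (fun h2 => hp (h p h1 h2)) j k
  · exact hs p h1 j k

theorem eq_zero_of_mem_Iic {X : Alg 𝕜 N b}
    (h : ∀ K : ℕ, X ∈ degreesIn 𝕜 (Alg 𝕜 N b) (Set.Iic (-(K : ℤ)))) : X = 0 := by
  refine alg_ext fun p j k => ?_
  rw [map_zero]
  refine mem_degreesIn_iff.1 (h (1 - p).toNat) p ?_ j k
  rw [Set.mem_Iic]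
  omega

theorem pow_mem_degreesIn {n : Alg 𝕜 N b} (hn : n ∈ degreesIn 𝕜 (Alg 𝕜 N b) (Set.Iic (-1)))
    (i : ℕ) : n ^ i ∈ degreesIn 𝕜 (Alg 𝕜 N b) (Set.Iic (-(i : ℤ))) := by
  induction i with
  | zero =>
    rw [pow_zero]
    exact one_mem_degreesIn (by simp)
  | succ i ih =>
    rw [pow_succ]
    refine mul_mem_degreesIn (fun p hp q hq => ?_) ih hn
    rw [Set.mem_Iic] at hp hq ⊢
    push_cast
    omega

/-- The Neumann series. -/
theorem exists_inverse_one_sub {n : Alg 𝕜 N b}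
    (hn : n ∈ degreesIn 𝕜 (Alg 𝕜 N b) (Set.Iic (-1))) :
    ∃ V : Alg 𝕜 N b, (1 - n) * V = 1 ∧ V * (1 - n) = 1 := by
  have hdiff : ∀ k K : ℕ, k ≤ K → ∑ i ∈ Finset.range K, n ^ i - ∑ i ∈ Finset.range k, n ^ i ∈
      degreesIn 𝕜 (Alg 𝕜 N b) (Set.Iic (-(k : ℤ))) := by
    intro k K h
    rw [← Finset.sum_Ico_eq_sub _ h]
    refine sum_mem fun i hi => degreesIn_mono (Set.Iic_subset_Iic.2 ?_) (pow_mem_degreesIn hn i)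
    have := (Finset.mem_Ico.1 hi).1
    omega
  -- The power `n ^ i` has degree at most `-i`, so the entries of degree `p` receive contributions
  -- from `i ≤ -p` only; the range is empty for `p > 0`.
  obtain ⟨V, hV⟩ := exists_of_entries (𝕜 := 𝕜) (N := N) (b := b) (P := 0)
    (fun p j k => entry 𝕜 N b p j k (∑ i ∈ Finset.range (1 - p).toNat, n ^ i))
    (fun p j k h => entry_eq_zero h _) (fun p hp j k => by
      rw [show (1 - p).toNat = 0 by omega]
      simp)
  have hVK : ∀ K : ℕ, V - ∑ i ∈ Finset.range K, n ^ i ∈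
      degreesIn 𝕜 (Alg 𝕜 N b) (Set.Iic (-(K : ℤ))) := by
    intro K
    rw [mem_degreesIn_iff]
    intro p hp j k
    rw [Set.mem_Iic, not_le] at hp
    rw [map_sub, hV, ← map_sub]
    rw [← neg_sub, map_neg, neg_eq_zero]
    refine mem_degreesIn_iff.1 (hdiff (1 - p).toNat K (by omega)) p ?_ j k
    rw [Set.mem_Iic]
    omega
  have h1n : 1 - n ∈ degreesIn 𝕜 (Alg 𝕜 N b) (Set.Iic 0) :=
    sub_mem (one_mem_degreesIn (by simp)) (degreesIn_mono (by simp) hn)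
  refine ⟨V, sub_eq_zero.1 (eq_zero_of_mem_Iic fun K => ?_),
    sub_eq_zero.1 (eq_zero_of_mem_Iic fun K => ?_)⟩
  · have h : (1 - n) * V - 1 = (1 - n) * (V - ∑ i ∈ Finset.range K, n ^ i) - n ^ K := by
      rw [mul_sub, mul_neg_geom_sum]
      abel
    rw [h]
    refine sub_mem (mul_mem_degreesIn (fun p hp q hq => ?_) h1n (hVK K)) (pow_mem_degreesIn hn K)
    rw [Set.mem_Iic] at hp hq ⊢
    omega
  · have h : V * (1 - n) - 1 = (V - ∑ i ∈ Finset.range K, n ^ i) * (1 - n) - n ^ K := by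
      rw [sub_mul, geom_sum_mul_neg]
      abel
    rw [h]
    refine sub_mem (mul_mem_degreesIn (fun p hp q hq => ?_) (hVK K) h1n) (pow_mem_degreesIn hn K)
    rw [Set.mem_Iic] at hp hq ⊢
    omega

/-- An inverse of an element of `1 + ⨁_{p < 0} g_p` has the same form. -/
theorem inverse_sub_one_mem {U V : Alg 𝕜 N b}
    (hU : U - 1 ∈ degreesIn 𝕜 (Alg 𝕜 N b) (Set.Iic (-1))) (hVU : V * U = 1) :
    V - 1 ∈ degreesIn 𝕜 (Alg 𝕜 N b) (Set.Iic (-1)) := by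
  have hn : 1 - U ∈ degreesIn 𝕜 (Alg 𝕜 N b) (Set.Iic (-1)) := by
    rw [← neg_sub]
    exact neg_mem hU
  obtain ⟨Q, hQ⟩ := exists_mem_degreesIn_Iic V
  have hV : ∀ K : ℕ, V = ∑ i ∈ Finset.range K, (1 - U) ^ i + V * (1 - U) ^ K := by
    intro K
    have h1 := congrArg (fun x => V * x) (mul_neg_geom_sum (1 - U) K)
    simp only [sub_sub_cancel, ← mul_assoc, hVU, one_mul, mul_sub, mul_one] at h1
    rw [h1]
    abel
  -- A priori `V` is only known to have degree at most `Q`; with this exponent the remainder `V * (1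
  -- - U) ^ K` has negative degree.
  have h := hV ((Q + 1).toNat + 1)
  rw [Finset.sum_range_succ', pow_zero] at h
  have h2 : V - 1 = ∑ i ∈ Finset.range (Q + 1).toNat, (1 - U) ^ (i + 1) +
      V * (1 - U) ^ ((Q + 1).toNat + 1) := by
    conv_lhs => rw [h]
    abel
  rw [h2]
  refine add_mem (sum_mem fun i _ => degreesIn_mono (Set.Iic_subset_Iic.2 ?_)
    (pow_mem_degreesIn hn (i + 1))) (mul_mem_degreesIn (fun p hp q hq => ?_) hQ
    (pow_mem_degreesIn hn _))
  · push_cast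
    omega
  · rw [Set.mem_Iic] at hp hq ⊢
    push_cast at hq
    omega

/-- The entries of `U⁻¹` are polynomials in the entries of `U`, if `U ∈ 1 + ⨁_{p < 0} g_p`. -/
theorem entry_inverse_mem {X : Type*} (F : Subalgebra 𝕜 (X → 𝕜)) {U V : X → Alg 𝕜 N b}
    (hU : ∀ x, U x - 1 ∈ degreesIn 𝕜 (Alg 𝕜 N b) (Set.Iic (-1)))
    (hV : ∀ x, V x - 1 ∈ degreesIn 𝕜 (Alg 𝕜 N b) (Set.Iic (-1)))
    (hUV : ∀ x, U x * V x = 1) (hF : ∀ p j k, (fun x => entry 𝕜 N b p j k (U x)) ∈ F)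
    (p : ℤ) (j k : Fin N) : (fun x => entry 𝕜 N b p j k (V x)) ∈ F := by
  have hconst : ∀ c : 𝕜, (fun _ : X => c) ∈ F := fun c => F.algebraMap_mem c
  -- From `V = 1 - (U - 1) V`, where `U - 1` has degree at most `-1`, the entries of `V` of degree
  -- `p` involve only entries of `V` of higher degree. The induction thus descends from degree `0`.
  have key : ∀ (n : ℕ) (p : ℤ), -(n : ℤ) ≤ p → ∀ j k,
      (fun x => entry 𝕜 N b p j k (V x)) ∈ F := by
    intro n
    induction n with
    | zero =>
      intro p hp j k
      have h : (fun x => entry 𝕜 N b p j k (V x)) = fun _ => entry 𝕜 N b p j k 1 := by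
        funext x
        rw [← sub_eq_zero, ← map_sub]
        exact mem_degreesIn_iff.1 (hV x) p (by rw [Set.mem_Iic]; push_cast at hp; omega) j k
      rw [h]
      exact hconst _
    | succ n ih =>
      intro p hp j k
      have hV0 : ∀ x, V x ∈ degreesIn 𝕜 (Alg 𝕜 N b) (Set.Iic 0) := fun x => by
        rw [← sub_add_cancel (V x) 1]
        exact add_mem (degreesIn_mono (by simp) (hV x)) (one_mem_degreesIn (by simp))
      have h : (fun x => entry 𝕜 N b p j k (V x)) = (fun _ => entry 𝕜 N b p j k 1) -
          ∑ q ∈ Finset.Icc (p - 0) (-1), ∑ l, (fun x => entry 𝕜 N b q j l (U x - 1)) *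
            fun x => entry 𝕜 N b (p - q) l k (V x) := by
        funext x
        simp only [Pi.sub_apply, Finset.sum_apply, Pi.mul_apply]
        rw [← entry_mul (hU x) (hV0 x), ← map_sub, sub_mul, hUV, one_mul, sub_sub_cancel]
      rw [h]
      refine sub_mem (hconst _) (sum_mem fun q hq => sum_mem fun l _ => mul_mem ?_ (ih _ ?_ _ _))
      · simp only [map_sub]
        exact sub_mem (hF q j l) (hconst _)
      · rw [Finset.mem_Icc] at hq
        push_cast at hp
        omega
  exact key (-p).toNat p (by omega) j k

end Inverse

/-! ### The Lax matrices as affine functions of the fields, and the image. -/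

section LaxMap

variable {𝕜 : Type*} [RCLike 𝕜] {N m : ℕ} {b : Boundary}

theorem diagonalElt_add (p : ℤ) (x y : Fin N → 𝕜) :
    diagonalElt 𝕜 N b p (x + y) = diagonalElt 𝕜 N b p x + diagonalElt 𝕜 N b p y := by
  simp only [diagonalElt_eq_sum, Pi.add_apply, add_smul, Finset.sum_add_distrib]

theorem diagonalElt_smul (p : ℤ) (r : 𝕜) (x : Fin N → 𝕜) :
    diagonalElt 𝕜 N b p (r • x) = r • diagonalElt 𝕜 N b p x := by
  simp only [diagonalElt_eq_sum, Pi.smul_apply, smul_assoc, Finset.smul_sum]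

theorem diagonalElt_zero_one : diagonalElt 𝕜 N b 0 (fun _ => 1) = 1 := by
  classical
  refine alg_ext fun p j k => ?_
  rw [entry_diagonalElt, entry_one]
  congr 1
  exact propext ⟨fun h => ⟨h.1, eq_of_occurs_zero h.2⟩,
    fun h => ⟨h.1, h.2 ▸ occurs_zero j⟩⟩

/-- The linear part of `u ↦ L`. -/
noncomputable def laxLLin (α : 𝕜) : phaseSpace 𝕜 N m b →ₗ[𝕜] Alg 𝕜 N b where
  toFun u := α • diagonalElt 𝕜 N b 0 u.1.1
  map_add' u v := by
    rw [← smul_add, ← diagonalElt_add]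
    rfl
  map_smul' r u := by
    change α • diagonalElt 𝕜 N b 0 (r • u.1.1) = r • α • _
    rw [diagonalElt_smul, smul_comm]

/-- The linear part of `u ↦ U`. -/
noncomputable def laxULin (α : 𝕜) : phaseSpace 𝕜 N m b →ₗ[𝕜] Alg 𝕜 N b where
  toFun u := -(α • ∑ j : Fin m, diagonalElt 𝕜 N b (-((j : ℕ) + 1 : ℤ)) (u.1.2 j))
  map_add' u v := by
    rw [← neg_add, ← smul_add, ← Finset.sum_add_distrib]
    simp only [← diagonalElt_add]
    rfl
  map_smul' r u := by
    change -(α • ∑ j : Fin m, diagonalElt 𝕜 N b (-((j : ℕ) + 1 : ℤ)) (r • u.1.2 j)) = r • -(α • _)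
    simp only [diagonalElt_smul, ← Finset.smul_sum]
    rw [smul_neg, smul_comm]

theorem laxL_eq (α : 𝕜) (u : phaseSpace 𝕜 N m b) :
    laxL α u = 1 + α • shiftE 𝕜 N b + laxLLin α u := by
  have h : diagonalElt 𝕜 N b 0 (fun k => 1 + α * u.1.1 k) = 1 + laxLLin α u := by
    rw [← diagonalElt_zero_one]
    change _ = _ + α • diagonalElt 𝕜 N b 0 u.1.1
    rw [← diagonalElt_smul, ← diagonalElt_add]
    rfl
  rw [laxL, h]
  abel

theorem laxU_eq (α : 𝕜) (u : phaseSpace 𝕜 N m b) : laxU α u = 1 + laxULin α u :=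
  sub_eq_add_neg _ _

theorem laxLLin_mem (α : 𝕜) (u : phaseSpace 𝕜 N m b) :
    laxLLin α u ∈ degreesIn 𝕜 (Alg 𝕜 N b) {0} :=
  Submodule.smul_mem _ _ (diagonalElt_mem_degreesIn (Set.mem_singleton 0) _)

theorem laxULin_mem (α : 𝕜) (u : phaseSpace 𝕜 N m b) :
    laxULin α u ∈ degreesIn 𝕜 (Alg 𝕜 N b) (Set.Icc (-(m : ℤ)) (-1)) := by
  refine neg_mem (Submodule.smul_mem _ _ (sum_mem fun j _ => diagonalElt_mem_degreesIn ?_ _))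
  have := j.2
  rw [Set.mem_Icc]
  omega

theorem laxU_sub_one_mem (α : 𝕜) (u : phaseSpace 𝕜 N m b) :
    laxU α u - 1 ∈ degreesIn 𝕜 (Alg 𝕜 N b) (Set.Iic (-1)) := by
  rw [laxU_eq, add_sub_cancel_left]
  exact degreesIn_mono Set.Icc_subset_Iic_self (laxULin_mem α u)

theorem ring_inverse_eq {A : Type*} [Ring A] {U V : A} (h : U * V = 1) (h' : V * U = 1) :
    Ring.inverse U = V :=
  Ring.inverse_unit ⟨U, V, h, h'⟩

theorem laxU_mul_inverse (α : 𝕜) (u : phaseSpace 𝕜 N m b) :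
    laxU α u * Ring.inverse (laxU α u) = 1 ∧ Ring.inverse (laxU α u) * laxU α u = 1 := by
  obtain ⟨V, h, h'⟩ := exists_inverse_one_sub (neg_mem (laxU_sub_one_mem α u))
  rw [sub_neg_eq_add, add_sub_cancel] at h h'
  rw [ring_inverse_eq h h']
  exact ⟨h, h'⟩

theorem inverse_laxU_sub_one_mem (α : 𝕜) (u : phaseSpace 𝕜 N m b) :
    Ring.inverse (laxU α u) - 1 ∈ degreesIn 𝕜 (Alg 𝕜 N b) (Set.Iic (-1)) :=
  inverse_sub_one_mem (laxU_sub_one_mem α u) (laxU_mul_inverse α u).2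

theorem inverse_laxU_mem (α : 𝕜) (u : phaseSpace 𝕜 N m b) :
    Ring.inverse (laxU α u) ∈ degreesIn 𝕜 (Alg 𝕜 N b) (Set.Iic 0) := by
  rw [← sub_add_cancel (Ring.inverse (laxU α u)) 1]
  exact add_mem (degreesIn_mono (by simp) (inverse_laxU_sub_one_mem α u))
    (one_mem_degreesIn (by simp))

theorem laxL_mem (α : 𝕜) (u : phaseSpace 𝕜 N m b) :
    laxL α u ∈ degreesIn 𝕜 (Alg 𝕜 N b) (Set.Icc 0 1) := by
  rw [laxL_eq]
  exact add_mem (add_mem (one_mem_degreesIn (by simp))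
    (Submodule.smul_mem _ _ (diagonalElt_mem_degreesIn (by simp) _)))
    (degreesIn_mono (by simp) (laxLLin_mem α u))

theorem exists_occurs_neg {j k : ℕ} (hk : k < N) (h : b = .openEnd → k + (j + 1) < N) :
    ∃ l, Occurs N b (-((j : ℤ) + 1)) ⟨k, hk⟩ l := by
  cases b with
  | openEnd =>
    refine ⟨⟨k + (j + 1), h rfl⟩, ?_⟩
    change ((k : ℕ) : ℤ) - ((k + (j + 1) : ℕ) : ℤ) = _
    push_cast
    ring
  | periodic =>
    refine ⟨⟨(k + (j + 1)) % N, Nat.mod_lt _ (by omega)⟩, ?_⟩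
    change ((k : ℕ) : ℤ) - (((k + (j + 1)) % N : ℕ) : ℤ) ≡ _ [ZMOD N]
    push_cast
    have h1 := (Int.mod_modEq ((k : ℤ) + (j + 1)) N).sub_left (k : ℤ)
    refine h1.trans ?_
    rw [show (k : ℤ) - (k + (j + 1)) = -((j : ℤ) + 1) by ring]

theorem rowCoeff_laxULin (α : 𝕜) (u : phaseSpace 𝕜 N m b) (j : Fin m) (k : Fin N) :
    rowCoeff (-((j : ℕ) + 1 : ℤ)) (laxULin α u) k = -(α * u.1.2 j k) := by
  classical
  by_cases h : b = .openEnd → (k : ℕ) + ((j : ℕ) + 1) < N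
  · obtain ⟨l, hl⟩ := exists_occurs_neg k.2 h
    rw [rowCoeff_eq hl]
    change entry 𝕜 N b _ _ _ (-(α • _)) = _
    rw [map_neg, map_smul, map_sum, Finset.sum_eq_single j]
    · rw [entry_diagonalElt, if_pos ⟨rfl, hl⟩, smul_eq_mul]
    · intro i _ hi
      rw [entry_diagonalElt, if_neg]
      intro h'
      exact hi (Fin.ext (by omega))
    · simp
  -- With open ends this row has no column in the given degree; correspondingly the field is zero by
  -- the definition of `phaseSpace`.
  · push Not at h
    rw [u.2 h.1 j k h.2, mul_zero, neg_zero]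
    refine Finset.sum_eq_zero fun l _ => entry_eq_zero (fun h' => ?_) _
    obtain ⟨rfl, h⟩ := h
    have h1 : ((k : ℕ) : ℤ) - ((l : ℕ) : ℤ) = -((j : ℕ) + 1 : ℤ) := h'
    have := l.2
    omega

/-- The linear parts of `L` and `U` fill out `g₀` and the degrees `-m, …, -1`. This yields the
description of the image as well as tangency, where the field variation `w` is recovered from the
velocities of `L` and `U`. -/
theorem exists_laxLin_eq {α : 𝕜} (hα : α ≠ 0) {X Y : Alg 𝕜 N b}
    (hX : X ∈ degreesIn 𝕜 (Alg 𝕜 N b) {0})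
    (hY : Y ∈ degreesIn 𝕜 (Alg 𝕜 N b) (Set.Icc (-(m : ℤ)) (-1))) :
    ∃ w : phaseSpace 𝕜 N m b, laxLLin α w = X ∧ laxULin α w = Y := by
  refine ⟨⟨(α⁻¹ • rowCoeff 0 X, fun j => (-α⁻¹) • rowCoeff (-((j : ℕ) + 1 : ℤ)) Y), ?_⟩, ?_, ?_⟩
  · rintro rfl j k h
    change _ * rowCoeff _ _ _ = (0 : 𝕜)
    rw [rowCoeff, Finset.sum_eq_zero fun l _ => entry_eq_zero (fun h' => ?_) _, mul_zero]
    have h1 : ((k : ℕ) : ℤ) - ((l : ℕ) : ℤ) = -((j : ℕ) + 1 : ℤ) := h'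
    have := l.2
    omega
  · change α • diagonalElt 𝕜 N b 0 (α⁻¹ • rowCoeff 0 X) = X
    rw [diagonalElt_smul, smul_inv_smul₀ hα, ← eq_diagonalElt_of_mem hX]
  · change -(α • ∑ j : Fin m, diagonalElt 𝕜 N b (-((j : ℕ) + 1 : ℤ))
      ((-α⁻¹) • rowCoeff (-((j : ℕ) + 1 : ℤ)) Y)) = Y
    simp only [diagonalElt_smul, ← Finset.smul_sum]
    rw [neg_smul, smul_neg, neg_neg, smul_inv_smul₀ hα]
    conv_rhs => rw [eq_sum_diagonalElt hY]
    rw [Fin.sum_univ_eq_sum_range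
      (fun j => diagonalElt 𝕜 N b (-((j : ℕ) + 1 : ℤ)) (rowCoeff (-((j : ℕ) + 1 : ℤ)) Y)) m]
    refine Finset.sum_bij' (fun j _ => -((j : ℕ) + 1 : ℤ)) (fun q _ => (-q - 1).toNat) ?_ ?_ ?_ ?_ ?_
    · intro j hj
      rw [Finset.mem_range] at hj
      rw [Finset.mem_Icc]
      omega
    · intro q hq
      rw [Finset.mem_Icc] at hq
      rw [Finset.mem_range]
      omega
    · intro j hj
      simp
    · intro q hq
      rw [Finset.mem_Icc] at hq
      omega
    · intro j _
      rfl

theorem entry_laxLLin (α : 𝕜) (w : phaseSpace 𝕜 N m b) (k : Fin N) :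
    entry 𝕜 N b 0 k k (laxLLin α w) = α * w.1.1 k := by
  change entry 𝕜 N b 0 k k (α • _) = _
  rw [map_smul, entry_diagonalElt_zero, smul_eq_mul]

theorem laxLin_injective {α : 𝕜} (hα : α ≠ 0) {w : phaseSpace 𝕜 N m b} (hL : laxLLin α w = 0)
    (hU : laxULin α w = 0) : w = 0 := by
  refine Subtype.ext (Prod.ext (funext fun k => ?_) (funext fun j => funext fun k => ?_))
  · have h := entry_laxLLin α w k
    rw [hL, map_zero] at h
    exact (mul_eq_zero.1 h.symm).resolve_left hα
  · have h := rowCoeff_laxULin α w j k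
    rw [hU] at h
    simp only [rowCoeff, map_zero, Finset.sum_const_zero] at h
    exact (mul_eq_zero.1 (neg_eq_zero.1 h.symm)).resolve_left hα

theorem range_laxMap {α : 𝕜} (hα : α ≠ 0) :
    Set.range (laxMap (N := N) (m := m) (b := b) α) = laxSet m α := by
  ext x
  constructor
  · rintro ⟨u, rfl⟩
    refine ⟨?_, laxU α u, ?_, laxU_mul_inverse α u⟩
    · change laxL α u - _ ∈ _
      rw [laxL_eq, add_sub_right_comm, add_sub_cancel_right]
      exact add_mem (one_mem_degreesIn (Set.mem_singleton 0)) (laxLLin_mem α u)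
    · rw [laxU_eq, add_sub_cancel_left]
      exact laxULin_mem α u
  · rintro ⟨hL, U, hU, h, h'⟩
    obtain ⟨w, hw, hw'⟩ := exists_laxLin_eq hα
      (sub_mem hL (one_mem_degreesIn (Set.mem_singleton 0))) hU
    refine ⟨w, Prod.ext ?_ ?_⟩
    · change laxL α w = x.1
      rw [laxL_eq, hw]
      abel
    · change Ring.inverse (laxU α w) = x.2
      rw [laxU_eq, hw', add_sub_cancel]
      exact ring_inverse_eq h h'

end LaxMap

/-! ### The map to `(L, U⁻¹)` is a smooth embedding. -/

section Embedding

variable {𝕜 : Type*} [RCLike 𝕜] {N m : ℕ} {b : Boundary}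

theorem contDiff_entry_laxL (α : 𝕜) (p : ℤ) (j k : Fin N) :
    ContDiff 𝕜 ∞ fun u : phaseSpace 𝕜 N m b => entry 𝕜 N b p j k (laxL α u) := by
  simp only [laxL_eq, map_add]
  exact contDiff_const.add
    (LinearMap.toContinuousLinearMap (entry 𝕜 N b p j k ∘ₗ laxLLin α)).contDiff

theorem contDiff_entry_laxU (α : 𝕜) (p : ℤ) (j k : Fin N) :
    ContDiff 𝕜 ∞ fun u : phaseSpace 𝕜 N m b => entry 𝕜 N b p j k (laxU α u) := by
  simp only [laxU_eq, map_add]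
  exact contDiff_const.add
    (LinearMap.toContinuousLinearMap (entry 𝕜 N b p j k ∘ₗ laxULin α)).contDiff

/-- `entry_inverse_mem` is applied to the algebra of smooth functions of the fields. -/
theorem contDiff_entry_inverse_laxU (α : 𝕜) (p : ℤ) (j k : Fin N) :
    ContDiff 𝕜 ∞ fun u : phaseSpace 𝕜 N m b => entry 𝕜 N b p j k (Ring.inverse (laxU α u)) :=
  entry_inverse_mem (X := phaseSpace 𝕜 N m b)
    { carrier := {f | ContDiff 𝕜 ∞ f}
      mul_mem' := fun {f g} (hf : ContDiff 𝕜 ∞ f) (hg : ContDiff 𝕜 ∞ g) => by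
        change ContDiff 𝕜 ∞ fun x => f x * g x
        exact hf.mul hg
      add_mem' := fun {f g} (hf : ContDiff 𝕜 ∞ f) (hg : ContDiff 𝕜 ∞ g) => by
        change ContDiff 𝕜 ∞ fun x => f x + g x
        exact hf.add hg
      algebraMap_mem' := fun r =>
        (contDiff_const : ContDiff 𝕜 ∞ fun _ : phaseSpace 𝕜 N m b => r) }
    (laxU_sub_one_mem α) (inverse_laxU_sub_one_mem α) (fun u => (laxU_mul_inverse α u).1)
    (contDiff_entry_laxU α) p j k

theorem contDiff_coord_laxMap (α : 𝕜) (i : Idx 𝕜 (Alg 𝕜 N b × Alg 𝕜 N b)) :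
    ContDiff 𝕜 ∞ fun u : phaseSpace 𝕜 N m b => coord i (laxMap α u) := by
  rcases i with i | i
  · exact contDiff_entry_laxL α _ _ _
  · exact contDiff_entry_inverse_laxU α _ _ _

theorem hasVel_inverse_laxU (α : 𝕜) (u w : phaseSpace 𝕜 N m b) (v : Alg 𝕜 N b)
    (hv : ∀ p j k, entry 𝕜 N b p j k v =
      fderiv 𝕜 (fun u => entry 𝕜 N b p j k (Ring.inverse (laxU α u))) u w) :
    HasVel 𝕜 (fun ε : 𝕜 => Ring.inverse (laxU α (u + ε • w))) v 0 := by
  refine ⟨⟨0, Filter.Eventually.of_forall fun ε => inverse_laxU_mem α _⟩, fun i => ?_⟩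
  have h1 : HasDerivAt (fun ε : 𝕜 => u + ε • w) w 0 := by
    simpa using ((hasDerivAt_id (0 : 𝕜)).smul_const w).const_add u
  have h2 : HasFDerivAt (fun u => entry 𝕜 N b i.1 i.2.1 i.2.2 (Ring.inverse (laxU α u)))
      (fderiv 𝕜 (fun u => entry 𝕜 N b i.1 i.2.1 i.2.2 (Ring.inverse (laxU α u))) u)
      (u + (0 : 𝕜) • w) := by
    rw [zero_smul, add_zero]
    exact ((contDiff_entry_inverse_laxU α _ _ _).differentiable (by simp) u).hasFDerivAt
  have h3 := h2.comp_hasDerivAt (0 : 𝕜) h1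
  rw [← hv] at h3
  exact h3

/-- The derivatives of the entries of `U⁻¹` in the direction `w` are the entries of one element `v`,
and differentiating `U U⁻¹ = 1` determines it. -/
theorem fderiv_entry_inverse_laxU (α : 𝕜) (u w : phaseSpace 𝕜 N m b) (p : ℤ) (j k : Fin N) :
    fderiv 𝕜 (fun u => entry 𝕜 N b p j k (Ring.inverse (laxU α u))) u w = entry 𝕜 N b p j k
      (-(Ring.inverse (laxU α u) * laxULin α w * Ring.inverse (laxU α u))) := by
  have hB := isCoordAlg_form 𝕜 N b
  obtain ⟨v, hv⟩ := exists_of_entries (𝕜 := 𝕜) (N := N) (b := b) (P := 0)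
    (fun p j k => fderiv 𝕜 (fun u => entry 𝕜 N b p j k (Ring.inverse (laxU α u))) u w)
    (fun p j k h => by
      simp only [entry_eq_zero h]
      simp)
    (fun p hp j k => by
      simp only [mem_degreesIn_iff.1 (inverse_laxU_mem α _) p (by simpa using hp)]
      simp)
  have h1 := hasVel_inverse_laxU α u w v hv
  have h2 : HasVel 𝕜 (fun ε : 𝕜 => laxU α (u + ε • w)) (laxULin α w) 0 := by
    simp only [laxU_eq, map_add, map_smul, ← add_assoc]
    exact hB.hasVel_line _ _ 0
  have h3 := hB.hasVel_mul h2 h1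
  simp only [(laxU_mul_inverse α _).1, zero_smul, add_zero] at h3
  have h4 := hB.vel_unique h3 (hB.hasVel_const 1 0)
  rw [← hv]
  congr 1
  have h5 := congrArg (fun x => Ring.inverse (laxU α u) * x) h4
  simp only [mul_add, mul_zero, ← mul_assoc, (laxU_mul_inverse α u).2, one_mul] at h5
  exact eq_neg_of_add_eq_zero_right h5

theorem fderiv_coord_laxMap (α : 𝕜) (u w : phaseSpace 𝕜 N m b)
    (i : Idx 𝕜 (Alg 𝕜 N b × Alg 𝕜 N b)) : fderiv 𝕜 (fun u => coord i (laxMap α u)) u w = coord i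
      ((laxLLin α w, -(Ring.inverse (laxU α u) * laxULin α w * Ring.inverse (laxU α u))) :
        Alg 𝕜 N b × Alg 𝕜 N b) := by
  rcases i with i | i
  · have h : (fun u : phaseSpace 𝕜 N m b => entry 𝕜 N b i.1 i.2.1 i.2.2 (laxL α u)) = fun u =>
        entry 𝕜 N b i.1 i.2.1 i.2.2 (1 + α • shiftE 𝕜 N b) +
          LinearMap.toContinuousLinearMap (entry 𝕜 N b i.1 i.2.1 i.2.2 ∘ₗ laxLLin α) u := by
      funext u
      rw [laxL_eq, map_add]
      rfl
    change fderiv 𝕜 (fun u : phaseSpace 𝕜 N m b => entry 𝕜 N b i.1 i.2.1 i.2.2 (laxL α u)) u w = _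
    rw [h, fderiv_const_add, ContinuousLinearMap.fderiv]
    rfl
  · exact fderiv_entry_inverse_laxU α u w _ _ _

theorem eq_zero_of_fderiv_laxMap {α : 𝕜} (hα : α ≠ 0) {u w : phaseSpace 𝕜 N m b}
    (h : ∀ i : Idx 𝕜 (Alg 𝕜 N b × Alg 𝕜 N b),
      fderiv 𝕜 (fun u => coord i (laxMap α u)) u w = 0) : w = 0 := by
  have h1 := (isCoordAlg_form 𝕜 N b).prod.ext
    (laxLLin α w, -(Ring.inverse (laxU α u) * laxULin α w * Ring.inverse (laxU α u))) 0 fun i => by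
      rw [map_zero, ← h i, fderiv_coord_laxMap]
  rw [Prod.mk_eq_zero, neg_eq_zero] at h1
  refine laxLin_injective hα h1.1 ?_
  obtain ⟨hUV, hVU⟩ := laxU_mul_inverse α u
  calc laxULin α w = (laxU α u * Ring.inverse (laxU α u)) * laxULin α w *
        (Ring.inverse (laxU α u) * laxU α u) := by rw [hUV, hVU, one_mul, mul_one]
    _ = laxU α u * (Ring.inverse (laxU α u) * laxULin α w * Ring.inverse (laxU α u)) *
        laxU α u := by noncomm_ring
    _ = 0 := by rw [h1.2, mul_zero, zero_mul]

/-- The fields depend continuously on the coordinates of the image: up to constants they are entries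
of `L` and `U` divided by `±α`, and the entries of `U` are polynomials in those of `U⁻¹`. -/
theorem isEmbedding_laxMap {α : 𝕜} (hα : α ≠ 0) : IsEmbedding
    fun (u : phaseSpace 𝕜 N m b) (i : Idx 𝕜 (Alg 𝕜 N b × Alg 𝕜 N b)) => coord i (laxMap α u) := by
  refine IsInducing.isEmbedding (isInducing_iff_nhds.2 fun u => le_antisymm ?_ ?_)
  · have h : Continuous fun (u : phaseSpace 𝕜 N m b) (i : Idx 𝕜 (Alg 𝕜 N b × Alg 𝕜 N b)) =>
        coord i (laxMap α u) := continuous_pi fun i => (contDiff_coord_laxMap α i).continuous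
    exact (h.tendsto u).le_comap
  set l := Filter.comap (fun (u : phaseSpace 𝕜 N m b) (i : Idx 𝕜 (Alg 𝕜 N b × Alg 𝕜 N b)) =>
    coord i (laxMap α u)) (𝓝 fun i => coord i (laxMap α u)) with hl
  have h1 : ∀ i : Idx 𝕜 (Alg 𝕜 N b × Alg 𝕜 N b),
      Filter.Tendsto (fun x => coord i (laxMap α x)) l (𝓝 (coord i (laxMap α u))) :=
    tendsto_pi_nhds.1 Filter.tendsto_comap
  have hLe : ∀ p j k, Filter.Tendsto (fun x => entry 𝕜 N b p j k (laxL α x)) l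
      (𝓝 (entry 𝕜 N b p j k (laxL α u))) := fun p j k => h1 (Sum.inl (p, j, k))
  -- `entry_inverse_mem` is used with `U` and `U⁻¹` exchanged, for the algebra of functions that
  -- tend along `l` to their value at `u`.
  have hUe : ∀ p j k, Filter.Tendsto (fun x => entry 𝕜 N b p j k (laxU α x)) l
      (𝓝 (entry 𝕜 N b p j k (laxU α u))) :=
    entry_inverse_mem (X := phaseSpace 𝕜 N m b)
      { carrier := {f | Filter.Tendsto f l (𝓝 (f u))}
        mul_mem' := fun hf hg => Filter.Tendsto.mul hf hg
        add_mem' := fun hf hg => Filter.Tendsto.add hf hg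
        algebraMap_mem' := fun _ => tendsto_const_nhds }
      (inverse_laxU_sub_one_mem α) (laxU_sub_one_mem α) (fun u => (laxU_mul_inverse α u).2)
      (fun p j k => h1 (Sum.inr (p, j, k)))
  have hdiv : ∀ f : phaseSpace 𝕜 N m b → 𝕜, Filter.Tendsto (fun x => α * f x) l (𝓝 (α * f u)) →
      Filter.Tendsto f l (𝓝 (f u)) := fun f hf => by
    simpa [inv_mul_cancel_left₀ hα] using hf.const_mul α⁻¹
  have hid : Filter.Tendsto id l (𝓝 u) := by
    rw [tendsto_subtype_rng]
    refine Filter.Tendsto.prodMk_nhds (tendsto_pi_nhds.2 fun k => ?_)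
      (tendsto_pi_nhds.2 fun j => tendsto_pi_nhds.2 fun k => ?_)
    · refine hdiv (fun x => x.1.1 k) ?_
      have h2 := (hLe 0 k k).sub_const (entry 𝕜 N b 0 k k (1 + α • shiftE 𝕜 N b))
      simpa only [laxL_eq, map_add (entry 𝕜 N b 0 k k) (1 + α • shiftE 𝕜 N b),
        add_sub_cancel_left, entry_laxLLin] using h2
    · refine hdiv (fun x => x.1.2 j k) ?_
      have h2 : Filter.Tendsto (fun x => rowCoeff (-((j : ℕ) + 1 : ℤ)) (laxULin α x) k) l
          (𝓝 (rowCoeff (-((j : ℕ) + 1 : ℤ)) (laxULin α u) k)) := by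
        refine tendsto_finsetSum _ fun i _ => ?_
        have h3 := (hUe (-((j : ℕ) + 1 : ℤ)) k i).sub_const (entry 𝕜 N b (-((j : ℕ) + 1 : ℤ)) k i 1)
        simpa only [laxU_eq, map_add, add_sub_cancel_left] using h3
      simp only [rowCoeff_laxULin] at h2
      simpa using h2.neg
  exact hid

end Embedding

/-! ### Tangency of the Hamiltonian vector fields. -/

section Tangent

variable {𝕜 : Type*} [RCLike 𝕜] {N m : ℕ} {b : Boundary}

theorem entry_opP₀ (X : Alg 𝕜 N b) (j : Fin N) :
    entry 𝕜 N b 0 j j (opP₀ 𝕜 N b X) = entry 𝕜 N b 0 j j X := by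
  classical
  rw [opP₀, entry_proj, if_pos (Set.mem_singleton 0)]

/-- The expression is the coefficient of the `i`-th diagonal entry of `X` in `S(X)_kk + S*(X)_jj`.
For `j = k + 1` the two unit terms compensate the difference of the signs, and `c = 0`; at the
periodic junction `j = 0`, `k = N - 1` the value is `c = 2`. In the latter case a vanishing trace is
needed. -/
theorem exists_sign_sub_sign_eq {j k : Fin N} (h : Occurs N b 1 j k) : ∃ c : ℤ, ∀ i : Fin N,
    (if i = k then 1 else 0) + (if i = j then 1 else 0) + (((i : ℕ) : ℤ) - ((j : ℕ) : ℤ)).sign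
      - (((i : ℕ) : ℤ) - ((k : ℕ) : ℤ)).sign = c := by
  have hs : ∀ t : ℤ, (0 < t ∧ t.sign = 1) ∨ (t = 0 ∧ t.sign = 0) ∨ (t < 0 ∧ t.sign = -1) := by
    intro t
    rcases lt_trichotomy t 0 with h | h | h
    · exact Or.inr (Or.inr ⟨h, Int.sign_eq_neg_one_of_neg h⟩)
    · exact Or.inr (Or.inl ⟨h, by simp [h]⟩)
    · exact Or.inl ⟨h, Int.sign_eq_one_of_pos h⟩
  have hjN := j.2
  have hkN := k.2
  -- As `0 ≤ j, k < N`, the congruence `j - k ≡ 1` leaves only the neighbour and the wrap-around.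
  have h' : ((j : ℕ) : ℤ) = k + 1 ∨ ((j : ℕ) = 0 ∧ (k : ℕ) + 1 = N) := by
    cases b with
    | openEnd =>
      have h1 : ((j : ℕ) : ℤ) - ((k : ℕ) : ℤ) = 1 := h
      omega
    | periodic =>
      have h1 : ((j : ℕ) : ℤ) - ((k : ℕ) : ℤ) ≡ 1 [ZMOD N] := h
      obtain ⟨r, hr⟩ := h1.symm.dvd
      have h2 : r < 1 := by nlinarith
      have h3 : -2 < r := by nlinarith
      obtain rfl | rfl : r = 0 ∨ r = -1 := by omega
      · omega
      · omega
  rcases h' with h' | h'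
  · refine ⟨0, fun i => ?_⟩
    simp only [Fin.ext_iff]
    rcases hs (((i : ℕ) : ℤ) - ((j : ℕ) : ℤ)) with h1 | h1 | h1 <;>
      rcases hs (((i : ℕ) : ℤ) - ((k : ℕ) : ℤ)) with h2 | h2 | h2 <;>
        rw [h1.2, h2.2] <;> split_ifs <;> omega
  · refine ⟨2, fun i => ?_⟩
    have hiN := i.2
    simp only [Fin.ext_iff]
    rcases hs (((i : ℕ) : ℤ) - ((j : ℕ) : ℤ)) with h1 | h1 | h1 <;>
      rcases hs (((i : ℕ) : ℤ) - ((k : ℕ) : ℤ)) with h2 | h2 | h2 <;>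
        rw [h1.2, h2.2] <;> split_ifs <;> omega

theorem entry_opS_add_entry_opSadj {X : Alg 𝕜 N b} (hX : trace0 𝕜 N b X = 0) {j k : Fin N}
    (h : Occurs N b 1 j k) :
    entry 𝕜 N b 0 k k (opS 𝕜 N b X) + entry 𝕜 N b 0 j j (opSadj 𝕜 N b X) = 0 := by
  obtain ⟨c, hc⟩ := exists_sign_sub_sign_eq h
  have h1 : (c : 𝕜) * trace0 𝕜 N b X = 0 := by rw [hX, mul_zero]
  rw [trace0_apply, Finset.mul_sum] at h1
  rw [← h1, opS, opSadj, LinearMap.sub_apply, LinearMap.add_apply, map_sub, map_add, entry_opP₀,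
    entry_opP₀, entry_opW, entry_opW]
  have h2 : ∀ i : Fin N, (c : 𝕜) * entry 𝕜 N b 0 i i X =
      (if i = k then entry 𝕜 N b 0 i i X else 0) + (if i = j then entry 𝕜 N b 0 i i X else 0) +
      ((((i : ℕ) : ℤ) - ((j : ℕ) : ℤ)).sign : 𝕜) * entry 𝕜 N b 0 i i X -
      ((((i : ℕ) : ℤ) - ((k : ℕ) : ℤ)).sign : 𝕜) * entry 𝕜 N b 0 i i X := fun i => by
    rw [← hc i]
    push_cast
    split_ifs <;> ring
  rw [Finset.sum_congr rfl fun i _ => h2 i, Finset.sum_sub_distrib, Finset.sum_add_distrib,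
    Finset.sum_add_distrib]
  simp only [Finset.sum_ite_eq', Finset.mem_univ, if_true]
  ring

/-- The vector is `L S(x) + S*(x) L`, with the traceless `x = z - y + q - v`, minus twice `L y₋ - z₋
L`. The degree-one entries of the former vanish by `entry_opS_add_entry_opSadj`. The latter has
degree at most `0`, and `L y = z L` rewrites it with nonnegative parts, so its degree is also at
least `0`. -/
theorem lax_left_mem {L y z q v : Alg 𝕜 N b} (hL : L ∈ degreesIn 𝕜 (Alg 𝕜 N b) (Set.Icc 0 1))
    (h : L * y = z * L) (hyz : trace0 𝕜 N b z = trace0 𝕜 N b y)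
    (hqv : trace0 𝕜 N b q = trace0 𝕜 N b v) :
    L * (opA₁ 𝕜 N b y - opS 𝕜 N b v + (opS 𝕜 N b z + opS 𝕜 N b q))
      - (opA₂ 𝕜 N b z - opSadj 𝕜 N b q + (opSadj 𝕜 N b y + opSadj 𝕜 N b v)) * L ∈
      degreesIn 𝕜 (Alg 𝕜 N b) {0} := by
  have h0 : ∀ {D D' : Alg 𝕜 N b}, D ∈ degreesIn 𝕜 (Alg 𝕜 N b) {0} →
      D' ∈ degreesIn 𝕜 (Alg 𝕜 N b) {0} → L * D - D' * L ∈ degreesIn 𝕜 (Alg 𝕜 N b) (Set.Icc 0 1) :=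
    fun hD hD' => sub_mem (mul_mem_degreesIn (fun p hp r hr => by simp_all) hL hD)
      (mul_mem_degreesIn (fun p hp r hr => by simp_all) hD' hL)
  have hneg : L * proj 𝕜 N b (Set.Iio 0) y - proj 𝕜 N b (Set.Iio 0) z * L ∈
      degreesIn 𝕜 (Alg 𝕜 N b) (Set.Iic 0) :=
    sub_mem (mul_mem_degreesIn (fun p hp r hr => by
        rw [Set.mem_Icc] at hp; rw [Set.mem_Iio] at hr; rw [Set.mem_Iic]; omega) hL (proj_mem _ y))
      (mul_mem_degreesIn (fun p hp r hr => by
        rw [Set.mem_Icc] at hr; rw [Set.mem_Iio] at hp; rw [Set.mem_Iic]; omega) (proj_mem _ z) hL)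
  have hpos : L * proj 𝕜 N b (Set.Ioi 0) y - proj 𝕜 N b (Set.Ioi 0) z * L ∈
      degreesIn 𝕜 (Alg 𝕜 N b) (Set.Ici 0) :=
    sub_mem (mul_mem_degreesIn (fun p hp r hr => by
        rw [Set.mem_Icc] at hp; rw [Set.mem_Ioi] at hr; rw [Set.mem_Ici]; omega) hL (proj_mem _ y))
      (mul_mem_degreesIn (fun p hp r hr => by
        rw [Set.mem_Icc] at hr; rw [Set.mem_Ioi] at hp; rw [Set.mem_Ici]; omega) (proj_mem _ z) hL)
  have hdiag := h0 (proj_mem {0} y) (proj_mem {0} z)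
  have hx : trace0 𝕜 N b (z - y + q - v) = 0 := by
    rw [map_sub, map_add, map_sub, hyz, hqv]
    ring
  have hE : L * opS 𝕜 N b (z - y + q - v) - -opSadj 𝕜 N b (z - y + q - v) * L ∈
      degreesIn 𝕜 (Alg 𝕜 N b) {0} := by
    refine mem_degreesIn_iff.2 fun p hp j k => ?_
    rw [neg_mul, sub_neg_eq_add, map_add, entry_mul_diag (opS_mem _), entry_diag_mul (opSadj_mem _),
      mul_comm _ (entry 𝕜 N b p j k L), ← mul_add]
    by_cases hp1 : p = 1
    · subst hp1
      by_cases hO : Occurs N b 1 j k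
      · rw [entry_opS_add_entry_opSadj hx hO, mul_zero]
      · rw [entry_eq_zero hO, zero_mul]
    · rw [mem_degreesIn_iff.1 hL p (fun h => ?_), zero_mul]
      rw [Set.mem_Icc] at h
      rw [Set.mem_singleton_iff] at hp
      omega
  have hy := proj_add_proj_add_proj y
  have hz := proj_add_proj_add_proj z
  have h' : L * (proj 𝕜 N b (Set.Ioi 0) y + proj 𝕜 N b {0} y + proj 𝕜 N b (Set.Iio 0) y) -
      (proj 𝕜 N b (Set.Ioi 0) z + proj 𝕜 N b {0} z + proj 𝕜 N b (Set.Iio 0) z) * L = 0 := by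
    rw [hy, hz, h, sub_self]
  have hneg' : L * proj 𝕜 N b (Set.Iio 0) y - proj 𝕜 N b (Set.Iio 0) z * L ∈
      degreesIn 𝕜 (Alg 𝕜 N b) (Set.Ici 0) := by
    have h2 : L * proj 𝕜 N b (Set.Iio 0) y - proj 𝕜 N b (Set.Iio 0) z * L =
        -(L * proj 𝕜 N b (Set.Ioi 0) y - proj 𝕜 N b (Set.Ioi 0) z * L) -
        (L * proj 𝕜 N b {0} y - proj 𝕜 N b {0} z * L) := by
      rw [← sub_eq_zero, ← h']
      noncomm_ring
    rw [h2]
    exact sub_mem (neg_mem hpos) (degreesIn_mono Set.Icc_subset_Ici_self hdiag)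
  have hneg₀ := mem_degreesIn_of_inter (u := {0})
    (fun p (hp : p ≤ 0) (hp' : 0 ≤ p) => le_antisymm hp hp') hneg hneg'
  have h3 : L * (opA₁ 𝕜 N b y - opS 𝕜 N b v + (opS 𝕜 N b z + opS 𝕜 N b q))
      - (opA₂ 𝕜 N b z - opSadj 𝕜 N b q + (opSadj 𝕜 N b y + opSadj 𝕜 N b v)) * L =
      (L * opS 𝕜 N b (z - y + q - v) - -opSadj 𝕜 N b (z - y + q - v) * L) -
      (L * proj 𝕜 N b (Set.Iio 0) y - proj 𝕜 N b (Set.Iio 0) z * L) -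
      (L * proj 𝕜 N b (Set.Iio 0) y - proj 𝕜 N b (Set.Iio 0) z * L) := by
    rw [← sub_eq_zero, ← h']
    simp only [opA₁, opA₂, opS, opSadj, opR₀, opP₀, map_add, map_sub, LinearMap.add_apply,
      LinearMap.sub_apply]
    noncomm_ring
  rw [h3]
  exact sub_mem (sub_mem hE hneg₀) hneg₀

/-- As for `L`, the relation `U q = v U` confines `U q₋ - v₋ U` to the degrees from `-m` to `-1`.
The diagonal-valued operators combine into the commutator of `U` with a single diagonal `g`; the
unit of `U` drops out, so no degree-zero term arises. -/
theorem lax_right_mem {U y z q v : Alg 𝕜 N b}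
    (hU : U - 1 ∈ degreesIn 𝕜 (Alg 𝕜 N b) (Set.Icc (-(m : ℤ)) (-1))) (h : U * q = v * U) :
    U * (opS 𝕜 N b z + opA₂ 𝕜 N b q + (opSadj 𝕜 N b y - opS 𝕜 N b v))
      - (opSadj 𝕜 N b y + opA₁ 𝕜 N b v + (opS 𝕜 N b z - opSadj 𝕜 N b q)) * U ∈
      degreesIn 𝕜 (Alg 𝕜 N b) (Set.Icc (-(m : ℤ)) (-1)) := by
  have hU' : U ∈ degreesIn 𝕜 (Alg 𝕜 N b) (Set.Icc (-(m : ℤ)) 0) := by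
    rw [← sub_add_cancel U 1]
    exact add_mem (degreesIn_mono (Set.Icc_subset_Icc_right (by simp)) hU)
      (one_mem_degreesIn (by simp))
  have hneg : U * proj 𝕜 N b (Set.Iio 0) q - proj 𝕜 N b (Set.Iio 0) v * U ∈
      degreesIn 𝕜 (Alg 𝕜 N b) (Set.Iic (-1)) :=
    sub_mem (mul_mem_degreesIn (fun p hp r hr => by
        rw [Set.mem_Icc] at hp; rw [Set.mem_Iio] at hr; rw [Set.mem_Iic]; omega) hU' (proj_mem _ q))
      (mul_mem_degreesIn (fun p hp r hr => by
        rw [Set.mem_Icc] at hr; rw [Set.mem_Iio] at hp; rw [Set.mem_Iic]; omega) (proj_mem _ v) hU')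
  have hpos : U * proj 𝕜 N b (Set.Ioi 0) q - proj 𝕜 N b (Set.Ioi 0) v * U ∈
      degreesIn 𝕜 (Alg 𝕜 N b) (Set.Ici (-(m : ℤ))) :=
    sub_mem (mul_mem_degreesIn (fun p hp r hr => by
        rw [Set.mem_Icc] at hp; rw [Set.mem_Ioi] at hr; rw [Set.mem_Ici]; omega) hU' (proj_mem _ q))
      (mul_mem_degreesIn (fun p hp r hr => by
        rw [Set.mem_Icc] at hr; rw [Set.mem_Ioi] at hp; rw [Set.mem_Ici]; omega) (proj_mem _ v) hU')
  have hdiag : U * proj 𝕜 N b {0} q - proj 𝕜 N b {0} v * U ∈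
      degreesIn 𝕜 (Alg 𝕜 N b) (Set.Ici (-(m : ℤ))) :=
    sub_mem (mul_mem_degreesIn (fun p hp r hr => by simp_all) hU' (proj_mem _ q))
      (mul_mem_degreesIn (fun p hp r hr => by simp_all) (proj_mem _ v) hU')
  have h' : U * (proj 𝕜 N b (Set.Ioi 0) q + proj 𝕜 N b {0} q + proj 𝕜 N b (Set.Iio 0) q) -
      (proj 𝕜 N b (Set.Ioi 0) v + proj 𝕜 N b {0} v + proj 𝕜 N b (Set.Iio 0) v) * U = 0 := by
    rw [proj_add_proj_add_proj, proj_add_proj_add_proj, h, sub_self]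
  have hneg' : U * proj 𝕜 N b (Set.Iio 0) q - proj 𝕜 N b (Set.Iio 0) v * U ∈
      degreesIn 𝕜 (Alg 𝕜 N b) (Set.Ici (-(m : ℤ))) := by
    have h2 : U * proj 𝕜 N b (Set.Iio 0) q - proj 𝕜 N b (Set.Iio 0) v * U =
        -(U * proj 𝕜 N b (Set.Ioi 0) q - proj 𝕜 N b (Set.Ioi 0) v * U) -
        (U * proj 𝕜 N b {0} q - proj 𝕜 N b {0} v * U) := by
      rw [← sub_eq_zero, ← h']
      noncomm_ring
    rw [h2]
    exact sub_mem (neg_mem hpos) hdiag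
  have hneg₀ := mem_degreesIn_of_inter (u := Set.Icc (-(m : ℤ)) (-1))
    (fun p hp hp' => ⟨hp', hp⟩) hneg hneg'
  obtain ⟨g, hg, hgdef⟩ : ∃ g ∈ degreesIn 𝕜 (Alg 𝕜 N b) {0},
      g = opS 𝕜 N b z + opSadj 𝕜 N b y - opS 𝕜 N b v - opSadj 𝕜 N b q :=
    ⟨_, sub_mem (sub_mem (add_mem (opS_mem _) (opSadj_mem _)) (opS_mem _)) (opSadj_mem _), rfl⟩
  have hcomm : (U - 1) * g - g * (U - 1) ∈
      degreesIn 𝕜 (Alg 𝕜 N b) (Set.Icc (-(m : ℤ)) (-1)) :=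
    sub_mem (mul_mem_degreesIn (fun p hp r hr => by simp_all) hU hg)
      (mul_mem_degreesIn (fun p hp r hr => by simp_all) hg hU)
  have h3 : U * (opS 𝕜 N b z + opA₂ 𝕜 N b q + (opSadj 𝕜 N b y - opS 𝕜 N b v))
      - (opSadj 𝕜 N b y + opA₁ 𝕜 N b v + (opS 𝕜 N b z - opSadj 𝕜 N b q)) * U =
      ((U - 1) * g - g * (U - 1)) -
      (U * proj 𝕜 N b (Set.Iio 0) q - proj 𝕜 N b (Set.Iio 0) v * U) -
      (U * proj 𝕜 N b (Set.Iio 0) q - proj 𝕜 N b (Set.Iio 0) v * U) := by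
    rw [← sub_eq_zero, ← h', hgdef]
    simp only [opA₁, opA₂, opS, opSadj, opR₀, opP₀, LinearMap.add_apply,
      LinearMap.sub_apply]
    noncomm_ring
  rw [h3]
  exact sub_mem (sub_mem hcomm hneg₀) hneg₀

theorem isPoissonSubmanifold_laxMap {α : 𝕜} (hα : α ≠ 0) :
    IsPoissonSubmanifold (bigBracket α) (laxMap (N := N) (m := m) (b := b) α) where
  bounded u := ⟨1, Filter.Eventually.of_forall fun w => mem_degreesIn_prod.2
    ⟨degreesIn_mono Set.Icc_subset_Iic_self (laxL_mem α w),
      degreesIn_mono (Set.Iic_subset_Iic.2 zero_le_one) (inverse_laxU_mem α w)⟩⟩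
  smooth := contDiff_coord_laxMap α
  immersion u w h := eq_zero_of_fderiv_laxMap hα h
  embedding := isEmbedding_laxMap hα
  tangent φ u _ := by
    have hB := isCoordAlg_form 𝕜 N b
    have hv := hB.prod.isHamiltonianVector (A₁ := bigA₁ 𝕜 N b) (A₂ := bigA₂ 𝕜 N b)
      isRMatrixBracket_big.adj α φ (laxMap α u)
    refine ⟨_, hv, ?_⟩
    obtain ⟨hUV, hVU⟩ := laxU_mul_inverse α u
    have hU := laxULin_mem α u
    rw [← add_sub_cancel_left 1 (laxULin α u), ← laxU_eq] at hU
    obtain ⟨F₁, F₂⟩ := grad (prodForm (form 𝕜 N b)) φ (laxMap α u)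
    rw [laxMap, hamVector_big]
    simp only [fderiv_coord_laxMap]
    generalize Ring.inverse (laxU α u) = V at *
    have hL := laxL_mem α u
    generalize laxL α u = L at *
    obtain ⟨w, hw, hw'⟩ := exists_laxLin_eq hα
      (Submodule.smul_mem _ α (Submodule.smul_mem _ (1 / 2 : 𝕜)
        (lax_left_mem (y := F₁ * L) (z := L * F₁) (q := V * F₂) (v := F₂ * V) hL
          (mul_assoc _ _ _).symm (trace0_mul_comm _ _) (trace0_mul_comm _ _))))
      (Submodule.smul_mem _ α (Submodule.smul_mem _ (1 / 2 : 𝕜)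
        (lax_right_mem (y := F₁ * L) (z := L * F₁) (q := V * F₂) (v := F₂ * V) hU (by
          rw [← mul_assoc, hUV, mul_assoc, hVU, one_mul, mul_one]))))
    refine ⟨w, fun i => ?_⟩
    rw [hw, hw', Prod.smul_mk]
    congr 2
    generalize laxU α u = U at *
    -- Since `V = U⁻¹` moves with velocity `-V U̇ V`, the vector computed for `U` becomes the second
    -- component of the Hamiltonian vector.
    have e : ∀ a c : Alg 𝕜 N b, V * (U * c - a * U) * V = c * V - V * a := fun a c => by
      rw [show V * (U * c - a * U) * V = (V * U) * c * V - V * a * (U * V) by noncomm_ring, hUV,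
        hVU, one_mul, mul_one]
    rw [mul_smul_comm, smul_mul_assoc, mul_smul_comm, smul_mul_assoc, e, ← smul_neg, ← smul_neg,
      neg_sub]

end Tangent

end RelToda

theorem mainTheorem5 {𝕜 : Type*} [RCLike 𝕜] (N m : ℕ) (b : Boundary) (α : 𝕜) (hα : α ≠ 0) :
    -- the operators are skew-symmetric, resp. adjoint, and the brackets are Poisson brackets
    ((∀ x y, form 𝕜 N b (opA₁ 𝕜 N b x) y = -form 𝕜 N b x (opA₁ 𝕜 N b y)) ∧
      (∀ x y, form 𝕜 N b (opA₂ 𝕜 N b x) y = -form 𝕜 N b x (opA₂ 𝕜 N b y)) ∧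
      (∀ x y, form 𝕜 N b (opS 𝕜 N b x) y = form 𝕜 N b x (opSadj 𝕜 N b y)) ∧
      (∀ x y, prodForm (form 𝕜 N b) (bigA₁ 𝕜 N b x) y =
        -prodForm (form 𝕜 N b) x (bigA₁ 𝕜 N b y)) ∧
      (∀ x y, prodForm (form 𝕜 N b) (bigA₂ 𝕜 N b x) y =
        -prodForm (form 𝕜 N b) x (bigA₂ 𝕜 N b y)) ∧
      (∀ x y, prodForm (form 𝕜 N b) (bigS 𝕜 N b x) y =
        prodForm (form 𝕜 N b) x (bigSadj 𝕜 N b y)) ∧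
      IsPoissonBracket (smallBracket (N := N) (b := b) α) ∧
      IsPoissonBracket (bigBracket (N := N) (b := b) α)) ∧
    -- (a)
    (Set.range (laxMap (N := N) (m := m) (b := b) α) = laxSet m α ∧
      IsPoissonSubmanifold (bigBracket α) (laxMap (N := N) (m := m) (b := b) α)) ∧
    -- (b)
    (IsPoissonMap (bigBracket α) (smallBracket α) (monodromy₁ (Alg 𝕜 N b)) ∧
      IsPoissonMap (bigBracket α) (smallBracket α) (monodromy₂ (Alg 𝕜 N b))) ∧
    -- (c)
    (∀ φ : Alg 𝕜 N b → 𝕜, AdInvariant φ →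
      ∀ M : Alg 𝕜 N b × Alg 𝕜 N b → Alg 𝕜 N b,
        (M = monodromy₁ (Alg 𝕜 N b) ∨ M = monodromy₂ (Alg 𝕜 N b)) →
      -- the Hamiltonian vector field of `φ ∘ M`, with `U̇ = -U V̇ U` for `V = U⁻¹`
      (∀ L U V : Alg 𝕜 N b, U * V = 1 → V * U = 1 →
        SmoothAt φ (L * V) → SmoothAt φ (V * L) →
        ∃ L' V' : Alg 𝕜 N b, IsHamiltonianVector (bigBracket α) (φ ∘ M) (L, V) (L', V') ∧
          L' = L * laxC α φ (V * L) - laxC α φ (L * V) * L ∧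
          -(U * V' * U) = U * laxC α φ (V * L) - laxC α φ (L * V) * U) ∧
      -- the equations of motion
      (∀ (L U V : ℝ → Alg 𝕜 N b) (L' U' V' : Alg 𝕜 N b) (t : ℝ),
        (∀ s, U s * V s = 1 ∧ V s * U s = 1) →
        SmoothAt φ (L t * V t) → SmoothAt φ (V t * L t) →
        HasVelocity 𝕜 L L' t → HasVelocity 𝕜 U U' t → HasVelocity 𝕜 V V' t →
        (HamiltonEquation (bigBracket α) (φ ∘ M) (fun s => (L s, V s)) t ↔
          L' = L t * laxC α φ (V t * L t) - laxC α φ (L t * V t) * L t ∧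
          U' = U t * laxC α φ (V t * L t) - laxC α φ (L t * V t) * U t))) := by
  have hskew := isRMatrixBracket_big (𝕜 := 𝕜) (N := N) (b := b)
  exact ⟨⟨form_opA₁, form_opA₂, form_opS, hskew.skew₁, hskew.skew₂, hskew.adj,
      isPoissonBracket_small α, isPoissonBracket_big α⟩,
    ⟨range_laxMap hα, isPoissonSubmanifold_laxMap hα⟩,
    ⟨isPoissonMap_monodromy₁ α, isPoissonMap_monodromy₂ α⟩,
    fun _ hinv _ hM => ⟨fun _ _ _ hUV hVU h₁ h₂ =>
        hinv.exists_hamiltonianVector α hM hUV hVU h₁ h₂,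
      fun _ _ _ _ _ _ _ hUV h₁ h₂ hL hU hV =>
        hinv.hamiltonEquation_iff_laxTriad α hM hUV h₁ h₂ hL hU hV⟩⟩
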